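/- **Language.** Let $\mathcal F$ and $\mathcal G$ be disjoint sets of connectives; each $h\in\mathcal F\cup\mathcal G$ has an arity $n_h\ge 0$ and an order-type $\varepsilon_h\in\{1,\partial\}^{n_h}$. $\mathcal L_{\mathrm{DLE}}$-terms are built from proposition letters with $\top,\bot,\wedge,\vee$ and the connectives in $\mathcal F\cup\mathcal G$. A *perfect DLE* is a complete, completely distributive lattice $A$ that is completely join-generated by its completely join-prime elements, with operations $f^{\mathbb A}$, $g^{\mathbb A}$ such that in each coordinate $f$ preserves arbitrary joins if $\varepsilon_f(i)=1$ and turns arbitrary meets into joins if $\varepsilon_f(i)=\partial$, and $g$ preserves arbitrary meets if $\varepsilon_g(i)=1$ and turns arbitrary joins into meets if $\varepsilon_g(i)=\partial$. An inequality or quasi-inequality is *valid* if it is true under all assignments. The expanded language $\mathcal L^*_{\mathrm{DLE}}$ adds the residuals of $\wedge$ and $\vee$ in both coordinates, and for every coordinate $i$ the residuals $f^\sharp_i$ and $g^\flat_i$; every perfect DLE interprets them. The residuals of $\vee$, the $f^\sharp_i$ with $\varepsilon_f(i)=\partial$ and the $g^\flat_i$ with $\varepsilon_g(i)=1$ belong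 to the extended family $\mathcal F^*\supseteq\mathcal F$; the residuals of $\wedge$, the $f^\sharp_i$ with $\varepsilon_f(i)=1$ and the $g^\flat_i$ with $\varepsilon_g(i)=\partial$ belong to $\mathcal G^*\supseteq\mathcal G$. **Analytic inductive inequalities.** Signs are propagated from the root of a generation tree, changing exactly at coordinates with order-type $\partial$. *Skeleton* nodes are $\pm\wedge,\pm\vee,+f,-g$; *PIA* nodes are $\pm\wedge,\pm\vee,+g,-f$ (for connectives of every arity, including $0$); $\pm\top,\pm\bot$ count as both. *SRR* nodes are $+\vee$, $-\wedge$, and $+g$, $-f$ of arity $\ge2$. A branch is *good* if, read from the root, it is a (possibly empty) path $P_2$ of Skeleton nodes followed by a (possibly empty) path $P_1$ of PIA nodes. Let $\Omega$ be an irreflexive transitive relation on the proposition letters and $\epsilon$ an order-type on them. A leaf $+p$ with $\epsilon(p)=1$ or $-p$ with $\epsilon(p)=\partial$ is *critical*. A signed tree is *analytic $(\Omega,\epsilon)$-inductive* if every branch is good and each branch ending in a critical leaf labelled $p$ has a decomposition $P_2,P_1$ as above such that at each SRR node on $P_1$ the immediate subtrees off the branch contain no critical leaf, and only letters $x$ with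 $x\mathrel{\Omega}p$. An inequality $s\le t$ is *analytic $(\Omega,\epsilon)$-inductive* if both $+s$ and $-t$ are. **Structural rules.** Structures of the display calculus $\mathbf{DL}$ are built from structural variables with the structural connectives $\mathrm I$, $;$, $>$, $<$, $H_f$, $K_g$ and the structural counterparts of all $f^\sharp_i$, $g^\flat_i$. In precedent position, $\mathrm I,\,;$ are read as $\top,\wedge$, the connectives $>,<$ as the residuals of $\vee$, and $H_f$ as $f$; in succedent position, $\mathrm I,\,;$ are read as $\bot,\vee$, the connectives $>,<$ as the residuals of $\wedge$, and $K_g$ as $g$; the counterparts of residuals are allowed in precedent position when the residual belongs to $\mathcal F^*$ and in succedent position when it belongs to $\mathcal G^*$, and are read as that residual. (A structure is well-formed for its position if all its connectives have such a reading.) A structural rule has finitely many premise sequents and a conclusion sequent of this kind; its *associated quasi-inequality* says that the readings of the premises imply the reading of the conclusion, with structural variables read as proposition letters, and the rule is *valid* on a perfect DLE if this quasi-inequality is. In the instances of a rule (arbitrary structures over formulas are assigned to the structural variables), the parts of the structures assigned to the variables are the parameters, and corresponding parts of all occurrences of one and the same variable are congruent. The rule is *analytic* if its instances satisfy C$_1$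 (every formula occurring in a premise is a subformula of a formula in the conclusion), C$_2$ (congruent parameters are occurrences of the same structure), C$_3$ (each parameter is congruent to at most one parameter in the conclusion), C$_4$ (congruent parameters in a premise and in the conclusion are in the same position, precedent or succedent), C$_5$ (a non-parametric formula in the conclusion is an entire side of it), and C$_6$, C$_7$ (replacing all occurrences congruent to a parametric formula in succedent, resp. precedent, position by any structure gives again an instance of the rule). It is *quasi-special* if it is analytic and each premise has the form $S\vdash Y$ or $X\vdash T$, where the displayed variables $Y$ (resp. $X$) occur exactly once in the conclusion, in succedent (resp. precedent) position, and in none of the structures $S$, $T$ of the premises. **ALBA reductions.** An ALBA reduction is a finite sequence of steps, each of which replaces one quasi-inequality of a finite system by finitely many ones, where a step is one of the following. 1. In the conclusion or in a premise: distribution of $f\in\mathcal F^*\cup\{\wedge\}$ over $\vee$ (over $\wedge$ in $\partial$-coordinates) and of $g\in\mathcal G^*\cup\{\vee\}$ over $\wedge$ (over $\vee$ in $\partial$-coordinates); replacement of $f(\dots,\bot,\dots)$ ($\top$ in $\partial$-coordinates) by $\bot$ and of $g(\dots,\top,\dots)$ ($\bot$ in $\partial$-coordinates) by $\top$; splitting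 of $a\le b\wedge c$ and of $a\vee b\le c$; deletion of $a\le\top$ and of $\bot\le a$. 2. Adjunction/residuation in a premise, for $f\in\mathcal F$, $g\in\mathcal G$, $\wedge$ or $\vee$, in any coordinate. 3. The inverted Ackermann rule: a premise-free inequality $s(\vec\alpha/\vec x)\le t(\vec\alpha/\vec x)$, where each variable in $\vec x$ occurs exactly once in $s\le t$, no other variable occurs in it, and no variable in $\vec x$ occurs in $\vec\alpha$, is replaced by the quasi-inequality with conclusion $s\le t$ and with one premise for each $x_k$: $x_k\le\alpha_k$ if $x_k$ occurs positively in $+s$ or in $-t$, and $\alpha_k\le x_k$ if it occurs negatively there. 4. The Ackermann rules: if $p$ occurs neither in the conclusion nor in $\alpha_1,\dots,\alpha_n$ ($n\ge0$), the premises $\alpha_1\le p,\dots,\alpha_n\le p$ are deleted and $\alpha_1\vee\dots\vee\alpha_n$ is substituted for $p$ in all the other premises $a\le b$, provided that in each of them $p$ occurs only positively in $a$ and only negatively in $b$; and the order-dual rule, with premises $p\le\alpha_1,\dots,p\le\alpha_n$, the term $\alpha_1\wedge\dots\wedge\alpha_n$, and the opposite polarities. **Proposition.** For all $\mathcal F,\mathcal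 G$, all irreflexive and transitive $\Omega$, every $\epsilon$, and every analytic $(\Omega,\epsilon)$-inductive $\mathcal L_{\mathrm{DLE}}$-inequality $s\le t$, there is a finite (possibly empty) set $R$ of quasi-special structural rules of $\mathbf{DL}$ for $\mathcal L_{\mathrm{DLE}}$ (in particular, they satisfy C$_1$–C$_7$) such that * some ALBA reduction transforms $s\le t$ into the system of the quasi-inequalities associated with the rules in $R$; and * for every perfect DLE $\mathbb A$, the inequality $s\le t$ is valid on $\mathbb A$ if and only if every rule in $R$ is valid on $\mathbb A$. -/

import Mathlib

universe u v w

namespace DLE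

/-! ## Signs, signatures with order-types, terms -/

/-- Signs. `pos` stands for `+`, for the order-type value `1` and for precedent position;
`neg` stands for `−`, for the order-type value `∂` and for succedent position. -/
inductive Sgn where
  | pos
  | neg
  deriving DecidableEq

def Sgn.flip : Sgn → Sgn
  | .pos => .neg
  | .neg => .pos

def Sgn.mul : Sgn → Sgn → Sgn
  | .pos, s => s
  | .neg, s => s.flip

/-- A set of connectives, each with an arity and an order-type over its arity. -/
structure OSig where
  Op : Type u
  ar : Op → ℕ
  eps : (o : Op) → Fin (ar o) → Sgn

/-- Generation trees over a signature, with leaves from `α`. -/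
inductive Tm (S : OSig.{u}) (α : Type v) : Type (max u v) where
  | var : α → Tm S α
  | node : (o : S.Op) → (Fin (S.ar o) → Tm S α) → Tm S α

namespace Tm

variable {S : OSig.{u}} {α : Type v} {β : Type w}

/-- Simultaneous substitution for the leaves. -/
def subst (σ : α → Tm S β) : Tm S α → Tm S β
  | .var x => σ x
  | .node o a => .node o fun i => (a i).subst σ

/-- The list of all `α`-leaves of the signed generation tree with root sign `s`, each with its
sign. -/
def leaves : Sgn → Tm S α → List (Sgn × α)
  | s, .var x => [(s, x)]
  | s, .node o a => (List.finRange (S.ar o)).flatMap fun i => (a i).leaves (s.mul (S.eps o i))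

/-- `SubAt s t p s' u`: in the signed generation tree of `t` with root sign `s`, the node reached
along the path `p` carries the sign `s'` and is the root of the subtree `u`. -/
inductive SubAt : Sgn → Tm S α → List ℕ → Sgn → Tm S α → Prop where
  | root (s : Sgn) (t : Tm S α) : SubAt s t [] s t
  | step (s s' : Sgn) (o : S.Op) (a : Fin (S.ar o) → Tm S α) (i : Fin (S.ar o)) (p : List ℕ)
      (u : Tm S α) : SubAt (s.mul (S.eps o i)) (a i) p s' u →
      SubAt s (.node o a) (i.val :: p) s' u

open Classical in
/-- Simultaneous replacement by `z` of the subtrees at the positions in `P`. -/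
noncomputable def replace (z : Tm S α) : (List ℕ → Prop) → Tm S α → Tm S α
  | P, .var x => if P [] then z else .var x
  | P, .node o a =>
      if P [] then z else .node o fun i => replace z (fun p => P (i.val :: p)) (a i)

/-- A connective node on a branch of a signed generation tree: its sign, its label, its immediate
subtrees, and the coordinate through which the branch continues (`none` if the branch ends in
this node). -/
structure BNode (S : OSig.{u}) (α : Type v) where
  sgn : Sgn
  op : S.Op
  args : Fin (S.ar op) → Tm S α
  next : Option (Fin (S.ar op))

/-- `IsBranch s t ns l`: `ns` lists, from the root to the leaf, the connective nodes of a branch of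
the signed generation tree of `t` with root sign `s`; the branch ends in the signed variable `x`
if `l = some (s', x)`, and in a connective of arity `0` if `l = none`. -/
inductive IsBranch : Sgn → Tm S α → List (BNode S α) → Option (Sgn × α) → Prop where
  | var (s : Sgn) (x : α) : IsBranch s (.var x) [] (some (s, x))
  | const (s : Sgn) (o : S.Op) (a : Fin (S.ar o) → Tm S α) : S.ar o = 0 →
      IsBranch s (.node o a) [⟨s, o, a, none⟩] none
  | step (s : Sgn) (o : S.Op) (a : Fin (S.ar o) → Tm S α) (i : Fin (S.ar o))
      (ns : List (BNode S α)) (l : Option (Sgn × α)) :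
      IsBranch (s.mul (S.eps o i)) (a i) ns l →
      IsBranch s (.node o a) (⟨s, o, a, some i⟩ :: ns) l

end Tm

/-! ## DLE-languages and their perfect algebras -/

/-- The parameters of a DLE-language: the (disjoint) families `F` and `G` of connectives. -/
structure Lang where
  F : OSig.{u}
  G : OSig.{u}

inductive Conn (L : Lang.{u}) : Type u where
  | top
  | bot
  | meet
  | join
  | F (f : L.F.Op)
  | G (g : L.G.Op)

namespace Conn

variable {L : Lang.{u}}

abbrev ar : Conn L → ℕ
  | .top => 0
  | .bot => 0
  | .meet => 2
  | .join => 2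
  | .F f => L.F.ar f
  | .G g => L.G.ar g

abbrev eps : (c : Conn L) → Fin c.ar → Sgn
  | .top => fun _ => .pos
  | .bot => fun _ => .pos
  | .meet => fun _ => .pos
  | .join => fun _ => .pos
  | .F f => L.F.eps f
  | .G g => L.G.eps g

/-- Membership in `F ∪ {∧}`. -/
def FLike : Conn L → Prop
  | .meet => True
  | .F _ => True
  | _ => False

/-- Membership in `G ∪ {∨}`. -/
def GLike : Conn L → Prop
  | .join => True
  | .G _ => True
  | _ => False

end Conn

/-- All the logical connectives of the language. -/
abbrev Lang.conn (L : Lang.{u}) : OSig.{u} := ⟨Conn L, Conn.ar, Conn.eps⟩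

/-- The terms of the language over the proposition letters `0, 1, 2, …`. -/
abbrev Term (L : Lang.{u}) : Type u := Tm L.conn ℕ

namespace Term

variable {L : Lang.{u}}

def top : Term L := .node Conn.top Fin.elim0
def bot : Term L := .node Conn.bot Fin.elim0
def meet (x y : Term L) : Term L := .node Conn.meet ![x, y]
def join (x y : Term L) : Term L := .node Conn.join ![x, y]

end Term

/-- The operations that interpret the connectives of the language on `A`. -/
structure Alg (L : Lang.{u}) (A : Type w) where
  opF : (f : L.F.Op) → (Fin (L.F.ar f) → A) → A
  opG : (g : L.G.Op) → (Fin (L.G.ar g) → A) → A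

namespace Alg

variable {L : Lang.{u}} {A : Type w} [CompletelyDistribLattice A]

/-- Completely join-prime elements. -/
def JoinPrime (j : A) : Prop := ∀ X : Set A, j ≤ sSup X → ∃ x ∈ X, j ≤ x

/-- Perfect (normal) DLEs: the lattice is complete, completely distributive and completely
join-generated by its completely join-prime elements, and coordinatewise every `f` preserves all
joins, resp. turns all meets into joins, and every `g` preserves all meets, resp. turns all joins
into meets, as its order-type prescribes. -/
structure IsPerfect (𝔸 : Alg L A) : Prop where
  joinGenerated : ∀ a : A, a = sSup {j : A | JoinPrime j ∧ j ≤ a}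
  F_pos : ∀ f i, L.F.eps f i = .pos → ∀ (a : Fin (L.F.ar f) → A) (X : Set A),
    𝔸.opF f (Function.update a i (sSup X)) = ⨆ x ∈ X, 𝔸.opF f (Function.update a i x)
  F_neg : ∀ f i, L.F.eps f i = .neg → ∀ (a : Fin (L.F.ar f) → A) (X : Set A),
    𝔸.opF f (Function.update a i (sInf X)) = ⨆ x ∈ X, 𝔸.opF f (Function.update a i x)
  G_pos : ∀ g i, L.G.eps g i = .pos → ∀ (a : Fin (L.G.ar g) → A) (X : Set A),
    𝔸.opG g (Function.update a i (sInf X)) = ⨅ x ∈ X, 𝔸.opG g (Function.update a i x)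
  G_neg : ∀ g i, L.G.eps g i = .neg → ∀ (a : Fin (L.G.ar g) → A) (X : Set A),
    𝔸.opG g (Function.update a i (sSup X)) = ⨅ x ∈ X, 𝔸.opG g (Function.update a i x)

def interp (𝔸 : Alg L A) : (c : Conn L) → (Fin c.ar → A) → A
  | .top, _ => ⊤
  | .bot, _ => ⊥
  | .meet, a => a (0 : Fin 2) ⊓ a (1 : Fin 2)
  | .join, a => a (0 : Fin 2) ⊔ a (1 : Fin 2)
  | .F f, a => 𝔸.opF f a
  | .G g, a => 𝔸.opG g a

def eval (𝔸 : Alg L A) (v : ℕ → A) : Term L → A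
  | .var x => v x
  | .node c a => 𝔸.interp c fun i => 𝔸.eval v (a i)

end Alg

/-- Inequalities `lhs ≤ rhs`. -/
structure Ineq (L : Lang.{u}) where
  lhs : Term L
  rhs : Term L

/-- Quasi-inequalities: the conjunction of `prems` implies `concl`. -/
structure QIneq (L : Lang.{u}) where
  prems : List (Ineq L)
  concl : Ineq L

section Validity

variable {L : Lang.{u}} {A : Type w} [CompletelyDistribLattice A]

def Ineq.Holds (e : Ineq L) (𝔸 : Alg L A) (v : ℕ → A) : Prop := 𝔸.eval v e.lhs ≤ 𝔸.eval v e.rhs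

/-- Validity of an inequality: truth under every assignment. -/
def Ineq.Valid (e : Ineq L) (𝔸 : Alg L A) : Prop := ∀ v : ℕ → A, e.Holds 𝔸 v

/-- Validity of a quasi-inequality: truth under every assignment. -/
def QIneq.Valid (q : QIneq L) (𝔸 : Alg L A) : Prop :=
  ∀ v : ℕ → A, (∀ e ∈ q.prems, e.Holds 𝔸 v) → q.concl.Holds 𝔸 v

end Validity

/-! ## The expanded language -/

/-- The order-type of the residual in the `i`-th coordinate of a connective of order-type `e`. -/
def residEps {n : ℕ} (e : Fin n → Sgn) (i : Fin n) : Fin n → Sgn := fun j =>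
  match e i with
  | .pos => if j = i then .pos else (e j).flip
  | .neg => e j

/-- `F*`: the connectives in `F`, the left residuals of `∨` in its first coordinate
(`subR`, with `subR x y ≤ z` iff `y ≤ x ∨ z`) and in its second one
(`subL`, with `subL x y ≤ z` iff `x ≤ z ∨ y`), and the residuals `f♯ᵢ` with `ε_f(i) = ∂` and
`g♭ᵢ` with `ε_g(i) = 1`. -/
inductive StarF (L : Lang.{u}) : Type u where
  | base (f : L.F.Op)
  | subR
  | subL
  | sharp (f : L.F.Op) (i : Fin (L.F.ar f)) (h : L.F.eps f i = .neg)
  | flat (g : L.G.Op) (i : Fin (L.G.ar g)) (h : L.G.eps g i = .pos)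

/-- `G*`: the connectives in `G`, the right residuals of `∧`
(`impR`, with `y ≤ impR x z` iff `x ∧ y ≤ z`, and `impL`, with `x ≤ impL z y` iff `x ∧ y ≤ z`),
and the residuals `f♯ᵢ` with `ε_f(i) = 1` and `g♭ᵢ` with `ε_g(i) = ∂`. -/
inductive StarG (L : Lang.{u}) : Type u where
  | base (g : L.G.Op)
  | impR
  | impL
  | sharp (f : L.F.Op) (i : Fin (L.F.ar f)) (h : L.F.eps f i = .pos)
  | flat (g : L.G.Op) (i : Fin (L.G.ar g)) (h : L.G.eps g i = .neg)

section Star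

variable {L : Lang.{u}}

abbrev StarF.ar : StarF L → ℕ
  | .base f => L.F.ar f
  | .subR => 2
  | .subL => 2
  | .sharp f _ _ => L.F.ar f
  | .flat g _ _ => L.G.ar g

abbrev StarF.eps : (o : StarF L) → Fin o.ar → Sgn
  | .base f => L.F.eps f
  | .subR => ![.neg, .pos]
  | .subL => ![.pos, .neg]
  | .sharp f i _ => residEps (L.F.eps f) i
  | .flat g i _ => residEps (L.G.eps g) i

abbrev StarG.ar : StarG L → ℕ
  | .base g => L.G.ar g
  | .impR => 2
  | .impL => 2
  | .sharp f _ _ => L.F.ar f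
  | .flat g _ _ => L.G.ar g

abbrev StarG.eps : (o : StarG L) → Fin o.ar → Sgn
  | .base g => L.G.eps g
  | .impR => ![.neg, .pos]
  | .impL => ![.pos, .neg]
  | .sharp f i _ => residEps (L.F.eps f) i
  | .flat g i _ => residEps (L.G.eps g) i

/-- The expanded language. -/
abbrev Lang.star (L : Lang.{u}) : Lang.{u} where
  F := ⟨StarF L, StarF.ar, StarF.eps⟩
  G := ⟨StarG L, StarG.ar, StarG.eps⟩

/-- The inclusion of the terms of the language into those of the expanded language. -/
def Term.emb : Term L → Term L.star
  | .var x => .var x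
  | .node .top _ => Term.top
  | .node .bot _ => Term.bot
  | .node .meet a => Term.meet (Term.emb (a (0 : Fin 2))) (Term.emb (a (1 : Fin 2)))
  | .node .join a => Term.join (Term.emb (a (0 : Fin 2))) (Term.emb (a (1 : Fin 2)))
  | .node (.F f) a => .node (Conn.F (StarF.base f)) fun i => Term.emb (a i)
  | .node (.G g) a => .node (Conn.G (StarG.base g)) fun i => Term.emb (a i)

/-- The natural expansion of a perfect algebra by the residuals of its operations. In the
residual in the `i`-th coordinate, the `i`-th argument is the bound. -/
def Alg.star {A : Type w} [CompletelyDistribLattice A] (𝔸 : Alg L A) : Alg L.star A where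
  opF o := match o with
    | .base f => fun a => 𝔸.opF f a
    | .subR => fun a => a (1 : Fin 2) \ a (0 : Fin 2)
    | .subL => fun a => a (0 : Fin 2) \ a (1 : Fin 2)
    | .sharp f i _ => fun a => sInf {c : A | 𝔸.opF f (Function.update a i c) ≤ a i}
    | .flat g i _ => fun a => sInf {c : A | a i ≤ 𝔸.opG g (Function.update a i c)}
  opG o := match o with
    | .base g => fun a => 𝔸.opG g a
    | .impR => fun a => a (0 : Fin 2) ⇨ a (1 : Fin 2)
    | .impL => fun a => a (1 : Fin 2) ⇨ a (0 : Fin 2)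
    | .sharp f i _ => fun a => sSup {c : A | 𝔸.opF f (Function.update a i c) ≤ a i}
    | .flat g i _ => fun a => sSup {c : A | a i ≤ 𝔸.opG g (Function.update a i c)}

end Star

/-! ## Analytic inductive inequalities -/

section Inductive

variable {L : Lang.{u}}

/-- Skeleton nodes: `±∧`, `±∨`, `+f`, `−g`; the constants `⊤`, `⊥` may occur anywhere. -/
def IsSkeleton : Sgn → Conn L → Prop
  | .neg, .F _ => False
  | .pos, .G _ => False
  | _, _ => True

/-- PIA nodes: `±∧`, `±∨`, `+g`, `−f`; the constants `⊤`, `⊥` may occur anywhere. -/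
def IsPIA : Sgn → Conn L → Prop
  | .pos, .F _ => False
  | .neg, .G _ => False
  | _, _ => True

/-- Syntactically right residual nodes: `+∨`, `−∧`, and `+g`, `−f` of arity at least `2`. -/
def IsSRR : Sgn → Conn L → Prop
  | .pos, .join => True
  | .neg, .meet => True
  | .pos, .G g => 2 ≤ L.G.ar g
  | .neg, .F f => 2 ≤ L.F.ar f
  | _, _ => False

/-- A branch, listed from the root, splits into a Skeleton path `P₂` and a PIA path `P₁`. -/
def GoodSplit (ns P₂ P₁ : List (Tm.BNode L.conn ℕ)) : Prop :=
  ns = P₂ ++ P₁ ∧ (∀ n ∈ P₂, IsSkeleton n.sgn n.op) ∧ (∀ n ∈ P₁, IsPIA n.sgn n.op)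

def GoodBranch (ns : List (Tm.BNode L.conn ℕ)) : Prop := ∃ P₂ P₁, GoodSplit ns P₂ P₁

/-- The signed tree with root sign `s` agrees with the opposite of the order-type `ε`: none of its
leaves is `ε`-critical. -/
def OppUniform (ε : ℕ → Sgn) (s : Sgn) (t : Term L) : Prop :=
  ∀ s' x, (s', x) ∈ t.leaves s → s' = (ε x).flip

/-- The side condition at an SRR-node of a critical branch with leaf `p`. -/
def SRRCondition (Ω : ℕ → ℕ → Prop) (ε : ℕ → Sgn) (p : ℕ) (n : Tm.BNode L.conn ℕ) : Prop :=
  IsSRR n.sgn n.op → ∀ j ∈ n.next, ∀ h, h ≠ j →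
    OppUniform ε (n.sgn.mul (L.conn.eps n.op h)) (n.args h) ∧
    ∀ s' x, (s', x) ∈ (n.args h).leaves .pos → Ω x p

/-- `(Ω, ε)`-inductive signed generation trees: every `ε`-critical branch is good, and the SRR-nodes
on its PIA part satisfy the side condition. -/
def InductiveTree (Ω : ℕ → ℕ → Prop) (ε : ℕ → Sgn) (s : Sgn) (t : Term L) : Prop :=
  ∀ ns p, t.IsBranch s ns (some (ε p, p)) →
    ∃ P₂ P₁, GoodSplit ns P₂ P₁ ∧ ∀ n ∈ P₁, SRRCondition Ω ε p n

/-- Analytic `(Ω, ε)`-inductive signed generation trees: moreover, every branch is good. -/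
def AnalyticTree (Ω : ℕ → ℕ → Prop) (ε : ℕ → Sgn) (s : Sgn) (t : Term L) : Prop :=
  InductiveTree Ω ε s t ∧ ∀ ns l, t.IsBranch s ns l → GoodBranch ns

/-- Analytic `(Ω, ε)`-inductive inequalities. -/
def Ineq.AnalyticInductive (Ω : ℕ → ℕ → Prop) (ε : ℕ → Sgn) (e : Ineq L) : Prop :=
  AnalyticTree Ω ε .pos e.lhs ∧ AnalyticTree Ω ε .neg e.rhs

end Inductive

/-! ## Structures, sequents and structural rules of the display calculus -/

/-- The structural connectives. -/
inductive SConn (L : Lang.{u}) : Type u where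
  | I
  | semi
  | gt
  | lt
  | H (f : L.F.Op)
  | K (g : L.G.Op)
  | Hres (f : L.F.Op) (i : Fin (L.F.ar f))
  | Kres (g : L.G.Op) (i : Fin (L.G.ar g))

section Structures

variable {L : Lang.{u}}

abbrev SConn.ar : SConn L → ℕ
  | .I => 0
  | .semi => 2
  | .gt => 2
  | .lt => 2
  | .H f => L.F.ar f
  | .K g => L.G.ar g
  | .Hres f _ => L.F.ar f
  | .Kres g _ => L.G.ar g

abbrev SConn.eps : (c : SConn L) → Fin c.ar → Sgn
  | .I => fun _ => .pos
  | .semi => fun _ => .pos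
  | .gt => ![.neg, .pos]
  | .lt => ![.pos, .neg]
  | .H f => L.F.eps f
  | .K g => L.G.eps g
  | .Hres f i => residEps (L.F.eps f) i
  | .Kres g i => residEps (L.G.eps g) i

/-- The structural connective has an associated logical connective when it occurs in precedent
(`pos`), resp. succedent (`neg`) position. -/
def SConn.HasSide : Sgn → SConn L → Prop
  | s, .H _ => s = .pos
  | s, .K _ => s = .neg
  | s, .Hres f i => s = (L.F.eps f i).flip
  | s, .Kres g i => s = L.G.eps g i
  | _, _ => True

abbrev Lang.str (L : Lang.{u}) : OSig.{u} := ⟨SConn L, SConn.ar, SConn.eps⟩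

/-- Structural terms with atoms from `α`. The atoms are structural variables (natural numbers) in
rule schemes, and formulas in the structures to which the rules are applied. -/
abbrev Str (L : Lang.{u}) (α : Type v) : Type (max u v) := Tm L.str α

/-- Left-sided (`pos`) and right-sided (`neg`) structural terms. -/
def Str.Sided {α : Type v} : Sgn → Str L α → Prop
  | _, .var _ => True
  | s, .node c a => SConn.HasSide s c ∧ ∀ i, Str.Sided (s.mul (L.str.eps c i)) (a i)

/-- The translations `l` (for the sign `pos`) and `r` (for the sign `neg`) of structural terms as
terms of the expanded language. The value is meaningful for left-sided, resp. right-sided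
structural terms; on all others some node is translated as `⊤` for lack of a logical
connective. -/
def Str.toTerm : Sgn → Str L ℕ → Term L.star
  | _, .var x => .var x
  | .pos, .node .I _ => Term.top
  | .neg, .node .I _ => Term.bot
  | .pos, .node .semi a =>
      Term.meet (Str.toTerm .pos (a (0 : Fin 2))) (Str.toTerm .pos (a (1 : Fin 2)))
  | .neg, .node .semi a =>
      Term.join (Str.toTerm .neg (a (0 : Fin 2))) (Str.toTerm .neg (a (1 : Fin 2)))
  | .pos, .node .gt a => .node (Conn.F StarF.subR)
      ![Str.toTerm .neg (a (0 : Fin 2)), Str.toTerm .pos (a (1 : Fin 2))]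
  | .neg, .node .gt a => .node (Conn.G StarG.impR)
      ![Str.toTerm .pos (a (0 : Fin 2)), Str.toTerm .neg (a (1 : Fin 2))]
  | .pos, .node .lt a => .node (Conn.F StarF.subL)
      ![Str.toTerm .pos (a (0 : Fin 2)), Str.toTerm .neg (a (1 : Fin 2))]
  | .neg, .node .lt a => .node (Conn.G StarG.impL)
      ![Str.toTerm .neg (a (0 : Fin 2)), Str.toTerm .pos (a (1 : Fin 2))]
  | .pos, .node (.H f) a =>
      .node (Conn.F (StarF.base f)) fun i => Str.toTerm (L.F.eps f i) (a i)
  | .neg, .node (.H _) _ => Term.top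
  | .pos, .node (.K _) _ => Term.top
  | .neg, .node (.K g) a =>
      .node (Conn.G (StarG.base g)) fun i => Str.toTerm (L.G.eps g i).flip (a i)
  | .pos, .node (.Hres f k) a =>
      if h : L.F.eps f k = .neg then
        .node (Conn.F (StarF.sharp f k h)) fun i => Str.toTerm (residEps (L.F.eps f) k i) (a i)
      else Term.top
  | .neg, .node (.Hres f k) a =>
      if h : L.F.eps f k = .pos then
        .node (Conn.G (StarG.sharp f k h)) fun i =>
          Str.toTerm (residEps (L.F.eps f) k i).flip (a i)
      else Term.top
  | .pos, .node (.Kres g k) a =>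
      if h : L.G.eps g k = .pos then
        .node (Conn.F (StarF.flat g k h)) fun i => Str.toTerm (residEps (L.G.eps g) k i) (a i)
      else Term.top
  | .neg, .node (.Kres g k) a =>
      if h : L.G.eps g k = .neg then
        .node (Conn.G (StarG.flat g k h)) fun i =>
          Str.toTerm (residEps (L.G.eps g) k i).flip (a i)
      else Term.top

end Structures

/-- Sequents `ant ⊢ suc`. -/
structure Seqt (L : Lang.{u}) (α : Type v) where
  ant : Str L α
  suc : Str L α

/-- Structural rule schemes (for `α = ℕ`, the structural variables), and inferences
(for `α = Term L`). -/
structure Rule (L : Lang.{u}) (α : Type v) where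
  prems : List (Seqt L α)
  concl : Seqt L α

namespace Seqt

variable {L : Lang.{u}} {α : Type v} {β : Type w}

def side (q : Seqt L α) : Sgn → Str L α
  | .pos => q.ant
  | .neg => q.suc

def leaves (q : Seqt L α) : List (Sgn × α) := q.ant.leaves .pos ++ q.suc.leaves .neg

def subst (σ : α → Str L β) (q : Seqt L α) : Seqt L β := ⟨q.ant.subst σ, q.suc.subst σ⟩

noncomputable def replace (z : Str L α) (P : Sgn → List ℕ → Prop) (q : Seqt L α) : Seqt L α :=
  ⟨Tm.replace z (P .pos) q.ant, Tm.replace z (P .neg) q.suc⟩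

/-- The sequent can be read as an inequality. -/
def Sided (q : Seqt L α) : Prop := Str.Sided .pos q.ant ∧ Str.Sided .neg q.suc

def toIneq (q : Seqt L ℕ) : Ineq L.star := ⟨Str.toTerm .pos q.ant, Str.toTerm .neg q.suc⟩

end Seqt

/-- Positions in an inference: a sequent (`none` for the conclusion, `some k` for the `k`-th
premise), one of its sides, and a path from the root of that side. -/
structure Pos where
  seq : Option ℕ
  side : Sgn
  path : List ℕ

namespace Rule

variable {L : Lang.{u}} {α : Type v} {β : Type w}

def seqAt (r : Rule L α) : Option ℕ → Option (Seqt L α)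
  | none => some r.concl
  | some k => r.prems[k]?

/-- At the position `π` there is an occurrence of the substructure `u`, in precedent (`s = pos`) or
succedent (`s = neg`) position. -/
def At (r : Rule L α) (π : Pos) (s : Sgn) (u : Str L α) : Prop :=
  ∃ q, r.seqAt π.seq = some q ∧ (q.side π.side).SubAt π.side π.path s u

/-- The inferences that are applications of a rule scheme are its instances under the assignments
`σ` of structures to the structural variables. -/
def inst (r : Rule L α) (σ : α → Str L β) : Rule L β :=
  ⟨r.prems.map (Seqt.subst σ), r.concl.subst σ⟩

/-- Replacement of the substructures at the positions in `P`. -/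
noncomputable def replace (r : Rule L α) (z : Str L α) (P : Pos → Prop) : Rule L α :=
  ⟨r.prems.mapIdx fun k q => q.replace z fun s p => P ⟨some k, s, p⟩,
    r.concl.replace z fun s p => P ⟨none, s, p⟩⟩

/-- In every instance of `r`, the position `π` is the position `d` inside an occurrence of the
structure assigned to `x`. -/
def Inside (r : Rule L ℕ) (x : ℕ) (d : List ℕ) (π : Pos) : Prop :=
  ∃ p s, π.path = p ++ d ∧ r.At ⟨π.seq, π.side, p⟩ s (.var x)

/-- The congruence on the parameters of the instance of `r` under `σ`: it relates the corresponding
positions in all occurrences of the structure assigned to one structural variable. The positions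
congruent to themselves are the parameters. -/
def Congr (r : Rule L ℕ) (σ : ℕ → Str L (Term L)) (π π' : Pos) : Prop :=
  ∃ x d, (∃ s u, (σ x).SubAt .pos d s u) ∧ r.Inside x d π ∧ r.Inside x d π'

/-- Preservation of formulas. -/
def C1 (r : Rule L ℕ) : Prop := ∀ (σ : ℕ → Str L (Term L)) (π : Pos) (s : Sgn) (A : Term L),
  π.seq ≠ none → (r.inst σ).At π s (.var A) →
    ∃ (π' : Pos) (s' : Sgn) (B : Term L), π'.seq = none ∧ (r.inst σ).At π' s' (.var B) ∧
      ∃ p s'', B.SubAt .pos p s'' A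

/-- Shape-alikeness of parameters. -/
def C2 (r : Rule L ℕ) : Prop := ∀ (σ : ℕ → Str L (Term L)) (π π' : Pos) (s s' : Sgn)
  (u u' : Str L (Term L)), r.Congr σ π π' → (r.inst σ).At π s u → (r.inst σ).At π' s' u' → u = u'

/-- Non-proliferation of parameters. -/
def C3 (r : Rule L ℕ) : Prop := ∀ (σ : ℕ → Str L (Term L)) (π π₁ π₂ : Pos),
  r.Congr σ π π₁ → r.Congr σ π π₂ → π₁.seq = none → π₂.seq = none → π₁ = π₂

/-- Position-alikeness of parameters. -/
def C4 (r : Rule L ℕ) : Prop := ∀ (σ : ℕ → Str L (Term L)) (π π' : Pos) (s s' : Sgn)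
  (u u' : Str L (Term L)), r.Congr σ π π' → π.seq ≠ none → π'.seq = none →
    (r.inst σ).At π s u → (r.inst σ).At π' s' u' → s = s'

/-- Display of principal constituents. -/
def C5 (r : Rule L ℕ) : Prop := ∀ (σ : ℕ → Str L (Term L)) (π : Pos) (s : Sgn) (A : Term L),
  π.seq = none → (r.inst σ).At π s (.var A) → ¬ r.Congr σ π π → π.path = []

/-- Closure under substitution for parameters in succedent (`s = neg`), resp. precedent (`s = pos`)
position: replacing congruent formulas by a structure gives an application of the same rule. -/
def ClosedUnderSubst (r : Rule L ℕ) (s : Sgn) : Prop :=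
  ∀ (σ : ℕ → Str L (Term L)) (π : Pos) (A : Term L) (z : Str L (Term L)),
    (r.inst σ).At π s (.var A) → r.Congr σ π π →
      ∃ σ' : ℕ → Str L (Term L), r.inst σ' = (r.inst σ).replace z (r.Congr σ π)

def C6 (r : Rule L ℕ) : Prop := r.ClosedUnderSubst .neg

def C7 (r : Rule L ℕ) : Prop := r.ClosedUnderSubst .pos

/-- Analytic structural rules. -/
def Analytic (r : Rule L ℕ) : Prop := r.C1 ∧ r.C2 ∧ r.C3 ∧ r.C4 ∧ r.C5 ∧ r.C6 ∧ r.C7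

/-- The premise `x ⊢ U` (for `s = pos`) or `U ⊢ x` (for `s = neg`). -/
def displayed : Sgn → ℕ → Str L ℕ → Seqt L ℕ
  | .pos, x, U => ⟨.var x, U⟩
  | .neg, x, U => ⟨U, .var x⟩

/-- Quasi-special structural rules: analytic rules in which every premise is of the form `X ⊢ T` or
`S ⊢ Y`, where the displayed variables `X` (resp. `Y`) occur exactly once in the conclusion, in
precedent (resp. succedent) position, and occur in none of the structures `S`, `T`. -/
def QuasiSpecial (r : Rule L ℕ) : Prop :=
  r.Analytic ∧ ∃ ps : List (Sgn × ℕ × Str L ℕ),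
    r.prems = ps.map (fun d => displayed d.1 d.2.1 d.2.2) ∧
    ∀ d ∈ ps,
      (d.1, d.2.1) ∈ r.concl.leaves ∧ (r.concl.leaves.map Prod.snd).count d.2.1 = 1 ∧
      ∀ d' ∈ ps, d.2.1 ∉ (d'.2.2.leaves .pos).map Prod.snd

/-- All sequents of the rule can be read as inequalities. -/
def Sided (r : Rule L ℕ) : Prop := (∀ q ∈ r.prems, q.Sided) ∧ r.concl.Sided

/-- The quasi-inequality that expresses the validity of the rule. -/
def toQIneq (r : Rule L ℕ) : QIneq L.star := ⟨r.prems.map Seqt.toIneq, r.concl.toIneq⟩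

/-- Validity of the rule on a perfect algebra. -/
def Valid {A : Type w} [CompletelyDistribLattice A] (r : Rule L ℕ) (𝔸 : Alg L A) : Prop :=
  r.toQIneq.Valid 𝔸.star

end Rule

/-! ## ALBA reductions -/

section ALBA

variable {L : Lang.{u}}

/-- `∨` for `pos`, `∧` for `neg`. -/
def Term.joinOf : Sgn → Term L → Term L → Term L
  | .pos => Term.join
  | .neg => Term.meet

/-- `⊥` for `pos`, `⊤` for `neg`. -/
def Term.botOf : Sgn → Term L
  | .pos => Term.bot
  | .neg => Term.top

def Term.bigJoin : List (Term L) → Term L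
  | [] => Term.bot
  | [a] => a
  | a :: b :: l => Term.join a (Term.bigJoin (b :: l))

def Term.bigMeet : List (Term L) → Term L
  | [] => Term.top
  | [a] => a
  | a :: b :: l => Term.meet a (Term.bigMeet (b :: l))

/-- One application, at some node of a term, of a distribution rule or of a rule for constants. -/
inductive Rewrite : Term L → Term L → Prop where
  | distF (c : Conn L) (a : Fin c.ar → Term L) (i : Fin c.ar) (x y : Term L) : c.FLike →
      Rewrite (.node c (Function.update a i (Term.joinOf (c.eps i) x y)))
        (Term.join (.node c (Function.update a i x)) (.node c (Function.update a i y)))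
  | distG (c : Conn L) (a : Fin c.ar → Term L) (i : Fin c.ar) (x y : Term L) : c.GLike →
      Rewrite (.node c (Function.update a i (Term.joinOf (c.eps i).flip x y)))
        (Term.meet (.node c (Function.update a i x)) (.node c (Function.update a i y)))
  | constF (c : Conn L) (a : Fin c.ar → Term L) (i : Fin c.ar) : c.FLike →
      Rewrite (.node c (Function.update a i (Term.botOf (c.eps i)))) Term.bot
  | constG (c : Conn L) (a : Fin c.ar → Term L) (i : Fin c.ar) : c.GLike →
      Rewrite (.node c (Function.update a i (Term.botOf (c.eps i).flip))) Term.top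
  | inside (c : Conn L) (a : Fin c.ar → Term L) (i : Fin c.ar) (t : Term L) : Rewrite (a i) t →
      Rewrite (.node c a) (.node c (Function.update a i t))

/-- The distribution rules, the rules for constants, the splitting rules, and the removal of
tautologies, as rules that replace an inequality by a list of inequalities. -/
inductive Simplify : Ineq L → List (Ineq L) → Prop where
  | left (s s' t : Term L) : Rewrite s s' → Simplify ⟨s, t⟩ [⟨s', t⟩]
  | right (s t t' : Term L) : Rewrite t t' → Simplify ⟨s, t⟩ [⟨s, t'⟩]
  | splitMeet (s t t' : Term L) : Simplify ⟨s, Term.meet t t'⟩ [⟨s, t⟩, ⟨s, t'⟩]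
  | splitJoin (s s' t : Term L) : Simplify ⟨Term.join s s', t⟩ [⟨s, t⟩, ⟨s', t⟩]
  | dropTop (s : Term L) : Simplify ⟨s, Term.top⟩ []
  | dropBot (t : Term L) : Simplify ⟨Term.bot, t⟩ []

/-- The adjunction and residuation rules, for `f ∈ F`, `g ∈ G`, `∧` and `∨`. -/
inductive Residuate : Ineq L.star → Ineq L.star → Prop where
  | F_pos (f : L.F.Op) (i : Fin (L.F.ar f)) (h : L.F.eps f i = .pos)
      (a : Fin (L.F.ar f) → Term L.star) (c : Term L.star) :
      Residuate ⟨.node (Conn.F (StarF.base f)) a, c⟩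
        ⟨a i, .node (Conn.G (StarG.sharp f i h)) (Function.update a i c)⟩
  | F_neg (f : L.F.Op) (i : Fin (L.F.ar f)) (h : L.F.eps f i = .neg)
      (a : Fin (L.F.ar f) → Term L.star) (c : Term L.star) :
      Residuate ⟨.node (Conn.F (StarF.base f)) a, c⟩
        ⟨.node (Conn.F (StarF.sharp f i h)) (Function.update a i c), a i⟩
  | G_pos (g : L.G.Op) (i : Fin (L.G.ar g)) (h : L.G.eps g i = .pos)
      (a : Fin (L.G.ar g) → Term L.star) (c : Term L.star) :
      Residuate ⟨c, .node (Conn.G (StarG.base g)) a⟩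
        ⟨.node (Conn.F (StarF.flat g i h)) (Function.update a i c), a i⟩
  | G_neg (g : L.G.Op) (i : Fin (L.G.ar g)) (h : L.G.eps g i = .neg)
      (a : Fin (L.G.ar g) → Term L.star) (c : Term L.star) :
      Residuate ⟨c, .node (Conn.G (StarG.base g)) a⟩
        ⟨a i, .node (Conn.G (StarG.flat g i h)) (Function.update a i c)⟩
  | meet_left (a b c : Term L.star) :
      Residuate ⟨Term.meet a b, c⟩ ⟨a, .node (Conn.G StarG.impL) ![c, b]⟩
  | meet_right (a b c : Term L.star) :
      Residuate ⟨Term.meet a b, c⟩ ⟨b, .node (Conn.G StarG.impR) ![a, c]⟩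
  | join_left (a b c : Term L.star) :
      Residuate ⟨c, Term.join a b⟩ ⟨.node (Conn.F StarF.subL) ![c, b], a⟩
  | join_right (a b c : Term L.star) :
      Residuate ⟨c, Term.join a b⟩ ⟨.node (Conn.F StarF.subR) ![a, c], b⟩

/-- `p` occurs in the term only positively, resp. only negatively. -/
def Term.PositiveIn (p : ℕ) (t : Term L) : Prop := (Sgn.neg, p) ∉ t.leaves .pos

def Term.NegativeIn (p : ℕ) (t : Term L) : Prop := (Sgn.pos, p) ∉ t.leaves .pos

def Term.Occurs (p : ℕ) (t : Term L) : Prop := p ∈ (t.leaves .pos).map Prod.snd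

/-- Uniform substitution of `a` for `p`. -/
def Term.subst1 (p : ℕ) (a t : Term L) : Term L := t.subst fun x => if x = p then a else .var x

def Ineq.subst1 (p : ℕ) (a : Term L) (e : Ineq L) : Ineq L :=
  ⟨Term.subst1 p a e.lhs, Term.subst1 p a e.rhs⟩

/-- The signed variable occurrences in an inequality `s ≤ t`, read off `+s` and `−t`. -/
def Ineq.leaves (e : Ineq L) : List (Sgn × ℕ) := e.lhs.leaves .pos ++ e.rhs.leaves .neg

/-- `x ≤ a` for `pos`, `a ≤ x` for `neg`. -/
def Ineq.bound : Sgn → ℕ → Term L → Ineq L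
  | .pos, x, a => ⟨.var x, a⟩
  | .neg, x, a => ⟨a, .var x⟩

/-- One application of an ALBA rule to a quasi-inequality, which it replaces by finitely many ones:
distribution, splitting and removal of tautologies in the conclusion and in the premises;
adjunction/residuation in the premises; the inverted Ackermann rule; the two Ackermann rules. -/
inductive ALBAStep : QIneq L.star → List (QIneq L.star) → Prop where
  | concl (ps : List (Ineq L.star)) (e : Ineq L.star) (es : List (Ineq L.star)) : Simplify e es →
      ALBAStep ⟨ps, e⟩ (es.map fun e' => ⟨ps, e'⟩)
  | prem (ps ps' : List (Ineq L.star)) (e c : Ineq L.star) (es : List (Ineq L.star)) :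
      Simplify e es → ALBAStep ⟨ps ++ e :: ps', c⟩ [⟨ps ++ es ++ ps', c⟩]
  | residuation (ps ps' : List (Ineq L.star)) (e e' c : Ineq L.star) :
      Residuate e e' → ALBAStep ⟨ps ++ e :: ps', c⟩ [⟨ps ++ e' :: ps', c⟩]
  /-- The inequality `s(α⃗) ≤ t(β⃗)` is replaced by the quasi-inequality with the conclusion
  `s(q⃗) ≤ t(r⃗)`, in which every variable occurs exactly once, and with one premise, according to
  its polarity, for each of these variables. -/
  | invertedAckermann (e : Ineq L.star) (σ : ℕ → Term L.star) :
      (e.leaves.map Prod.snd).Nodup →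
      (∀ x ∈ e.leaves.map Prod.snd, ∀ y ∈ e.leaves.map Prod.snd, ¬ Term.Occurs x (σ y)) →
      ALBAStep ⟨[], ⟨e.lhs.subst σ, e.rhs.subst σ⟩⟩
        [⟨e.leaves.map fun l => Ineq.bound l.1 l.2 (σ l.2), e⟩]
  | rightAckermann (p : ℕ) (as : List (Term L.star)) (ps rest : List (Ineq L.star))
      (c : Ineq L.star) :
      ps.Perm (as.map (fun a => ⟨a, .var p⟩) ++ rest) →
      (∀ a ∈ as, ¬ Term.Occurs p a) →
      (∀ e ∈ rest, Term.PositiveIn p e.lhs ∧ Term.NegativeIn p e.rhs) →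
      ¬ Term.Occurs p c.lhs → ¬ Term.Occurs p c.rhs →
      ALBAStep ⟨ps, c⟩ [⟨rest.map (Ineq.subst1 p (Term.bigJoin as)), c⟩]
  | leftAckermann (p : ℕ) (as : List (Term L.star)) (ps rest : List (Ineq L.star))
      (c : Ineq L.star) :
      ps.Perm (as.map (fun a => ⟨.var p, a⟩) ++ rest) →
      (∀ a ∈ as, ¬ Term.Occurs p a) →
      (∀ e ∈ rest, Term.NegativeIn p e.lhs ∧ Term.PositiveIn p e.rhs) →
      ¬ Term.Occurs p c.lhs → ¬ Term.Occurs p c.rhs →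
      ALBAStep ⟨ps, c⟩ [⟨rest.map (Ineq.subst1 p (Term.bigMeet as)), c⟩]

/-- ALBA reductions: finite sequences of applications of ALBA rules to members of a system of
quasi-inequalities. -/
def ALBAReduces : List (QIneq L.star) → List (QIneq L.star) → Prop :=
  Relation.ReflTransGen fun Q Q' =>
    ∃ Q₁ q Q₂ qs, Q = Q₁ ++ q :: Q₂ ∧ ALBAStep q qs ∧ Q' = Q₁ ++ qs ++ Q₂

end ALBA

end DLE

/-!
The proof runs ALBA in such a way that every intermediate system keeps the shape of a rule.

The same terms are read in two ways. At a sign `s`, an *operator node* (`OperatorNode`) preserves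
joins (for `pos`) or meets (for `neg`) in every coordinate, up to its order-type; a *join node*
(`JoinNode`) is a finite join, resp. meet. Skeleton trees at the sign `s` are built from these two
kinds of nodes, and PIA trees at the sign `s` are built from the two kinds of nodes at the opposite
sign (`SkeletonOver`). Operators distribute over join nodes, so each such tree is rewritten as a
finite join of trees of operator nodes only (`SkeletonOver.normalizes`), and these are exactly the
readings of structures of the display calculus (`OperatorOver.exists_structure`).

For an analytic inductive inequality, each branch is cut where its longest Skeleton part ends.
The PIA subtrees below the cut are normalised first: their components are *definite* and have at
most one critical leaf, by the side condition on SRR nodes (`PIATree.disjunct`). Doing this inside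
the inequality makes the meets of components part of the Skeleton, which is normalised next. After
splitting, the inverted Ackermann rule puts a fresh structural variable in place of each definite
PIA tree (`OperatorOver.exists_linear`). If such a tree has a critical leaf `p`, residuation along
the critical branch displays `p` (`CriticalTree.exists_bound`); otherwise the premise stays as it
is. Hence a structural variable either is displayed in a premise or occurs inside the bounds of
letters, but not both, which is what quasi-special rules require.

All premises now bound a variable by a term whose letters occur non-critically only, and the bounds
of a letter `p` contain only letters `Ω`-smaller than `p`. The Ackermann rules therefore eliminate
the letters in an order that extends `Ω` (`reducesToRules_of_admissibleBound`). The remaining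
premises are normalised once more and read as structures. The conclusion of the resulting rule is
linear, and this alone yields the analyticity conditions (`Rule.Linear.analytic`).

Semantically, an operation on a complete lattice that preserves joins coordinatewise is residuated
(`Residuated`), and residuals are residuated again (`Residuated.residual`); hence the expansion of
a perfect algebra validates all the reduction rules, and each ALBA step preserves and reflects
validity (`ALBAStep.valid_iff`).
-/

namespace DLE

/-! ### Signs and leaves of signed trees -/

namespace Sgn

@[simp] lemma flip_pos : Sgn.pos.flip = .neg := rfl
@[simp] lemma flip_neg : Sgn.neg.flip = .pos := rfl
@[simp] lemma flip_flip (s : Sgn) : s.flip.flip = s := by cases s <;> rfl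
@[simp] lemma pos_mul (s : Sgn) : Sgn.pos.mul s = s := rfl
@[simp] lemma neg_mul (s : Sgn) : Sgn.neg.mul s = s.flip := rfl
@[simp] lemma mul_pos (s : Sgn) : s.mul .pos = s := by cases s <;> rfl
@[simp] lemma mul_neg (s : Sgn) : s.mul .neg = s.flip := by cases s <;> rfl
lemma flip_mul (s t : Sgn) : s.flip.mul t = (s.mul t).flip := by cases s <;> cases t <;> rfl
lemma mul_flip (s t : Sgn) : s.mul t.flip = (s.mul t).flip := by cases s <;> cases t <;> rfl
lemma flip_injective : Function.Injective Sgn.flip := fun a b h => by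
  simpa using congrArg Sgn.flip h
lemma flip_ne (s : Sgn) : s.flip ≠ s := by cases s <;> decide
lemma eq_flip_of_ne {s t : Sgn} (h : s ≠ t) : s = t.flip := by
  cases s <;> cases t <;> first | rfl | exact absurd rfl h

/-- The order `≤` for the sign `pos` and its opposite for the sign `neg`. -/
def le {A : Type w} [LE A] : Sgn → A → A → Prop
  | .pos, a, b => a ≤ b
  | .neg, a, b => b ≤ a

lemma le_flip {A : Type w} [LE A] (s : Sgn) (a b : A) : s.flip.le a b ↔ s.le b a := by
  cases s <;> rfl
lemma le_refl {A : Type w} [Preorder A] (s : Sgn) (a : A) : s.le a a := by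
  cases s <;> exact _root_.le_refl a
lemma le_trans {A : Type w} [Preorder A] {s : Sgn} {a b c : A} (h : s.le a b) (h' : s.le b c) :
    s.le a c := by
  cases s
  · exact _root_.le_trans (α := A) h h'
  · exact _root_.le_trans (α := A) h' h
lemma le_antisymm {A : Type w} [PartialOrder A] {s : Sgn} {a b : A} (h : s.le a b)
    (h' : s.le b a) : a = b := by
  cases s
  · exact _root_.le_antisymm (α := A) h h'
  · exact _root_.le_antisymm (α := A) h' h

end Sgn

namespace Tm

variable {S : OSig.{u}} {α : Type v} {β : Type w}

lemma mem_leaves_var {s s' : Sgn} {x y : α} :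
    (s', x) ∈ (Tm.var y : Tm S α).leaves s ↔ s' = s ∧ x = y := by
  simp [leaves]

lemma mem_leaves_node {s s' : Sgn} {x : α} {o : S.Op} {a : Fin (S.ar o) → Tm S α} :
    (s', x) ∈ (Tm.node o a).leaves s ↔ ∃ i, (s', x) ∈ (a i).leaves (s.mul (S.eps o i)) := by
  simp [leaves]

lemma mem_leaves_flip {t : Tm S α} {s s' : Sgn} {x : α} :
    (s', x) ∈ t.leaves s.flip ↔ (s'.flip, x) ∈ t.leaves s := by
  induction t generalizing s with
  | var y => cases s <;> cases s' <;> simp [leaves, Sgn.flip]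
  | node o a ih => simp only [mem_leaves_node, Sgn.flip_mul, ih]

lemma mem_vars {t : Tm S α} (s : Sgn) {x : α} :
    x ∈ (t.leaves .pos).map Prod.snd ↔ ∃ s', (s', x) ∈ t.leaves s := by
  have h : x ∈ (t.leaves .pos).map Prod.snd ↔ ∃ s', (s', x) ∈ t.leaves .pos := by simp
  rw [h]
  cases s
  · rfl
  · constructor
    · rintro ⟨s', h⟩
      exact ⟨s'.flip, (mem_leaves_flip (s := .pos)).2 (by simpa using h)⟩
    · rintro ⟨s', h⟩
      exact ⟨s'.flip, (mem_leaves_flip (s := .pos)).1 h⟩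

lemma mem_leaves_subst {t : Tm S α} {σ : α → Tm S β} {s s' : Sgn} {y : β} :
    (s', y) ∈ (t.subst σ).leaves s ↔
      ∃ s₁ x, (s₁, x) ∈ t.leaves s ∧ (s', y) ∈ (σ x).leaves s₁ := by
  induction t generalizing s with
  | var x => simp [subst, leaves]
  | node o a ih =>
    simp only [subst, mem_leaves_node, ih]
    exact ⟨fun ⟨i, s₁, x, h, h'⟩ => ⟨s₁, x, ⟨i, h⟩, h'⟩,
      fun ⟨s₁, x, ⟨i, h⟩, h'⟩ => ⟨i, s₁, x, h, h'⟩⟩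

lemma subst_congr {t : Tm S α} {σ τ : α → Tm S β} (s : Sgn)
    (h : ∀ s' x, (s', x) ∈ t.leaves s → σ x = τ x) : t.subst σ = t.subst τ := by
  induction t generalizing s with
  | var x => exact h s x (by simp [leaves])
  | node o a ih =>
    simp only [subst]
    congr 1
    funext i
    exact ih i _ fun s' x hx => h s' x (mem_leaves_node.2 ⟨i, hx⟩)

end Tm

namespace Term

variable {L : Lang.{u}}

lemma occurs_iff (s : Sgn) {p : ℕ} {t : Term L} : t.Occurs p ↔ ∃ s', (s', p) ∈ t.leaves s :=
  Tm.mem_vars s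

end Term

/-! ### Residuated operations and the soundness of the reduction rules -/

/-- An `n`-ary operation `h` of order-type `e` is residuated in every coordinate: for the sign
`pos`, each of its coordinate maps is the lower adjoint of a map that is monotone or antitone as
`e` prescribes; for the sign `neg`, the upper one. -/
def Residuated {A : Type w} [LE A] {n : ℕ} (s : Sgn) (e : Fin n → Sgn) (h : (Fin n → A) → A) :
    Prop :=
  ∀ (i : Fin n) (a : Fin n → A) (b : A), ∃ r, ∀ c,
    s.le (h (Function.update a i c)) b ↔ (s.mul (e i)).le c r

/-- A property of tuples passes from `a` to `b` if it is preserved when single coordinates of `a`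
are replaced by those of `b`. -/
lemma update_induction {X : Type*} {n : ℕ} (a b : Fin n → X) {Q : (Fin n → X) → Prop} (h₀ : Q a)
    (h : ∀ i d, Q d → d i = a i → Q (Function.update d i (b i))) : Q b := by
  have key : ∀ k : ℕ, k ≤ n → Q fun i => if i.val < k then b i else a i := by
    intro k
    induction k with
    | zero => intro _; simpa using h₀
    | succ k ih =>
      intro hk
      have h₂ := h ⟨k, hk⟩ _ (ih (by omega)) (by simp)
      convert h₂ using 1
      funext i
      by_cases hi : i = ⟨k, hk⟩
      · subst hi; simp
      · have : i.val ≠ k := fun h => hi (Fin.ext h)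
        have : i.val < k + 1 ↔ i.val < k := by omega
        simp [Function.update_of_ne hi, this]
  simpa using key n le_rfl

namespace Residuated

variable {A : Type w} {n : ℕ} {s : Sgn} {e : Fin n → Sgn} {h : (Fin n → A) → A}

lemma mono_update [Preorder A] (H : Residuated s e h) (i : Fin n) (a : Fin n → A) {c c' : A}
    (hc : (s.mul (e i)).le c c') :
    s.le (h (Function.update a i c)) (h (Function.update a i c')) := by
  obtain ⟨r, hr⟩ := H i a (h (Function.update a i c'))
  exact (hr c).2 (Sgn.le_trans hc ((hr c').1 (Sgn.le_refl _ _)))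

lemma mono_self [Preorder A] (H : Residuated s e h) {a b : Fin n → A}
    (hab : ∀ i, (s.mul (e i)).le (a i) (b i)) : s.le (h a) (h b) := by
  refine update_induction a b (Q := fun d => s.le (h a) (h d)) (Sgn.le_refl _ _) fun i d hd hi => ?_
  refine Sgn.le_trans hd ?_
  have := H.mono_update i d (hab i)
  rwa [← hi, Function.update_eq_self] at this

lemma mono [Preorder A] (H : Residuated s e h) (s' : Sgn) {a b : Fin n → A}
    (hab : ∀ i, (s'.mul (e i)).le (a i) (b i)) : s'.le (h a) (h b) := by
  by_cases hs : s' = s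
  · subst hs; exact H.mono_self hab
  · obtain rfl := Sgn.eq_flip_of_ne hs
    rw [Sgn.le_flip]
    refine H.mono_self fun i => ?_
    have := hab i
    rwa [Sgn.flip_mul, Sgn.le_flip] at this

/-- The residual `k` of a residuated operation `h` in its `i`-th coordinate is residuated: its own
residual in the coordinate `i` is `h`, and in a coordinate `j ≠ i` it is that of `h`. -/
lemma residual [Preorder A] (H : Residuated s e h) (i : Fin n) {k : (Fin n → A) → A}
    (hk : ∀ a c, s.le (h (Function.update a i c)) (a i) ↔ (s.mul (e i)).le c (k a)) :
    Residuated (s.mul (e i)).flip (residEps e i) k := by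
  intro j a d
  by_cases hj : j = i
  · subst hj
    refine ⟨h (Function.update a j d), fun c => ?_⟩
    rw [Sgn.le_flip, ← hk]
    simp only [Function.update_idem, Function.update_self]
    rw [← Sgn.le_flip]
    have : s.flip = (s.mul (e j)).flip.mul (residEps e j j) := by
      simp only [residEps]; cases e j <;> simp
    rw [← this]
  · obtain ⟨r, hr⟩ := H j (Function.update a i d) (a i)
    refine ⟨r, fun c => ?_⟩
    rw [Sgn.le_flip, ← hk, Function.update_of_ne (Ne.symm hj), Function.update_comm hj, hr]
    have : s.mul (e j) = (s.mul (e i)).flip.mul (residEps e i j) := by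
      simp only [residEps]; cases e i <;> simp [hj, Sgn.mul_flip, Sgn.flip_mul]
    rw [← this]

/-- The join for the sign `pos`, the meet for the sign `neg`. -/
def jn [Lattice A] : Sgn → A → A → A
  | .pos => (· ⊔ ·)
  | .neg => (· ⊓ ·)

/-- The bottom for the sign `pos`, the top for the sign `neg`. -/
def bt [Lattice A] [BoundedOrder A] : Sgn → A
  | .pos => ⊥
  | .neg => ⊤

lemma jn_le [Lattice A] (s : Sgn) (a b c : A) : s.le (jn s a b) c ↔ s.le a c ∧ s.le b c := by
  cases s
  · exact sup_le_iff
  · exact le_inf_iff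

lemma bt_le [Lattice A] [BoundedOrder A] (s : Sgn) (a : A) : s.le (bt s) a := by
  cases s
  · exact bot_le (α := A)
  · exact le_top (α := A)

lemma map_jn [Lattice A] (H : Residuated s e h) (i : Fin n) (a : Fin n → A) (x y : A) :
    h (Function.update a i (jn (s.mul (e i)) x y)) =
      jn s (h (Function.update a i x)) (h (Function.update a i y)) := by
  have key : ∀ b, s.le (h (Function.update a i (jn (s.mul (e i)) x y))) b ↔
      s.le (jn s (h (Function.update a i x)) (h (Function.update a i y))) b := by
    intro b
    obtain ⟨r, hr⟩ := H i a b
    rw [hr, jn_le, jn_le, hr, hr]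
  exact Sgn.le_antisymm ((key _).2 (Sgn.le_refl _ _)) ((key _).1 (Sgn.le_refl _ _))

lemma map_bt [Lattice A] [BoundedOrder A] (H : Residuated s e h) (i : Fin n) (a : Fin n → A) :
    h (Function.update a i (bt (s.mul (e i)))) = bt s := by
  obtain ⟨r, hr⟩ := H i a (bt s)
  exact Sgn.le_antisymm ((hr _).2 (bt_le _ _)) (bt_le _ _)

end Residuated

/-- A map that preserves all joins has a right adjoint. -/
lemma exists_adjoint {B : Type*} {A : Type*} [CompleteLattice B] [CompleteLattice A] {h : B → A}
    (hh : ∀ X : Set B, h (sSup X) = ⨆ x ∈ X, h x) (b : A) : ∃ r, ∀ c, h c ≤ b ↔ c ≤ r := by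
  refine ⟨sSup {c | h c ≤ b}, fun c => ⟨fun hc => le_sSup hc, fun hc => ?_⟩⟩
  have h1 : h (sSup {c, sSup {c | h c ≤ b}}) = h (sSup {c | h c ≤ b}) := by
    rw [sSup_pair, sup_eq_right.2 hc]
  have h2 : h c ≤ h (sSup {c, sSup {c | h c ≤ b}}) := by
    rw [hh]; exact le_iSup₂_of_le c (by simp) le_rfl
  refine h2.trans (h1.le.trans ?_)
  rw [hh]
  exact iSup₂_le fun x hx => hx

namespace Alg

variable {L : Lang.{u}} {A : Type w} [CompletelyDistribLattice A]

/-- All the operations are residuated in every coordinate. -/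
structure IsResiduated (𝔸 : Alg L A) : Prop where
  F : ∀ f, Residuated .pos (L.F.eps f) (𝔸.opF f)
  G : ∀ g, Residuated .neg (L.G.eps g) (𝔸.opG g)

/-- In a complete lattice, preservation of all joins, resp. meets, amounts to having an adjoint.
That the lattice is generated by its join-prime elements plays no role here. -/
lemma IsPerfect.isResiduated {𝔸 : Alg L A} (h : 𝔸.IsPerfect) : 𝔸.IsResiduated where
  F f i a b := by
    cases hi : L.F.eps f i
    · exact exists_adjoint (B := A) (A := A) (h := fun c => 𝔸.opF f (Function.update a i c))
        (h.F_pos f i hi a) b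
    · exact exists_adjoint (B := Aᵒᵈ) (A := A) (h := fun c => 𝔸.opF f (Function.update a i c))
        (h.F_neg f i hi a) b
  G g i a b := by
    cases hi : L.G.eps g i
    · exact exists_adjoint (B := Aᵒᵈ) (A := Aᵒᵈ) (h := fun c => 𝔸.opG g (Function.update a i c))
        (h.G_pos g i hi a) b
    · exact exists_adjoint (B := A) (A := Aᵒᵈ) (h := fun c => 𝔸.opG g (Function.update a i c))
        (h.G_neg g i hi a) b

lemma iff_le_sSup {P : A → Prop} (h : ∃ r, ∀ c, P c ↔ c ≤ r) (c : A) :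
    P c ↔ c ≤ sSup {c | P c} := by
  obtain ⟨r, hr⟩ := h
  have : {c | P c} = Set.Iic r := Set.ext hr
  rw [this, csSup_Iic, hr]

lemma iff_sInf_le {P : A → Prop} (h : ∃ r, ∀ c, P c ↔ r ≤ c) (c : A) :
    P c ↔ sInf {c | P c} ≤ c := by
  obtain ⟨r, hr⟩ := h
  have : {c | P c} = Set.Ici r := Set.ext hr
  rw [this, csInf_Ici, hr]

section ResidualSpec

variable {𝔸 : Alg L A} (H : 𝔸.IsResiduated)
include H

lemma IsResiduated.sharp_pos (f : L.F.Op) (i) (h : L.F.eps f i = .pos) (a : Fin (L.F.ar f) → A)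
    (c : A) : 𝔸.opF f (Function.update a i c) ≤ a i ↔ c ≤ 𝔸.star.opG (.sharp f i h) a :=
  iff_le_sSup (P := fun c => 𝔸.opF f (Function.update a i c) ≤ a i)
    (by simpa [h, Sgn.le] using H.F f i a (a i)) c

lemma IsResiduated.sharp_neg (f : L.F.Op) (i) (h : L.F.eps f i = .neg) (a : Fin (L.F.ar f) → A)
    (c : A) : 𝔸.opF f (Function.update a i c) ≤ a i ↔ 𝔸.star.opF (.sharp f i h) a ≤ c :=
  iff_sInf_le (P := fun c => 𝔸.opF f (Function.update a i c) ≤ a i)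
    (by simpa [h, Sgn.le] using H.F f i a (a i)) c

lemma IsResiduated.flat_pos (g : L.G.Op) (i) (h : L.G.eps g i = .pos) (a : Fin (L.G.ar g) → A)
    (c : A) : a i ≤ 𝔸.opG g (Function.update a i c) ↔ 𝔸.star.opF (.flat g i h) a ≤ c :=
  iff_sInf_le (P := fun c => a i ≤ 𝔸.opG g (Function.update a i c))
    (by simpa [h, Sgn.le] using H.G g i a (a i)) c

lemma IsResiduated.flat_neg (g : L.G.Op) (i) (h : L.G.eps g i = .neg) (a : Fin (L.G.ar g) → A)
    (c : A) : a i ≤ 𝔸.opG g (Function.update a i c) ↔ c ≤ 𝔸.star.opG (.flat g i h) a :=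
  iff_le_sSup (P := fun c => a i ≤ 𝔸.opG g (Function.update a i c))
    (by simpa [h, Sgn.le] using H.G g i a (a i)) c

/-- The expansion by residuals is again residuated. -/
lemma IsResiduated.star : 𝔸.star.IsResiduated where
  F o := by
    cases o with
    | base f => exact H.F f
    | subR =>
      intro i a b
      match i with
      | 0 => exact ⟨a (1 : Fin 2) \ b, fun c => by
          simp [Alg.star, Sgn.le, Sgn.mul, sup_comm]⟩
      | 1 => exact ⟨a (0 : Fin 2) ⊔ b, fun c => by simp [Alg.star, Sgn.le]⟩
    | subL =>
      intro i a b
      match i with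
      | 0 => exact ⟨a (1 : Fin 2) ⊔ b, fun c => by simp [Alg.star, Sgn.le]⟩
      | 1 => exact ⟨a (0 : Fin 2) \ b, fun c => by
          simp [Alg.star, Sgn.le, Sgn.mul, sup_comm]⟩
    | sharp f i h =>
      have := (H.F f).residual i (k := 𝔸.star.opF (.sharp f i h))
        (fun a c => by simpa [h, Sgn.le] using H.sharp_neg f i h a c)
      simpa [h] using this
    | flat g i h =>
      have := (H.G g).residual i (k := 𝔸.star.opF (.flat g i h))
        (fun a c => by simpa [h, Sgn.le] using H.flat_pos g i h a c)
      simpa [h] using this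
  G o := by
    cases o with
    | base g => exact H.G g
    | impR =>
      intro i a b
      match i with
      | 0 => exact ⟨b ⇨ a (1 : Fin 2), fun c => by
          simp [Alg.star, Sgn.le, Sgn.mul, Sgn.flip, inf_comm]⟩
      | 1 => exact ⟨b ⊓ a (0 : Fin 2), fun c => by simp [Alg.star, Sgn.le]⟩
    | impL =>
      intro i a b
      match i with
      | 0 => exact ⟨b ⊓ a (1 : Fin 2), fun c => by simp [Alg.star, Sgn.le]⟩
      | 1 => exact ⟨b ⇨ a (0 : Fin 2), fun c => by
          simp [Alg.star, Sgn.le, Sgn.mul, Sgn.flip, inf_comm]⟩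
    | sharp f i h =>
      have := (H.F f).residual i (k := 𝔸.star.opG (.sharp f i h))
        (fun a c => by simpa [h, Sgn.le] using H.sharp_pos f i h a c)
      simpa [h] using this
    | flat g i h =>
      have := (H.G g).residual i (k := 𝔸.star.opG (.flat g i h))
        (fun a c => by simpa [h, Sgn.le] using H.flat_neg g i h a c)
      simpa [h] using this

lemma IsResiduated.interp_FLike (c : Conn L) (h : c.FLike) :
    Residuated .pos c.eps (𝔸.interp c) := by
  cases c with
  | F f => exact H.F f
  | meet =>
    intro i a b
    match i with
    | 0 => exact ⟨a (1 : Fin 2) ⇨ b, fun c => by simp [interp, Sgn.le]⟩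
    | 1 => exact ⟨a (0 : Fin 2) ⇨ b, fun c => by simp [interp, Sgn.le, inf_comm]⟩
  | _ => exact h.elim

lemma IsResiduated.interp_GLike (c : Conn L) (h : c.GLike) :
    Residuated .neg c.eps (𝔸.interp c) := by
  cases c with
  | G g => exact H.G g
  | join =>
    intro i a b
    match i with
    | 0 => exact ⟨b \ a (1 : Fin 2), fun c => by simp [interp, Sgn.le, sup_comm]⟩
    | 1 => exact ⟨b \ a (0 : Fin 2), fun c => by simp [interp, Sgn.le]⟩
  | _ => exact h.elim

lemma IsResiduated.interp_mono (c : Conn L) (s : Sgn) {a b : Fin c.ar → A}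
    (hab : ∀ i, (s.mul (c.eps i)).le (a i) (b i)) : s.le (𝔸.interp c a) (𝔸.interp c b) := by
  cases c with
  | top => exact Sgn.le_refl _ _
  | bot => exact Sgn.le_refl _ _
  | meet => exact (H.interp_FLike .meet trivial).mono s hab
  | join => exact (H.interp_GLike .join trivial).mono s hab
  | F f => exact (H.interp_FLike (.F f) trivial).mono s hab
  | G g => exact (H.interp_GLike (.G g) trivial).mono s hab

/-- Values of terms are monotone in the positive leaves and antitone in the negative ones. -/
lemma IsResiduated.eval_mono (t : Term L) (s : Sgn) {v v' : ℕ → A}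
    (h : ∀ s' x, (s', x) ∈ t.leaves s → s'.le (v x) (v' x)) :
    s.le (𝔸.eval v t) (𝔸.eval v' t) := by
  induction t generalizing s with
  | var x => exact h s x (by simp [Tm.leaves])
  | node c a ih =>
    exact H.interp_mono c s fun i => ih i _ fun s' x hx => h s' x (Tm.mem_leaves_node.2 ⟨i, hx⟩)

end ResidualSpec

lemma eval_congr (𝔸 : Alg L A) (t : Term L) (s : Sgn) {v v' : ℕ → A}
    (h : ∀ s' x, (s', x) ∈ t.leaves s → v x = v' x) : 𝔸.eval v t = 𝔸.eval v' t := by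
  induction t generalizing s with
  | var x => exact h s x (by simp [Tm.leaves])
  | node c a ih =>
    simp only [eval]
    congr 1
    funext i
    exact ih i _ fun s' x hx => h s' x (Tm.mem_leaves_node.2 ⟨i, hx⟩)

lemma eval_subst (𝔸 : Alg L A) (t : Term L) (v : ℕ → A) (σ : ℕ → Term L) :
    𝔸.eval v (t.subst σ) = 𝔸.eval (fun x => 𝔸.eval v (σ x)) t := by
  induction t with
  | var x => rfl
  | node c a ih => simp only [Tm.subst, eval, ih]

lemma eval_emb (𝔸 : Alg L A) (t : Term L) (v : ℕ → A) : 𝔸.star.eval v t.emb = 𝔸.eval v t := by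
  induction t with
  | var x => rfl
  | node c a ih =>
    cases c with
    | top => rfl
    | bot => rfl
    | meet => exact congrArg₂ (· ⊓ ·) (ih (0 : Fin 2)) (ih (1 : Fin 2))
    | join => exact congrArg₂ (· ⊔ ·) (ih (0 : Fin 2)) (ih (1 : Fin 2))
    | F f => exact congrArg (𝔸.opF f) (funext ih)
    | G g => exact congrArg (𝔸.opG g) (funext ih)

lemma eval_joinOf (𝔸 : Alg L A) (s : Sgn) (x y : Term L) (v : ℕ → A) :
    𝔸.eval v (Term.joinOf s x y) = Residuated.jn s (𝔸.eval v x) (𝔸.eval v y) := by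
  cases s <;> simp [Term.joinOf, Term.join, Term.meet, eval, interp, Residuated.jn]

lemma eval_botOf (𝔸 : Alg L A) (s : Sgn) (v : ℕ → A) :
    𝔸.eval v (Term.botOf s : Term L) = Residuated.bt s := by
  cases s <;> simp [Term.botOf, Term.top, Term.bot, eval, interp, Residuated.bt]

lemma eval_update (𝔸 : Alg L A) (c : Conn L) (a : Fin c.ar → Term L) (i : Fin c.ar) (x : Term L)
    (v : ℕ → A) : 𝔸.eval v (.node c (Function.update a i x)) =
      𝔸.interp c (Function.update (fun j => 𝔸.eval v (a j)) i (𝔸.eval v x)) := by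
  simp only [eval]
  congr 1
  funext j
  by_cases hj : j = i
  · subst hj; simp
  · simp [Function.update_of_ne hj]

end Alg

section Soundness

variable {L : Lang.{u}} {A : Type w} [CompletelyDistribLattice A]

lemma Rewrite.eval_eq {𝔸 : Alg L A} (H : 𝔸.IsResiduated) {t t' : Term L} (h : Rewrite t t')
    (v : ℕ → A) : 𝔸.eval v t = 𝔸.eval v t' := by
  induction h with
  | distF c a i x y hc =>
    have := (H.interp_FLike c hc).map_jn i (fun j => 𝔸.eval v (a j)) (𝔸.eval v x) (𝔸.eval v y)
    rw [Alg.eval_update, Alg.eval_joinOf]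
    refine this.trans ?_
    rw [← Alg.eval_update, ← Alg.eval_update, ← Alg.eval_joinOf]
    rfl
  | distG c a i x y hc =>
    have := (H.interp_GLike c hc).map_jn i (fun j => 𝔸.eval v (a j)) (𝔸.eval v x) (𝔸.eval v y)
    rw [Alg.eval_update, Alg.eval_joinOf]
    refine this.trans ?_
    rw [← Alg.eval_update, ← Alg.eval_update, ← Alg.eval_joinOf]
    rfl
  | constF c a i hc =>
    have := (H.interp_FLike c hc).map_bt i (fun j => 𝔸.eval v (a j))
    rw [Alg.eval_update, Alg.eval_botOf]
    exact this.trans (Alg.eval_botOf 𝔸 .pos v).symm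
  | constG c a i hc =>
    have := (H.interp_GLike c hc).map_bt i (fun j => 𝔸.eval v (a j))
    rw [Alg.eval_update, Alg.eval_botOf]
    exact this.trans (Alg.eval_botOf 𝔸 .neg v).symm
  | inside c a i t h ih =>
    rw [Alg.eval_update, ← ih]
    simp [Alg.eval]

lemma Simplify.holds_iff {𝔸 : Alg L A} (H : 𝔸.IsResiduated) {e : Ineq L} {es : List (Ineq L)}
    (h : Simplify e es) (v : ℕ → A) : e.Holds 𝔸 v ↔ ∀ e' ∈ es, e'.Holds 𝔸 v := by
  cases h with
  | left s s' t h => simp [Ineq.Holds, h.eval_eq H]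
  | right s t t' h => simp [Ineq.Holds, h.eval_eq H]
  | splitMeet s t t' =>
    simp [Ineq.Holds, Term.meet, Alg.eval, Alg.interp]
  | splitJoin s s' t =>
    simp [Ineq.Holds, Term.join, Alg.eval, Alg.interp]
  | dropTop s => simp [Ineq.Holds, Term.top, Alg.eval, Alg.interp]
  | dropBot s => simp [Ineq.Holds, Term.bot, Alg.eval, Alg.interp]

lemma Residuate.holds_iff {𝔸 : Alg L A} (H : 𝔸.IsResiduated) {e e' : Ineq L.star}
    (h : Residuate e e') (v : ℕ → A) : e.Holds 𝔸.star v ↔ e'.Holds 𝔸.star v := by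
  have hu : ∀ {n : ℕ} (a : Fin n → Term L.star) (i : Fin n) (c : Term L.star),
      (fun j => 𝔸.star.eval v (Function.update a i c j)) =
        Function.update (fun j => 𝔸.star.eval v (a j)) i (𝔸.star.eval v c) := by
    intro n a i c
    funext j
    by_cases hj : j = i
    · subst hj; simp
    · simp [Function.update_of_ne hj]
  cases h with
  | F_pos f i h a c =>
    have := H.sharp_pos f i h (Function.update (fun j => 𝔸.star.eval v (a j)) i (𝔸.star.eval v c))
      (𝔸.star.eval v (a i))
    simp only [Function.update_idem, Function.update_self, Function.update_eq_self] at this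
    simp only [Ineq.Holds, Alg.eval, Alg.interp]
    rw [hu]
    exact this
  | F_neg f i h a c =>
    have := H.sharp_neg f i h (Function.update (fun j => 𝔸.star.eval v (a j)) i (𝔸.star.eval v c))
      (𝔸.star.eval v (a i))
    simp only [Function.update_idem, Function.update_self, Function.update_eq_self] at this
    simp only [Ineq.Holds, Alg.eval, Alg.interp]
    rw [hu]
    exact this
  | G_pos g i h a c =>
    have := H.flat_pos g i h (Function.update (fun j => 𝔸.star.eval v (a j)) i (𝔸.star.eval v c))
      (𝔸.star.eval v (a i))
    simp only [Function.update_idem, Function.update_self, Function.update_eq_self] at this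
    simp only [Ineq.Holds, Alg.eval, Alg.interp]
    rw [hu]
    exact this
  | G_neg g i h a c =>
    have := H.flat_neg g i h (Function.update (fun j => 𝔸.star.eval v (a j)) i (𝔸.star.eval v c))
      (𝔸.star.eval v (a i))
    simp only [Function.update_idem, Function.update_self, Function.update_eq_self] at this
    simp only [Ineq.Holds, Alg.eval, Alg.interp]
    rw [hu]
    exact this
  | meet_left a b c => exact le_himp_iff.symm
  | meet_right a b c =>
    exact Iff.trans (by rw [inf_comm]; rfl) (le_himp_iff (α := A)).symm
  | join_left a b c =>
    exact Iff.trans (by rw [sup_comm]; rfl) (sdiff_le_iff (α := A)).symm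
  | join_right a b c => exact sdiff_le_iff.symm

lemma Alg.bigJoin_le_iff (𝔸 : Alg L A) (v : ℕ → A) (as : List (Term L)) (b : A) :
    𝔸.eval v (Term.bigJoin as) ≤ b ↔ ∀ a ∈ as, 𝔸.eval v a ≤ b := by
  induction as using Term.bigJoin.induct with
  | case1 => simp [Term.bigJoin, Term.bot, Alg.eval, Alg.interp]
  | case2 => simp [Term.bigJoin]
  | case3 a b l ih =>
    rw [Term.bigJoin, Term.join, Alg.eval, List.forall_mem_cons, ← ih]
    simp [Alg.interp]

lemma Alg.le_bigMeet_iff (𝔸 : Alg L A) (v : ℕ → A) (as : List (Term L)) (b : A) :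
    b ≤ 𝔸.eval v (Term.bigMeet as) ↔ ∀ a ∈ as, b ≤ 𝔸.eval v a := by
  induction as using Term.bigMeet.induct with
  | case1 => simp [Term.bigMeet, Term.top, Alg.eval, Alg.interp]
  | case2 => simp [Term.bigMeet]
  | case3 a b l ih =>
    rw [Term.bigMeet, Term.meet, Alg.eval, List.forall_mem_cons, ← ih]
    simp [Alg.interp]

lemma Alg.eval_subst1 (𝔸 : Alg L A) (v : ℕ → A) (p : ℕ) (a t : Term L) :
    𝔸.eval v (Term.subst1 p a t) = 𝔸.eval (Function.update v p (𝔸.eval v a)) t := by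
  rw [Term.subst1, Alg.eval_subst]
  congr 1
  funext x
  by_cases hx : x = p
  · subst hx; simp
  · simp [hx, Alg.eval]

lemma Alg.eval_update_of_not_occurs (𝔸 : Alg L A) (v : ℕ → A) (p : ℕ) (b : A) {t : Term L}
    (h : ¬ t.Occurs p) : 𝔸.eval (Function.update v p b) t = 𝔸.eval v t := by
  refine 𝔸.eval_congr t .pos fun s' x hx => ?_
  rw [Function.update_of_ne]
  rintro rfl
  exact h ((Term.occurs_iff .pos).2 ⟨s', hx⟩)

/-- The variable `p` occurs in `e` only with the sign `s` in the generation trees `+lhs`, `−rhs`: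
`e` is preserved when the value of `p` decreases with respect to `s`. -/
lemma Ineq.Holds.update {𝔸 : Alg L A} (H : 𝔸.IsResiduated) {e : Ineq L} {v : ℕ → A} {p : ℕ}
    {b : A} {s : Sgn} (he : e.Holds 𝔸 v) (hp : (s.flip, p) ∉ e.leaves) (hb : s.le b (v p)) :
    e.Holds 𝔸 (Function.update v p b) := by
  have key : ∀ s' x, (s', x) ∈ e.leaves → s'.le (Function.update v p b x) (v x) := by
    intro s' x hx
    by_cases hxp : x = p
    · subst hxp
      by_cases hs : s' = s
      · subst hs; simpa using hb
      · exact absurd (Sgn.eq_flip_of_ne hs ▸ hx) hp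
    · rw [Function.update_of_ne hxp]; exact Sgn.le_refl _ _
  have h1 := H.eval_mono e.lhs .pos (v := Function.update v p b) (v' := v)
    fun s' x hx => key s' x (List.mem_append_left _ hx)
  have h2 := H.eval_mono e.rhs .neg (v := Function.update v p b) (v' := v)
    fun s' x hx => key s' x (List.mem_append_right _ hx)
  exact le_trans (α := A) h1 (le_trans (α := A) he h2)

lemma Ineq.holds_subst1 (𝔸 : Alg L A) (v : ℕ → A) (p : ℕ) (a : Term L) (e : Ineq L) :
    (e.subst1 p a).Holds 𝔸 v ↔ e.Holds 𝔸 (Function.update v p (𝔸.eval v a)) := by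
  simp [Ineq.Holds, Ineq.subst1, Alg.eval_subst1]

lemma Ineq.holds_bound (𝔸 : Alg L A) (v : ℕ → A) (s : Sgn) (x : ℕ) (a : Term L) :
    (Ineq.bound s x a).Holds 𝔸 v ↔ s.le (v x) (𝔸.eval v a) := by
  cases s <;> rfl

/-- Every ALBA rule preserves and reflects validity. -/
lemma ALBAStep.valid_iff {𝔸 : Alg L A} (H : 𝔸.IsResiduated) {q : QIneq L.star}
    {qs : List (QIneq L.star)} (h : ALBAStep q qs) :
    q.Valid 𝔸.star ↔ ∀ q' ∈ qs, q'.Valid 𝔸.star := by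
  have H' := H.star
  cases h with
  | concl ps e es h =>
    simp only [List.mem_map, forall_exists_index, and_imp, forall_apply_eq_imp_iff₂,
      QIneq.Valid]
    constructor
    · exact fun hq e' he' v hv => (h.holds_iff H' v).1 (hq v hv) e' he'
    · exact fun hq v hv => (h.holds_iff H' v).2 fun e' he' => hq e' he' v hv
  | prem ps ps' e c es h =>
    simp only [List.mem_singleton, forall_eq, QIneq.Valid]
    refine forall_congr' fun v => imp_congr_left ?_
    simp only [List.forall_mem_append, List.forall_mem_cons, h.holds_iff H' v]
    tauto
  | residuation ps ps' e e' c h =>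
    simp only [List.mem_singleton, forall_eq, QIneq.Valid]
    refine forall_congr' fun v => imp_congr_left ?_
    simp only [List.forall_mem_append, List.forall_mem_cons, h.holds_iff H v]
  | invertedAckermann e σ hnd hocc =>
    simp only [List.mem_singleton, forall_eq, QIneq.Valid, List.not_mem_nil, false_implies,
      implies_true, forall_const, List.forall_mem_map, Prod.forall, Ineq.holds_bound]
    simp only [Ineq.Holds, Alg.eval_subst]
    constructor
    · intro h v hv
      have h1 := H'.eval_mono e.lhs .pos (v := v) (v' := fun x => 𝔸.star.eval v (σ x))
        fun s' x hx => hv s' x (List.mem_append_left _ hx)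
      have h2 := H'.eval_mono e.rhs .neg (v := v) (v' := fun x => 𝔸.star.eval v (σ x))
        fun s' x hx => hv s' x (List.mem_append_right _ hx)
      exact le_trans (α := A) h1 (le_trans (α := A) (h v) h2)
    · intro h v
      classical
      -- Each variable of `e` takes the value of the term substituted for it, so that the premises
      -- hold with equality.
      let w : ℕ → A := fun x => if x ∈ e.leaves.map Prod.snd then 𝔸.star.eval v (σ x) else v x
      have hw : ∀ s' x, (s', x) ∈ e.leaves → w x = 𝔸.star.eval v (σ x) := fun s' x hx =>
        if_pos (List.mem_map.2 ⟨(s', x), hx, rfl⟩)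
      have hσ : ∀ s' x, (s', x) ∈ e.leaves → 𝔸.star.eval w (σ x) = 𝔸.star.eval v (σ x) := by
        intro s' x hx
        refine 𝔸.star.eval_congr _ .pos fun s₁ y hy => if_neg fun hy' => ?_
        exact hocc y hy' x (List.mem_map.2 ⟨(s', x), hx, rfl⟩)
          ((Term.occurs_iff .pos).2 ⟨s₁, hy⟩)
      have := h w fun s' x hx => by
        rw [hw s' x hx, hσ s' x hx]; exact Sgn.le_refl _ _
      rwa [𝔸.star.eval_congr e.lhs .pos fun s' x hx => hw s' x (List.mem_append_left _ hx),
        𝔸.star.eval_congr e.rhs .neg fun s' x hx => hw s' x (List.mem_append_right _ hx)] at this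
  | rightAckermann p as ps rest c hperm has hrest hc hc' =>
    simp only [List.mem_singleton, forall_eq, QIneq.Valid, hperm.mem_iff]
    simp only [List.forall_mem_append, List.forall_mem_map, Ineq.holds_subst1]
    constructor
    · -- The least value of `p` that satisfies the deleted premises is the join of their left sides.
      intro h v hv
      have := h (Function.update v p (𝔸.star.eval v (Term.bigJoin as))) ⟨fun a ha => ?_, hv⟩
      · simpa [Ineq.Holds, Alg.eval_update_of_not_occurs, hc, hc'] using this
      · simp only [Ineq.Holds, Alg.eval, Function.update_self]
        rw [Alg.eval_update_of_not_occurs _ _ _ _ (has a ha)]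
        exact (Alg.bigJoin_le_iff _ _ _ _).1 le_rfl a ha
    · rintro h v ⟨hv, hv'⟩
      refine h v fun e he => (hv' e he).update H' (s := .pos) ?_ ?_
      · have := hrest e he
        simp only [Ineq.leaves, List.mem_append, not_or]
        exact ⟨this.1, fun h => this.2 ((Tm.mem_leaves_flip (s := .pos)).1 h)⟩
      · exact (Alg.bigJoin_le_iff _ _ _ _).2 fun a ha => hv a ha
  | leftAckermann p as ps rest c hperm has hrest hc hc' =>
    simp only [List.mem_singleton, forall_eq, QIneq.Valid, hperm.mem_iff]
    simp only [List.forall_mem_append, List.forall_mem_map, Ineq.holds_subst1]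
    constructor
    · intro h v hv
      have := h (Function.update v p (𝔸.star.eval v (Term.bigMeet as))) ⟨fun a ha => ?_, hv⟩
      · simpa [Ineq.Holds, Alg.eval_update_of_not_occurs, hc, hc'] using this
      · simp only [Ineq.Holds, Alg.eval, Function.update_self]
        rw [Alg.eval_update_of_not_occurs _ _ _ _ (has a ha)]
        exact (Alg.le_bigMeet_iff _ _ _ _).1 le_rfl a ha
    · rintro h v ⟨hv, hv'⟩
      refine h v fun e he => (hv' e he).update H' (s := .neg) ?_ ?_
      · have := hrest e he
        simp only [Ineq.leaves, List.mem_append, not_or]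
        exact ⟨this.1, fun h => this.2 ((Tm.mem_leaves_flip (s := .pos)).1 h)⟩
      · exact (Alg.le_bigMeet_iff _ _ _ _).2 fun a ha => hv a ha

/-- ALBA reductions preserve and reflect validity. -/
lemma ALBAReduces.valid_iff {𝔸 : Alg L A} (H : 𝔸.IsResiduated) {Q Q' : List (QIneq L.star)}
    (h : ALBAReduces Q Q') :
    (∀ q ∈ Q, q.Valid 𝔸.star) ↔ ∀ q ∈ Q', q.Valid 𝔸.star := by
  induction h with
  | refl => rfl
  | tail _ h ih =>
    obtain ⟨Q₁, q, Q₂, qs, rfl, hq, rfl⟩ := h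
    rw [ih]
    simp only [List.forall_mem_append, List.forall_mem_cons, hq.valid_iff H, and_assoc]

end Soundness

/-! ### Subtrees and paths -/

namespace Tm

variable {S : OSig.{u}} {α : Type v} {β : Type w}

lemma subAt_nil {s s' : Sgn} {t u : Tm S α} : SubAt s t [] s' u ↔ s = s' ∧ t = u := by
  constructor
  · intro h
    cases h
    exact ⟨rfl, rfl⟩
  · rintro ⟨rfl, rfl⟩
    exact .root _ _

lemma subAt_var {s s' : Sgn} {x : α} {p : List ℕ} {u : Tm S α} :
    SubAt s (.var x) p s' u ↔ p = [] ∧ s = s' ∧ .var x = u := by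
  constructor
  · intro h
    cases h
    exact ⟨rfl, rfl, rfl⟩
  · rintro ⟨rfl, rfl, rfl⟩
    exact .root _ _

lemma subAt_cons {s s' : Sgn} {o : S.Op} {a : Fin (S.ar o) → Tm S α} {k : ℕ} {p : List ℕ}
    {u : Tm S α} : SubAt s (.node o a) (k :: p) s' u ↔
      ∃ i : Fin (S.ar o), k = i.val ∧ SubAt (s.mul (S.eps o i)) (a i) p s' u := by
  constructor
  · intro h
    generalize hq : k :: p = q at h
    cases h with
    | root => exact absurd hq (by simp)
    | step _ _ _ _ i p' _ h =>
      obtain ⟨rfl, rfl⟩ := List.cons.inj hq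
      exact ⟨i, rfl, h⟩
  · rintro ⟨i, rfl, h⟩
    exact .step _ _ _ _ _ _ _ h

lemma SubAt.unique {s s₁ s' s₁' : Sgn} {t u u' : Tm S α} {p : List ℕ} (h : SubAt s t p s' u)
    (h' : SubAt s₁ t p s₁' u') : u = u' := by
  induction t generalizing s s₁ p with
  | var x => exact (subAt_var.1 h).2.2.symm.trans (subAt_var.1 h').2.2
  | node o a ih =>
    cases p with
    | nil => exact (subAt_nil.1 h).2.symm.trans (subAt_nil.1 h').2
    | cons k p =>
      obtain ⟨i, rfl, hi⟩ := subAt_cons.1 h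
      obtain ⟨j, hj, h'⟩ := subAt_cons.1 h'
      obtain rfl := Fin.ext hj
      exact ih _ hi h'

lemma SubAt.sign_unique {s s' s'' : Sgn} {t u u' : Tm S α} {p : List ℕ} (h : SubAt s t p s' u)
    (h' : SubAt s t p s'' u') : s' = s'' := by
  induction t generalizing s p with
  | var x => exact (subAt_var.1 h).2.1.symm.trans (subAt_var.1 h').2.1
  | node o a ih =>
    cases p with
    | nil => exact (subAt_nil.1 h).1.symm.trans (subAt_nil.1 h').1
    | cons k p =>
      obtain ⟨i, rfl, hi⟩ := subAt_cons.1 h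
      obtain ⟨j, hj, h'⟩ := subAt_cons.1 h'
      obtain rfl := Fin.ext hj
      exact ih _ hi h'

lemma SubAt.change_sign {s s' : Sgn} {t u : Tm S α} {p : List ℕ} (h : SubAt s t p s' u)
    (s₁ : Sgn) : ∃ s₁', SubAt s₁ t p s₁' u := by
  induction h generalizing s₁ with
  | root s t => exact ⟨s₁, .root _ _⟩
  | step s s' o a i p u h ih =>
    obtain ⟨s₁', h'⟩ := ih (s₁.mul (S.eps o i))
    exact ⟨s₁', .step _ _ _ _ _ _ _ h'⟩

lemma SubAt.append {s s' s'' : Sgn} {t u v : Tm S α} {p d : List ℕ} (h : SubAt s t p s' u)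
    (h' : SubAt s' u d s'' v) : SubAt s t (p ++ d) s'' v := by
  induction h with
  | root => exact h'
  | step s s' o a i p u h ih => exact .step _ _ _ _ _ _ _ (ih h')

lemma SubAt.of_append {s s' s'' : Sgn} {t u v : Tm S α} {p d : List ℕ} (h : SubAt s t p s' u)
    (h' : SubAt s t (p ++ d) s'' v) : SubAt s' u d s'' v := by
  induction h with
  | root => exact h'
  | step s s' o a i p u h ih =>
    obtain ⟨j, hj, h'⟩ := subAt_cons.1 h'
    obtain rfl := Fin.ext hj
    exact ih h'

lemma SubAt.subst {s s' : Sgn} {t u : Tm S α} {p : List ℕ} (h : SubAt s t p s' u)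
    (σ : α → Tm S β) : SubAt s (t.subst σ) p s' (u.subst σ) := by
  induction h with
  | root => exact .root _ _
  | step s s' o a i p u h ih => exact .step _ _ _ _ _ _ _ ih

/-- A leaf of a substitution instance lies in the tree that is substituted for some leaf. -/
lemma SubAt.subst_var {s s' : Sgn} {t : Tm S α} {σ : α → Tm S β} {q : List ℕ} {y : β}
    (h : SubAt s (t.subst σ) q s' (.var y)) :
    ∃ p d x s₁, q = p ++ d ∧ SubAt s t p s₁ (.var x) ∧ SubAt s₁ (σ x) d s' (.var y) := by
  induction t generalizing s q with
  | var x => exact ⟨[], q, x, s, rfl, .root _ _, h⟩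
  | node o a ih =>
    cases q with
    | nil => exact absurd (subAt_nil.1 h).2 (by simp [Tm.subst])
    | cons k q =>
      obtain ⟨i, rfl, hi⟩ := subAt_cons.1 h
      obtain ⟨p, d, x, s₁, rfl, h₁, h₂⟩ := ih i hi
      exact ⟨i.val :: p, d, x, s₁, rfl, .step _ _ _ _ _ _ _ h₁, h₂⟩

lemma mem_leaves_iff_subAt {s s' : Sgn} {t : Tm S α} {x : α} :
    (s', x) ∈ t.leaves s ↔ ∃ p, SubAt s t p s' (.var x) := by
  induction t generalizing s with
  | var y =>
    rw [mem_leaves_var]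
    constructor
    · rintro ⟨rfl, rfl⟩
      exact ⟨[], .root _ _⟩
    · rintro ⟨p, h⟩
      obtain ⟨-, hs, hx⟩ := subAt_var.1 h
      exact ⟨hs.symm, (Tm.var.inj hx).symm⟩
  | node o a ih =>
    simp only [mem_leaves_node, ih]
    constructor
    · rintro ⟨i, p, h⟩
      exact ⟨_, .step _ _ _ _ _ _ _ h⟩
    · rintro ⟨p, h⟩
      cases p with
      | nil => exact absurd (subAt_nil.1 h).2 (by simp)
      | cons k p =>
        obtain ⟨i, rfl, hi⟩ := subAt_cons.1 h
        exact ⟨i, p, hi⟩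

lemma SubAt.leaf_path_unique {s s₁ s' s₁' : Sgn} {t : Tm S α} {p p' d d' : List ℕ} {x x' : α}
    (h : SubAt s t p s' (.var x)) (h' : SubAt s₁ t p' s₁' (.var x')) (hd : p ++ d = p' ++ d') :
    p = p' ∧ d = d' ∧ x = x' := by
  obtain ⟨s₂, h'⟩ := h'.change_sign s
  have key : p = p' := by
    rcases List.append_eq_append_iff.1 hd with ⟨c, rfl, -⟩ | ⟨c, rfl, -⟩
    · simp [(subAt_var.1 (h.of_append h')).1]
    · simp [(subAt_var.1 (h'.of_append h)).1]
  subst key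
  exact ⟨rfl, List.append_cancel_left hd, Tm.var.inj (h.unique h')⟩

lemma SubAt.path_unique_of_nodup {s s' s'' : Sgn} {t : Tm S α} {p p' : List ℕ} {x : α}
    (hn : ((t.leaves s).map Prod.snd).Nodup) (h : SubAt s t p s' (.var x))
    (h' : SubAt s t p' s'' (.var x)) : p = p' := by
  induction t generalizing s p p' with
  | var y => rw [(subAt_var.1 h).1, (subAt_var.1 h').1]
  | node o a ih =>
    rw [leaves, List.map_flatMap, List.nodup_flatMap] at hn
    cases p with
    | nil => exact absurd (subAt_nil.1 h).2 (by simp)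
    | cons k p =>
    cases p' with
    | nil => exact absurd (subAt_nil.1 h').2 (by simp)
    | cons k' p' =>
      obtain ⟨i, rfl, hi⟩ := subAt_cons.1 h
      obtain ⟨j, rfl, hj⟩ := subAt_cons.1 h'
      have hij : i = j := by
        by_contra hij
        have hsymm : Std.Symm (Function.onFun List.Disjoint fun i =>
            ((a i).leaves (s.mul (S.eps o i))).map Prod.snd) := ⟨fun _ _ h => h.symm⟩
        exact hn.2.forall (List.mem_finRange i) (List.mem_finRange j) hij
          (List.mem_map.2 ⟨_, mem_leaves_iff_subAt.2 ⟨_, hi⟩, rfl⟩)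
          (List.mem_map.2 ⟨_, mem_leaves_iff_subAt.2 ⟨_, hj⟩, rfl⟩)
      subst hij
      rw [ih i (hn.1 i (List.mem_finRange i)) hi hj]

lemma replace_of_forall_not {z : Tm S α} {P : List ℕ → Prop} (t : Tm S α) (h : ∀ p, ¬ P p) :
    replace z P t = t := by
  induction t generalizing P with
  | var x => simp [replace, h]
  | node o a ih =>
    rw [replace, if_neg (h _)]
    congr 1
    funext i
    exact ih i fun p => h _

/-- Replacing a subtree of the tree substituted for `x`, in all its copies. -/
lemma replace_subst [DecidableEq α] {z : Tm S β} {σ : α → Tm S β} {x : α} {d : List ℕ}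
    {P : List ℕ → Prop} (s : Sgn) (t : Tm S α)
    (hP : ∀ q, P q ↔ ∃ p, q = p ++ d ∧ ∃ s', SubAt s t p s' (.var x)) :
    replace z P (t.subst σ) =
      t.subst (Function.update σ x (replace z (fun p => p = d) (σ x))) := by
  induction t generalizing s P with
  | var y =>
    simp only [subst]
    by_cases hy : y = x
    · subst hy
      rw [Function.update_self]
      congr 1
      funext q
      simp [hP, subAt_var]
    · rw [Function.update_of_ne hy]
      refine replace_of_forall_not _ fun p hp => ?_
      obtain ⟨p, -, s', h⟩ := (hP _).1 hp
      exact hy (Tm.var.inj (subAt_var.1 h).2.2)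
  | node o a ih =>
    have h0 : ¬ P [] := by
      rw [hP]
      rintro ⟨p, hp, s', h⟩
      obtain rfl : p = [] := (List.append_eq_nil_iff.1 hp.symm).1
      exact absurd (subAt_nil.1 h).2 (by simp)
    simp only [subst, replace, if_neg h0]
    congr 1
    funext i
    refine ih i (s.mul (S.eps o i)) fun q => ?_
    rw [hP]
    constructor
    · rintro ⟨p, hp, s', h⟩
      cases p with
      | nil => exact absurd (subAt_nil.1 h).2 (by simp)
      | cons k p =>
        obtain ⟨j, rfl, hj⟩ := subAt_cons.1 h
        rw [List.cons_append, List.cons.injEq] at hp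
        obtain rfl := Fin.ext hp.1
        exact ⟨p, hp.2, s', hj⟩
    · rintro ⟨p, rfl, s', h⟩
      exact ⟨i.val :: p, rfl, s', .step _ _ _ _ _ _ _ h⟩

end Tm

/-! ### Rules with a linear conclusion are analytic -/

namespace Seqt

variable {L : Lang.{u}} {α : Type v} {β : Type w}

lemma side_subst (q : Seqt L α) (σ : α → Str L β) (s : Sgn) :
    (q.subst σ).side s = (q.side s).subst σ := by
  cases s <;> rfl

lemma mem_leaves {q : Seqt L α} {s : Sgn} {x : α} :
    (s, x) ∈ q.leaves ↔ ∃ s₀, (s, x) ∈ (q.side s₀).leaves s₀ := by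
  rw [leaves, List.mem_append]
  exact ⟨fun h => h.elim (fun h => ⟨.pos, h⟩) fun h => ⟨.neg, h⟩,
    fun ⟨s₀, h⟩ => by cases s₀; exacts [Or.inl h, Or.inr h]⟩

lemma nodup_side {q : Seqt L α} (h : (q.leaves.map Prod.snd).Nodup) (s : Sgn) :
    (((q.side s).leaves s).map Prod.snd).Nodup := by
  rw [leaves, List.map_append, List.nodup_append'] at h
  cases s
  exacts [h.1, h.2.1]

lemma side_unique {q : Seqt L α} (h : (q.leaves.map Prod.snd).Nodup) {s₀ s₁ s s' : Sgn} {x : α}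
    (h₀ : (s, x) ∈ (q.side s₀).leaves s₀) (h₁ : (s', x) ∈ (q.side s₁).leaves s₁) : s₀ = s₁ := by
  rw [leaves, List.map_append, List.nodup_append'] at h
  cases s₀ <;> cases s₁
  · rfl
  · exact (h.2.2 (List.mem_map.2 ⟨_, h₀, rfl⟩) (List.mem_map.2 ⟨_, h₁, rfl⟩)).elim
  · exact (h.2.2 (List.mem_map.2 ⟨_, h₁, rfl⟩) (List.mem_map.2 ⟨_, h₀, rfl⟩)).elim
  · rfl

end Seqt

namespace Rule

variable {L : Lang.{u}}

/-- Every structural variable occurs at most once in the conclusion, and the variables of the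
premises occur there in the same position. -/
structure Linear (r : Rule L ℕ) : Prop where
  nodup : (r.concl.leaves.map Prod.snd).Nodup
  subset : ∀ q ∈ r.prems, ∀ l ∈ q.leaves, l ∈ r.concl.leaves

lemma seqAt_inst (r : Rule L ℕ) (σ : ℕ → Str L (Term L)) (k : Option ℕ) :
    (r.inst σ).seqAt k = (r.seqAt k).map (Seqt.subst σ) := by
  cases k <;> simp [seqAt, inst]

lemma At.subst {r : Rule L ℕ} {σ : ℕ → Str L (Term L)} {π : Pos} {s : Sgn} {u : Str L ℕ}
    (h : r.At π s u) : (r.inst σ).At π s (u.subst σ) := by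
  obtain ⟨q, hq, h⟩ := h
  refine ⟨q.subst σ, by rw [seqAt_inst, hq]; rfl, ?_⟩
  rw [Seqt.side_subst]
  exact h.subst σ

lemma At.append {α : Type v} {r : Rule L α} {k : Option ℕ} {s₀ s s' : Sgn} {p d : List ℕ}
    {u v : Str L α} (h : r.At ⟨k, s₀, p⟩ s u) (h' : u.SubAt s d s' v) :
    r.At ⟨k, s₀, p ++ d⟩ s' v := by
  obtain ⟨q, hq, h⟩ := h
  exact ⟨q, hq, h.append h'⟩

lemma At.of_append {α : Type v} {r : Rule L α} {k : Option ℕ} {s₀ s s' : Sgn} {p d : List ℕ}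
    {u v : Str L α} (h : r.At ⟨k, s₀, p⟩ s u) (h' : r.At ⟨k, s₀, p ++ d⟩ s' v) :
    u.SubAt s d s' v := by
  obtain ⟨q, hq, h⟩ := h
  obtain ⟨q', hq', h'⟩ := h'
  obtain rfl := Option.some.inj (hq.symm.trans hq')
  exact h.of_append h'

/-- The formulas of an instance lie in the structures assigned to the variables. -/
lemma At.exists_inside {r : Rule L ℕ} {σ : ℕ → Str L (Term L)} {π : Pos} {s : Sgn} {A : Term L}
    (h : (r.inst σ).At π s (.var A)) : ∃ p d x s₁, π.path = p ++ d ∧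
      r.At ⟨π.seq, π.side, p⟩ s₁ (.var x) ∧ (σ x).SubAt s₁ d s (.var A) := by
  obtain ⟨q, hq, h⟩ := h
  rw [seqAt_inst, Option.map_eq_some_iff] at hq
  obtain ⟨q, hq, rfl⟩ := hq
  rw [Seqt.side_subst] at h
  obtain ⟨p, d, x, s₁, hp, h₁, h₂⟩ := h.subst_var
  exact ⟨p, d, x, s₁, hp, ⟨q, hq, h₁⟩, h₂⟩

lemma Inside.unique {r : Rule L ℕ} {π : Pos} {x x' : ℕ} {d d' : List ℕ} (h : r.Inside x d π)
    (h' : r.Inside x' d' π) : x = x' ∧ d = d' := by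
  obtain ⟨p, s, hp, q, hq, h⟩ := h
  obtain ⟨p', s', hp', q', hq', h'⟩ := h'
  obtain rfl := Option.some.inj (hq.symm.trans hq')
  have := h.leaf_path_unique h' (hp.symm.trans hp')
  exact ⟨this.2.2, this.2.1⟩

namespace Linear

variable {r : Rule L ℕ} (H : r.Linear)
include H

lemma concl_unique {s₀ s₁ s s' : Sgn} {p p' : List ℕ} {x : ℕ}
    (h : r.At ⟨none, s₀, p⟩ s (.var x)) (h' : r.At ⟨none, s₁, p'⟩ s' (.var x)) :
    s₀ = s₁ ∧ p = p' := by
  obtain ⟨q, hq, h⟩ := h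
  obtain rfl := Option.some.inj hq
  obtain ⟨q, hq, h'⟩ := h'
  obtain rfl := Option.some.inj hq
  obtain rfl := Seqt.side_unique H.nodup (Tm.mem_leaves_iff_subAt.2 ⟨_, h⟩)
    (Tm.mem_leaves_iff_subAt.2 ⟨_, h'⟩)
  exact ⟨rfl, h.path_unique_of_nodup (Seqt.nodup_side H.nodup _) h'⟩

lemma exists_concl {π : Pos} {s : Sgn} {x : ℕ} (h : r.At π s (.var x)) :
    ∃ s₀ p, r.At ⟨none, s₀, p⟩ s (.var x) := by
  obtain ⟨q, hq, h⟩ := h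
  have hx : (s, x) ∈ q.leaves := Seqt.mem_leaves.2 ⟨_, Tm.mem_leaves_iff_subAt.2 ⟨_, h⟩⟩
  have hx' : (s, x) ∈ r.concl.leaves := by
    rcases hk : π.seq with _ | k
    · rw [hk] at hq
      obtain rfl := Option.some.inj hq
      exact hx
    · rw [hk] at hq
      exact H.subset q (List.mem_of_getElem? hq) _ hx
  obtain ⟨s₀, h₀⟩ := Seqt.mem_leaves.1 hx'
  obtain ⟨p, hp⟩ := Tm.mem_leaves_iff_subAt.1 h₀
  exact ⟨s₀, p, r.concl, rfl, hp⟩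

lemma sign_unique {π π' : Pos} {s s' : Sgn} {x : ℕ} (h : r.At π s (.var x))
    (h' : r.At π' s' (.var x)) : s = s' := by
  obtain ⟨s₀, p, h⟩ := H.exists_concl h
  obtain ⟨s₁, p', h'⟩ := H.exists_concl h'
  obtain ⟨rfl, rfl⟩ := H.concl_unique h h'
  obtain ⟨q, hq, h⟩ := h
  obtain ⟨q', hq', h'⟩ := h'
  obtain rfl := Option.some.inj (hq.symm.trans hq')
  exact h.sign_unique h'

lemma c1 : r.C1 := by
  intro σ π s A _ h
  obtain ⟨p, d, x, s₁, -, hx, hA⟩ := h.exists_inside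
  obtain ⟨s₀, p', h'⟩ := H.exists_concl hx
  exact ⟨⟨none, s₀, p' ++ d⟩, s, A, rfl, h'.subst.append hA, [], .pos, .root _ _⟩

omit H in
lemma c2 : r.C2 := by
  rintro σ ⟨k, s₀, q⟩ ⟨k', s₀', q'⟩ s s' u u' ⟨x, d, -, ⟨p, s₁, hp, h⟩, ⟨p', s₁', hp', h'⟩⟩ hu hu'
  obtain rfl : q = p ++ d := hp
  obtain rfl : q' = p' ++ d := hp'
  exact (h.subst.of_append hu).unique (h'.subst.of_append hu')

lemma c3 : r.C3 := by
  rintro σ π ⟨k₁, s₁, q₁⟩ ⟨k₂, s₂, q₂⟩ ⟨x, d, -, h, ⟨p, s, hp, h'⟩⟩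
    ⟨x', d', -, h₂, ⟨p', s', hp', h₂'⟩⟩ hk₁ hk₂
  obtain ⟨rfl, rfl⟩ := h.unique h₂
  obtain rfl : k₁ = none := hk₁
  obtain rfl : k₂ = none := hk₂
  obtain rfl : q₁ = p ++ d := hp
  obtain rfl : q₂ = p' ++ d := hp'
  obtain ⟨rfl, rfl⟩ := H.concl_unique h' h₂'
  rfl

lemma c4 : r.C4 := by
  rintro σ ⟨k, s₀, q⟩ ⟨k', s₀', q'⟩ s s' u u' ⟨x, d, -, ⟨p, s₁, hp, h⟩, ⟨p', s₁', hp', h'⟩⟩ - -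
    hu hu'
  obtain rfl : q = p ++ d := hp
  obtain rfl : q' = p' ++ d := hp'
  obtain rfl := H.sign_unique h h'
  exact (h.subst.of_append hu).sign_unique (h'.subst.of_append hu')

omit H in
lemma c5 : r.C5 := by
  intro σ π s A _ h hc
  obtain ⟨p, d, x, s₁, hp, hx, hA⟩ := h.exists_inside
  obtain ⟨s₂, hA⟩ := hA.change_sign .pos
  exact (hc ⟨x, d, ⟨_, _, hA⟩, ⟨p, s₁, hp, hx⟩, ⟨p, s₁, hp, hx⟩⟩).elim

omit H in
/-- The positions congruent to the position `d` inside the structure assigned to `x` are the copies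
of `d` in all the occurrences of `x`, so the replacement amounts to changing the value of `x`. -/
lemma closedUnderSubst (s : Sgn) : r.ClosedUnderSubst s := by
  rintro σ π A z - ⟨x, d, hd, hπ, -⟩
  refine ⟨Function.update σ x (Tm.replace z (fun p => p = d) (σ x)), ?_⟩
  have hc : ∀ π', r.Congr σ π π' ↔ r.Inside x d π' := by
    intro π'
    constructor
    · rintro ⟨x', d', -, h, h'⟩
      obtain ⟨rfl, rfl⟩ := hπ.unique h
      exact h'
    · exact fun h => ⟨x, d, hd, hπ, h⟩
  have key : ∀ k q, r.seqAt k = some q →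
      q.subst (Function.update σ x (Tm.replace z (fun p => p = d) (σ x))) =
        (q.subst σ).replace z fun s p => r.Congr σ π ⟨k, s, p⟩ := by
    intro k q hq
    have h : ∀ s₀ p', r.Congr σ π ⟨k, s₀, p'⟩ ↔
        ∃ p, p' = p ++ d ∧ ∃ s', (q.side s₀).SubAt s₀ p s' (.var x) := by
      intro s₀ p'
      rw [hc]
      constructor
      · rintro ⟨p, s', hp, q', hq', h⟩
        obtain rfl := Option.some.inj (hq.symm.trans hq')
        exact ⟨p, hp, s', h⟩
      · rintro ⟨p, hp, s', h⟩
        exact ⟨p, s', hp, q, hq, h⟩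
    simp only [Seqt.subst, Seqt.replace]
    rw [Tm.replace_subst .pos q.ant (h .pos), Tm.replace_subst .neg q.suc (h .neg)]
  simp only [inst, replace]
  congr 1
  · refine List.ext_getElem (by simp) fun k h₁ h₂ => ?_
    simp only [List.getElem_map, List.getElem_mapIdx]
    refine key (some k) _ ?_
    simp only [List.length_map] at h₁
    simp [seqAt, h₁]
  · exact key none _ rfl

/-- The structural analyticity conditions hold for a rule whose conclusion is linear: since the
parameters are exactly the parts of the structures assigned to the variables, each condition
reduces to a statement about the occurrences of a single variable. -/
lemma analytic : r.Analytic :=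
  ⟨H.c1, c2, H.c3, H.c4, c5, closedUnderSubst .neg, closedUnderSubst .pos⟩

end Linear

end Rule

/-! ### Normal forms: distributing operators over joins -/

section Normalization

variable {L : Lang.{u}}

/-- The nodes that are read as operators at the sign `s`: for `pos`, they preserve joins in every
coordinate (up to its order-type), and for `neg` they preserve meets. These are the connectives
that are available to structures in precedent, resp. succedent position. -/
def OperatorNode : Sgn → Conn L → Prop
  | .pos, .top => True
  | .pos, .meet => True
  | .pos, .F _ => True
  | .neg, .bot => True
  | .neg, .join => True
  | .neg, .G _ => True
  | _, _ => False

/-- The nodes over which operators distribute: finite joins for `pos`, finite meets for `neg`. -/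
def JoinNode : Sgn → Conn L → Prop
  | .pos, .bot => True
  | .pos, .join => True
  | .neg, .top => True
  | .neg, .meet => True
  | _, _ => False

/-- Signed trees that consist of operator and join nodes above subtrees that satisfy `P`. For the
root sign `s`, these are the trees with Skeleton nodes above subtrees in `P`; for the opposite
root sign, the ones with PIA nodes. -/
inductive SkeletonOver (P : Sgn → Term L → Prop) : Sgn → Term L → Prop where
  | leaf {s : Sgn} {t : Term L} : P s t → SkeletonOver P s t
  | node {s : Sgn} {c : Conn L} {a : Fin c.ar → Term L} : OperatorNode s c ∨ JoinNode s c →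
      (∀ i, SkeletonOver P (s.mul (c.eps i)) (a i)) → SkeletonOver P s (.node c a)

/-- `Disjunct P s t u`: the tree `u` is obtained from the tree `t` over `P` by choosing an immediate
subtree at each join node. It is one of the components of the normal form of `t`. -/
inductive Disjunct (P : Sgn → Term L → Prop) : Sgn → Term L → Term L → Prop where
  | leaf {s : Sgn} {t : Term L} : P s t → Disjunct P s t t
  | operator {s : Sgn} {c : Conn L} {a b : Fin c.ar → Term L} : OperatorNode s c →
      (∀ i, Disjunct P (s.mul (c.eps i)) (a i) (b i)) → Disjunct P s (.node c a) (.node c b)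
  | choice {s : Sgn} {c : Conn L} {a : Fin c.ar → Term L} {u : Term L} (i : Fin c.ar) :
      JoinNode s c → Disjunct P (s.mul (c.eps i)) (a i) u → Disjunct P s (.node c a) u

/-- Finite joins (for `pos`), resp. meets (for `neg`) of terms that satisfy `Φ`. -/
inductive JoinTree (Φ : Term L → Prop) (s : Sgn) : Term L → Prop where
  | leaf {t : Term L} : Φ t → JoinTree Φ s t
  | bot : JoinTree Φ s (Term.botOf s)
  | join {t t' : Term L} : JoinTree Φ s t → JoinTree Φ s t' → JoinTree Φ s (Term.joinOf s t t')

/-- The distribution rules transform `t` into a finite join, resp. meet, of terms that satisfy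
`Φ`. -/
def Normalizes (Φ : Term L → Prop) (s : Sgn) (t : Term L) : Prop :=
  ∃ t', Relation.ReflTransGen Rewrite t t' ∧ JoinTree Φ s t'

lemma Rewrite.star_inside (c : Conn L) (a : Fin c.ar → Term L) (i : Fin c.ar) {t t' : Term L}
    (h : Relation.ReflTransGen Rewrite t t') :
    Relation.ReflTransGen Rewrite (.node c (Function.update a i t) : Term L)
      (.node c (Function.update a i t')) := by
  induction h with
  | refl => exact .refl
  | @tail t₁ t₂ _ h ih =>
    refine ih.tail ?_
    have := Rewrite.inside c (Function.update a i t₁) i t₂ (by simpa using h)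
    rwa [Function.update_idem] at this

lemma Rewrite.star_node (c : Conn L) {a b : Fin c.ar → Term L}
    (h : ∀ i, Relation.ReflTransGen Rewrite (a i) (b i)) :
    Relation.ReflTransGen Rewrite (.node c a : Term L) (.node c b) := by
  refine update_induction a b (Q := fun d => Relation.ReflTransGen Rewrite
    (.node c a : Term L) (.node c d)) .refl fun i d hd hi => hd.trans ?_
  have := Rewrite.star_inside c d i (h i)
  rwa [← hi, Function.update_eq_self] at this

lemma Rewrite.star_joinOf (s : Sgn) {x x' y y' : Term L} (hx : Relation.ReflTransGen Rewrite x x')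
    (hy : Relation.ReflTransGen Rewrite y y') :
    Relation.ReflTransGen Rewrite (Term.joinOf s x y) (Term.joinOf s x' y') := by
  have h : ∀ i : Fin 2, Relation.ReflTransGen Rewrite (![x, y] i) (![x', y'] i) := by
    intro i
    match i with
    | 0 => exact hx
    | 1 => exact hy
  cases s
  · exact Rewrite.star_node .join h
  · exact Rewrite.star_node .meet h

lemma Term.node_join (a : Fin 2 → Term L) :
    (.node Conn.join a : Term L) = Term.join (a 0) (a 1) := by
  rw [Term.join]; congr 1; funext i; match i with | 0 => rfl | 1 => rfl

lemma Term.node_meet (a : Fin 2 → Term L) :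
    (.node Conn.meet a : Term L) = Term.meet (a 0) (a 1) := by
  rw [Term.meet]; congr 1; funext i; match i with | 0 => rfl | 1 => rfl

lemma Term.node_top (a : Fin 0 → Term L) : (.node Conn.top a : Term L) = Term.top := by
  rw [Term.top]; congr 1; exact Subsingleton.elim _ _

lemma Term.node_bot (a : Fin 0 → Term L) : (.node Conn.bot a : Term L) = Term.bot := by
  rw [Term.bot]; congr 1; exact Subsingleton.elim _ _

lemma JoinNode.mul_eps {s : Sgn} {c : Conn L} (h : JoinNode s c) (i : Fin c.ar) :
    s.mul (c.eps i) = s := by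
  cases s <;> cases c <;> first | exact h.elim | rfl

/-- A join node is either a binary join or the bottom, for its sign. -/
lemma JoinNode.eq_joinOf_or_botOf {s : Sgn} {c : Conn L} (h : JoinNode s c)
    (a : Fin c.ar → Term L) :
    (∃ i j, (.node c a : Term L) = Term.joinOf s (a i) (a j)) ∨
      (.node c a : Term L) = Term.botOf s := by
  cases s <;> cases c <;> first | exact h.elim | skip
  · exact .inr (Term.node_bot a)
  · exact .inl ⟨(0 : Fin 2), (1 : Fin 2), Term.node_join a⟩
  · exact .inr (Term.node_top a)
  · exact .inl ⟨(0 : Fin 2), (1 : Fin 2), Term.node_meet a⟩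

lemma OperatorNode.rewrite_joinOf {s : Sgn} {c : Conn L} (h : OperatorNode s c)
    (a : Fin c.ar → Term L) (i : Fin c.ar) (x y : Term L) :
    Rewrite (.node c (Function.update a i (Term.joinOf (s.mul (c.eps i)) x y)))
      (Term.joinOf s (.node c (Function.update a i x)) (.node c (Function.update a i y))) := by
  cases s <;> cases c <;> first | exact h.elim | exact i.elim0 | skip
  · exact .distF .meet a i x y trivial
  · exact .distF (.F _) a i x y trivial
  · exact .distG .join a i x y trivial
  · exact .distG (.G _) a i x y trivial

lemma OperatorNode.rewrite_botOf {s : Sgn} {c : Conn L} (h : OperatorNode s c)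
    (a : Fin c.ar → Term L) (i : Fin c.ar) :
    Rewrite (.node c (Function.update a i (Term.botOf (s.mul (c.eps i))))) (Term.botOf s) := by
  cases s <;> cases c <;> first | exact h.elim | exact i.elim0 | skip
  · exact .constF .meet a i trivial
  · exact .constF (.F _) a i trivial
  · exact .constG .join a i trivial
  · exact .constG (.G _) a i trivial

lemma JoinTree.mono {Φ Ψ : Term L → Prop} (h : ∀ t, Φ t → Ψ t) {s : Sgn} {t : Term L}
    (ht : JoinTree Φ s t) : JoinTree Ψ s t := by
  induction ht with
  | leaf h' => exact .leaf (h _ h')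
  | bot => exact .bot
  | join _ _ ih ih' => exact .join ih ih'

namespace Normalizes

variable {Φ Ψ : Term L → Prop} {s : Sgn} {t t' : Term L}

lemma mono (h : ∀ t, Φ t → Ψ t) (ht : Normalizes Φ s t) : Normalizes Ψ s t :=
  let ⟨t', h₁, h₂⟩ := ht
  ⟨t', h₁, h₂.mono h⟩

lemma leaf (h : Φ t) : Normalizes Φ s t := ⟨t, .refl, .leaf h⟩

lemma bot : Normalizes Φ s (Term.botOf s) := ⟨_, .refl, .bot⟩

lemma join (h : Normalizes Φ s t) (h' : Normalizes Φ s t') :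
    Normalizes Φ s (Term.joinOf s t t') := by
  obtain ⟨u, h₁, h₂⟩ := h
  obtain ⟨u', h₁', h₂'⟩ := h'
  exact ⟨_, Rewrite.star_joinOf s h₁ h₁', .join h₂ h₂'⟩

lemma of_rewrite (h : Relation.ReflTransGen Rewrite t t') (h' : Normalizes Φ s t') :
    Normalizes Φ s t :=
  let ⟨u, h₁, h₂⟩ := h'
  ⟨u, h.trans h₁, h₂⟩

lemma bind (h : Normalizes Φ s t) (h' : ∀ u, Φ u → Normalizes Ψ s u) : Normalizes Ψ s t := by
  obtain ⟨u, h₁, h₂⟩ := h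
  refine of_rewrite h₁ ?_
  clear h₁
  induction h₂ with
  | leaf h => exact h' _ h
  | bot => exact bot
  | join _ _ ih ih' => exact ih.join ih'

/-- An operator distributes over a join tree in one coordinate. -/
lemma update {c : Conn L} (hc : OperatorNode s c) (a : Fin c.ar → Term L) (i : Fin c.ar)
    (h : JoinTree Φ (s.mul (c.eps i)) t) :
    Normalizes (fun u => ∃ d, Φ d ∧ u = .node c (Function.update a i d)) s
      (.node c (Function.update a i t)) := by
  induction h with
  | leaf h => exact leaf ⟨_, h, rfl⟩
  | bot => exact of_rewrite (.single (hc.rewrite_botOf a i)) bot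
  | join _ _ ih ih' => exact of_rewrite (.single (hc.rewrite_joinOf a i _ _)) (ih.join ih')

/-- An operator distributes over join trees in all coordinates. -/
lemma node {c : Conn L} (hc : OperatorNode s c) {Φ : Fin c.ar → Term L → Prop}
    {a : Fin c.ar → Term L} (h : ∀ i, JoinTree (Φ i) (s.mul (c.eps i)) (a i)) :
    Normalizes (fun u => ∃ d : Fin c.ar → Term L, (∀ i, Φ i (d i)) ∧ u = .node c d) s
      (.node c a) := by
  have key : ∀ (js : List (Fin c.ar)) (a : Fin c.ar → Term L), js.Nodup →
      (∀ i ∈ js, JoinTree (Φ i) (s.mul (c.eps i)) (a i)) → (∀ i ∉ js, Φ i (a i)) →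
      Normalizes (fun u => ∃ d : Fin c.ar → Term L, (∀ i, Φ i (d i)) ∧ u = .node c d) s
        (.node c a) := by
    intro js
    induction js with
    | nil => exact fun a _ _ h => leaf ⟨a, fun i => h i List.not_mem_nil, rfl⟩
    | cons j js ih =>
      intro a hn h₁ h₂
      have hj := update hc a j (h₁ j List.mem_cons_self)
      rw [Function.update_eq_self] at hj
      refine hj.bind ?_
      rintro _ ⟨d, hd, rfl⟩
      refine ih _ hn.of_cons (fun i hi => ?_) fun i hi => ?_
      · have hij : i ≠ j := fun h => (List.nodup_cons.1 hn).1 (h ▸ hi)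
        rw [Function.update_of_ne hij]
        exact h₁ i (List.mem_cons_of_mem _ hi)
      · by_cases hij : i = j
        · subst hij
          simpa using hd
        · rw [Function.update_of_ne hij]
          exact h₂ i (by simp [hij, hi])
  exact key (List.finRange c.ar) a (List.nodup_finRange _) (fun i _ => h i)
    fun i hi => absurd (List.mem_finRange i) hi

end Normalizes

/-- The normal form of a tree over `P` is the join of its disjuncts. -/
lemma SkeletonOver.normalizes {P : Sgn → Term L → Prop} {s : Sgn} {t : Term L}
    (h : SkeletonOver P s t) : Normalizes (Disjunct P s t) s t := by
  induction h with
  | leaf h => exact .leaf (.leaf h)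
  | @node s c a hc _ ih =>
    rcases hc with hc | hc
    · choose b hb hb' using ih
      refine (Normalizes.of_rewrite (Rewrite.star_node c hb) (Normalizes.node hc hb')).mono ?_
      rintro _ ⟨d, hd, rfl⟩
      exact .operator hc hd
    · rcases hc.eq_joinOf_or_botOf a with ⟨i, j, h⟩ | h
      · have h₁ := (ih i).mono fun u hu => Disjunct.choice i hc hu
        have h₂ := (ih j).mono fun u hu => Disjunct.choice j hc hu
        rw [hc.mul_eps] at h₁
        rw [hc.mul_eps] at h₂
        have := h₁.join h₂
        rwa [← h] at this
      · have := Normalizes.bot (Φ := Disjunct P s (.node c a)) (s := s)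
        rwa [← h] at this

/-- Trees of operator nodes over `P`. -/
inductive OperatorOver (P : Sgn → Term L → Prop) : Sgn → Term L → Prop where
  | leaf {s : Sgn} {t : Term L} : P s t → OperatorOver P s t
  | node {s : Sgn} {c : Conn L} {a : Fin c.ar → Term L} : OperatorNode s c →
      (∀ i, OperatorOver P (s.mul (c.eps i)) (a i)) → OperatorOver P s (.node c a)

lemma Disjunct.operatorOver {P : Sgn → Term L → Prop} {s : Sgn} {t u : Term L}
    (h : Disjunct P s t u) : OperatorOver P s u := by
  induction h with
  | leaf h => exact .leaf h
  | operator hc _ ih => exact .node hc ih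
  | choice _ hc _ ih => rwa [hc.mul_eps] at ih

lemma OperatorOver.skeletonOver {P : Sgn → Term L → Prop} {s : Sgn} {u : Term L}
    (h : OperatorOver P s u) : SkeletonOver P s u := by
  induction h with
  | leaf h => exact .leaf h
  | node hc _ ih => exact .node (.inl hc) ih

lemma Disjunct.leaves_subset {P : Sgn → Term L → Prop} {s s' : Sgn} {t u : Term L} {x : ℕ}
    (h : Disjunct P s t u) (hx : (s', x) ∈ u.leaves s) : (s', x) ∈ t.leaves s := by
  induction h with
  | leaf h => exact hx
  | operator hc _ ih =>
    obtain ⟨i, hi⟩ := Tm.mem_leaves_node.1 hx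
    exact Tm.mem_leaves_node.2 ⟨i, ih i hi⟩
  | choice i hc _ ih => exact Tm.mem_leaves_node.2 ⟨i, ih (by rwa [hc.mul_eps])⟩

lemma SkeletonOver.joinOf {P : Sgn → Term L → Prop} {s s' : Sgn} {x y : Term L}
    (hx : SkeletonOver P s x) (hy : SkeletonOver P s y) :
    SkeletonOver P s (Term.joinOf s' x y) := by
  have h : ∀ i : Fin 2, SkeletonOver P s (![x, y] i) := by
    intro i
    match i with
    | 0 => exact hx
    | 1 => exact hy
  cases s'
  · refine .node (c := .join) (by cases s <;> simp [OperatorNode, JoinNode]) fun i => ?_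
    simpa using h i
  · refine .node (c := .meet) (by cases s <;> simp [OperatorNode, JoinNode]) fun i => ?_
    simpa using h i

lemma SkeletonOver.botOf {P : Sgn → Term L → Prop} {s s' : Sgn} :
    SkeletonOver P s (Term.botOf s') := by
  cases s'
  · exact .node (c := .bot) (by cases s <;> simp [OperatorNode, JoinNode]) fun i => i.elim0
  · exact .node (c := .top) (by cases s <;> simp [OperatorNode, JoinNode]) fun i => i.elim0

lemma JoinTree.skeletonOver {P : Sgn → Term L → Prop} {Φ : Term L → Prop} {s s' : Sgn}
    {t : Term L} (h : JoinTree Φ s' t) (hP : ∀ u, Φ u → SkeletonOver P s u) :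
    SkeletonOver P s t := by
  induction h with
  | leaf h => exact hP _ h
  | bot => exact .botOf
  | join _ _ ih ih' => exact ih.joinOf ih'

end Normalization

/-! ### Operator trees as structures -/

section Structures

variable {L : Lang.{u}}

/-- Each operator node of the expanded language is the reading of a structural connective. -/
lemma OperatorNode.exists_structure {s : Sgn} {c : Conn L.star} (h : OperatorNode s c) :
    ∃ mk : (Fin c.ar → Str L ℕ) → Str L ℕ, ∀ a,
      Str.toTerm s (mk a) = .node c (fun i => Str.toTerm (s.mul (c.eps i)) (a i)) ∧
      ((∀ i, Str.Sided (s.mul (c.eps i)) (a i)) → Str.Sided s (mk a)) ∧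
      (mk a).leaves s =
        (List.finRange c.ar).flatMap fun i => (a i).leaves (s.mul (c.eps i)) := by
  cases s <;> cases c <;> first | exact h.elim | skip
  · exact ⟨fun a => .node SConn.I a, fun a => ⟨(Term.node_top _).symm, fun h => ⟨trivial, h⟩, rfl⟩⟩
  · exact ⟨fun a => .node SConn.semi a,
      fun a => ⟨(Term.node_meet fun i => Str.toTerm .pos (a i)).symm, fun h => ⟨trivial, h⟩, rfl⟩⟩
  · rename_i f
    cases f with
    | base f => exact ⟨fun a => .node (SConn.H f) a, fun a => ⟨rfl, fun h => ⟨rfl, h⟩, rfl⟩⟩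
    | subR =>
      refine ⟨fun a => .node SConn.gt a, fun a => ⟨?_, fun h => ⟨trivial, h⟩, rfl⟩⟩
      rw [Str.toTerm]; congr 1; funext i; match i with | 0 => rfl | 1 => rfl
    | subL =>
      refine ⟨fun a => .node SConn.lt a, fun a => ⟨?_, fun h => ⟨trivial, h⟩, rfl⟩⟩
      rw [Str.toTerm]; congr 1; funext i; match i with | 0 => rfl | 1 => rfl
    | sharp f i hi =>
      exact ⟨fun a => .node (SConn.Hres f i) a,
        fun a => ⟨by rw [Str.toTerm, dif_pos hi]; rfl,
          fun h => ⟨by simp [SConn.HasSide, hi], h⟩, rfl⟩⟩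
    | flat g i hi =>
      exact ⟨fun a => .node (SConn.Kres g i) a,
        fun a => ⟨by rw [Str.toTerm, dif_pos hi]; rfl, fun h => ⟨hi.symm, h⟩, rfl⟩⟩
  · exact ⟨fun a => .node SConn.I a, fun a => ⟨(Term.node_bot _).symm, fun h => ⟨trivial, h⟩, rfl⟩⟩
  · exact ⟨fun a => .node SConn.semi a,
      fun a => ⟨(Term.node_join fun i => Str.toTerm .neg (a i)).symm, fun h => ⟨trivial, h⟩, rfl⟩⟩
  · rename_i g
    cases g with
    | base g => exact ⟨fun a => .node (SConn.K g) a, fun a => ⟨rfl, fun h => ⟨rfl, h⟩, rfl⟩⟩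
    | impR =>
      refine ⟨fun a => .node SConn.gt a, fun a => ⟨?_, fun h => ⟨trivial, h⟩, rfl⟩⟩
      rw [Str.toTerm]; congr 1; funext i; match i with | 0 => rfl | 1 => rfl
    | impL =>
      refine ⟨fun a => .node SConn.lt a, fun a => ⟨?_, fun h => ⟨trivial, h⟩, rfl⟩⟩
      rw [Str.toTerm]; congr 1; funext i; match i with | 0 => rfl | 1 => rfl
    | sharp f i hi =>
      exact ⟨fun a => .node (SConn.Hres f i) a,
        fun a => ⟨by rw [Str.toTerm, dif_pos hi]; rfl,
          fun h => ⟨by simp [SConn.HasSide, hi], h⟩, rfl⟩⟩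
    | flat g i hi =>
      exact ⟨fun a => .node (SConn.Kres g i) a,
        fun a => ⟨by rw [Str.toTerm, dif_pos hi]; rfl, fun h => ⟨hi.symm, h⟩, rfl⟩⟩

/-- The term is a variable. -/
def IsVar (_ : Sgn) (t : Term L) : Prop := ∃ x, t = .var x

/-- The reading of a sided structure has the same signed leaves as the structure. -/
lemma OperatorOver.exists_structure {s : Sgn} {t : Term L.star} (h : OperatorOver IsVar s t) :
    ∃ U : Str L ℕ, U.Sided s ∧ U.toTerm s = t ∧ U.leaves s = t.leaves s := by
  induction h with
  | leaf h =>
    obtain ⟨x, rfl⟩ := h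
    exact ⟨.var x, trivial, by simp [Str.toTerm], rfl⟩
  | node hc _ ih =>
    choose U hU₁ hU₂ hU₃ using ih
    obtain ⟨mk, hmk⟩ := hc.exists_structure
    obtain ⟨h₁, h₂, h₃⟩ := hmk U
    refine ⟨mk U, h₂ hU₁, ?_, ?_⟩
    · rw [h₁]
      simp only [hU₂]
    · rw [h₃]
      simp only [hU₃]
      rfl

/-- An operator tree over `P` is a substitution instance of a structure in which no variable occurs
twice; its variables can be taken from the range of any injective `f`. The variables below the
`i`-th coordinate of a node are kept apart by means of the pairing `Nat.pair i`. -/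
lemma OperatorOver.exists_linear {P : Sgn → Term L.star → Prop} {s : Sgn} {t : Term L.star}
    (h : OperatorOver P s t) (f : ℕ → ℕ) (hf : Function.Injective f) :
    ∃ (U : Str L ℕ) (σ : ℕ → Term L.star), U.Sided s ∧ (U.toTerm s).subst σ = t ∧
      (U.toTerm s).leaves s = U.leaves s ∧ ((U.leaves s).map Prod.snd).Nodup ∧
      ∀ s' x, (s', x) ∈ U.leaves s → P s' (σ x) ∧ x ∈ Set.range f := by
  induction h generalizing f with
  | @leaf s t h =>
    refine ⟨.var (f 0), fun _ => t, trivial, by simp [Str.toTerm, Tm.subst],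
      by simp [Str.toTerm, Tm.leaves], by simp [Tm.leaves], fun s' x hx => ?_⟩
    obtain ⟨rfl, rfl⟩ := Tm.mem_leaves_var.1 hx
    exact ⟨h, 0, rfl⟩
  | @node s c a hc _ ih =>
    have hinj : ∀ i : ℕ, Function.Injective fun z => f (Nat.pair i z) := fun i z z' h =>
      (Nat.pair_eq_pair.1 (hf h)).2
    choose U σ hU₁ hU₂ hU₃ hU₄ hU₅ using fun i : Fin c.ar => ih i _ (hinj i.val)
    obtain ⟨mk, hmk⟩ := hc.exists_structure
    obtain ⟨h₁, h₂, h₃⟩ := hmk U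
    let τ : ℕ → Term L.star := fun y =>
      if h : (Nat.unpair (Function.invFun f y)).1 < c.ar then σ ⟨_, h⟩ y else .var y
    have hτ : ∀ i s' x, (s', x) ∈ (U i).leaves (s.mul (c.eps i)) → τ x = σ i x := by
      intro i s' x hx
      obtain ⟨z, rfl⟩ := (hU₅ i s' x hx).2
      simp [τ, Function.leftInverse_invFun hf _, Nat.unpair_pair]
    refine ⟨mk U, τ, h₂ hU₁, ?_, ?_, ?_, ?_⟩
    · rw [h₁, Tm.subst]
      congr 1
      funext i
      rw [← hU₂ i]
      refine Tm.subst_congr (s.mul (c.eps i)) fun s' x hx => hτ i s' x ?_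
      rwa [hU₃ i] at hx
    · rw [h₁, h₃, Tm.leaves]
      simp only [hU₃]
    · rw [h₃, List.map_flatMap, List.nodup_flatMap]
      refine ⟨fun i _ => hU₄ i, (List.nodup_finRange _).imp fun {i j} hij => ?_⟩
      rw [Function.onFun, List.disjoint_left]
      intro x hx hx'
      obtain ⟨⟨s₁, _⟩, h, rfl⟩ := List.mem_map.1 hx
      obtain ⟨⟨s₂, _⟩, h', rfl⟩ := List.mem_map.1 hx'
      obtain ⟨z, hz⟩ := (hU₅ i _ _ h).2
      obtain ⟨z', hz'⟩ := (hU₅ j _ _ h').2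
      exact hij (Fin.ext (Nat.pair_eq_pair.1 (hf (hz.trans hz'.symm))).1)
    · intro s' x hx
      rw [h₃, List.mem_flatMap] at hx
      obtain ⟨i, -, hi⟩ := hx
      rw [hτ i s' x hi]
      obtain ⟨h, z, rfl⟩ := hU₅ i s' x hi
      exact ⟨h, _, rfl⟩

end Structures

/-! ### Analytic inductive trees in the expanded language -/

section Inductive

variable {L : Lang.{u}}

/-- The connectives of the original language, in the expanded one. -/
def BaseNode : Conn L.star → Prop
  | .F (.base _) => True
  | .G (.base _) => True
  | .F _ => False
  | .G _ => False
  | _ => True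

/-- A node of a term and the node of its embedding have the same classification. -/
lemma Term.exists_emb_node (c : Conn L) (a : Fin c.ar → Term L) :
    ∃ (c' : Conn L.star) (e : Fin c'.ar ≃ Fin c.ar),
      Term.emb (.node c a) = .node c' (fun i => Term.emb (a (e i))) ∧
      (∀ i, c'.eps i = c.eps (e i)) ∧ BaseNode c' ∧
      (∀ s, IsPIA s c → OperatorNode s.flip c' ∨ JoinNode s.flip c') ∧
      (∀ s, IsSkeleton s c → OperatorNode s c' ∨ JoinNode s c') ∧
      ∀ s, OperatorNode s.flip c' → 2 ≤ c.ar → IsSRR s c := by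
  cases c with
  | top =>
    refine ⟨.top, Equiv.refl _, (Term.node_top _).symm, fun _ => rfl, trivial, ?_, ?_, ?_⟩ <;>
      rintro (_ | _) <;> simp [OperatorNode, JoinNode, Sgn.flip]
  | bot =>
    refine ⟨.bot, Equiv.refl _, (Term.node_bot _).symm, fun _ => rfl, trivial, ?_, ?_, ?_⟩ <;>
      rintro (_ | _) <;> simp [OperatorNode, JoinNode, Sgn.flip]
  | meet =>
    refine ⟨.meet, Equiv.refl _, (Term.node_meet fun i => Term.emb (a i)).symm, fun _ => rfl,
      trivial, ?_, ?_, ?_⟩ <;>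
      rintro (_ | _) <;> simp [OperatorNode, JoinNode, Sgn.flip, IsSRR]
  | join =>
    refine ⟨.join, Equiv.refl _, (Term.node_join fun i => Term.emb (a i)).symm, fun _ => rfl,
      trivial, ?_, ?_, ?_⟩ <;>
      rintro (_ | _) <;> simp [OperatorNode, JoinNode, Sgn.flip, IsSRR]
  | F f =>
    refine ⟨.F (.base f), Equiv.refl _, rfl, fun _ => rfl, trivial, ?_, ?_, ?_⟩ <;>
      rintro (_ | _) <;> simp [OperatorNode, JoinNode, Sgn.flip, IsSRR, IsPIA, IsSkeleton]
  | G g =>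
    refine ⟨.G (.base g), Equiv.refl _, rfl, fun _ => rfl, trivial, ?_, ?_, ?_⟩ <;>
      rintro (_ | _) <;> simp [OperatorNode, JoinNode, Sgn.flip, IsSRR, IsPIA, IsSkeleton]

lemma Term.mem_leaves_emb {t : Term L} {s s' : Sgn} {x : ℕ} :
    (s', x) ∈ t.emb.leaves s ↔ (s', x) ∈ t.leaves s := by
  induction t generalizing s with
  | var y => simp [Term.emb, Tm.leaves]
  | node c a ih =>
    obtain ⟨c', e, h, he, -⟩ := Term.exists_emb_node c a
    rw [h, Tm.mem_leaves_node, Tm.mem_leaves_node]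
    refine e.exists_congr fun i => ?_
    have : L.star.conn.eps c' i = L.conn.eps c (e i) := he i
    rw [this]
    exact ih (e i)

lemma Tm.exists_isBranch_node (s : Sgn) (t : Term L) : ∀ (c : Conn L) (a : Fin c.ar → Term L),
    t = .node c a → ∃ nx ns l, t.IsBranch s (⟨s, c, a, nx⟩ :: ns) l := by
  induction t generalizing s with
  | var y => simp
  | node c a ih =>
    rintro _ _ ⟨⟩
    by_cases h : c.ar = 0
    · exact ⟨none, [], none, .const s c a h⟩
    · let i : Fin c.ar := ⟨0, Nat.pos_of_ne_zero h⟩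
      have : ∃ ns l, (a i).IsBranch (s.mul (c.eps i)) ns l := by
        rcases hi : a i with x | ⟨c', a'⟩
        · exact ⟨_, _, .var _ _⟩
        · obtain ⟨nx, ns, l, h⟩ := ih i (s.mul (c.eps i)) c' a' hi
          rw [hi] at h
          exact ⟨_, _, h⟩
      obtain ⟨ns, l, h⟩ := this
      exact ⟨some i, ns, l, .step s c a i ns l h⟩

lemma Tm.exists_isBranch_of_mem_leaves {s s' : Sgn} {t : Term L} {x : ℕ}
    (h : (s', x) ∈ t.leaves s) : ∃ ns, t.IsBranch s ns (some (s', x)) := by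
  induction t generalizing s with
  | var y =>
    obtain ⟨rfl, rfl⟩ := Tm.mem_leaves_var.1 h
    exact ⟨_, .var _ _⟩
  | node c a ih =>
    obtain ⟨i, hi⟩ := Tm.mem_leaves_node.1 h
    obtain ⟨ns, h⟩ := ih i hi
    exact ⟨_, .step s c a i ns _ h⟩

/-- All letters of the term are `Ω`-smaller than `p`. -/
def Below (Ω : ℕ → ℕ → Prop) (p : ℕ) (t : Term L) : Prop := ∀ x, t.Occurs x → Ω x p

lemma Below.of_subset {Ω : ℕ → ℕ → Prop} {p : ℕ} {t u : Term L} (s : Sgn) (h : Below Ω p t)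
    (hu : ∀ l ∈ u.leaves s, l ∈ t.leaves s) : Below Ω p u := by
  intro x hx
  obtain ⟨s', hs'⟩ := (Term.occurs_iff s).1 hx
  exact h x ((Term.occurs_iff s).2 ⟨s', hu _ hs'⟩)

/-- Signed trees that consist of PIA nodes, with the side condition at the operator nodes above
critical leaves. -/
inductive PIATree (Ω : ℕ → ℕ → Prop) (ε : ℕ → Sgn) : Sgn → Term L.star → Prop where
  | var (s : Sgn) (x : ℕ) : PIATree Ω ε s (.var x)
  | node {s : Sgn} {c : Conn L.star} {a : Fin c.ar → Term L.star} : BaseNode c →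
      OperatorNode s.flip c ∨ JoinNode s.flip c →
      (OperatorNode s.flip c → ∀ i p, (ε p, p) ∈ (a i).leaves (s.mul (c.eps i)) → ∀ h, h ≠ i →
        OppUniform ε (s.mul (c.eps h)) (a h) ∧ Below Ω p (a h)) →
      (∀ i, PIATree Ω ε (s.mul (c.eps i)) (a i)) → PIATree Ω ε s (.node c a)

/-- The trees all of whose branches are PIA paths that satisfy the side condition. -/
lemma PIATree.of_branches {Ω : ℕ → ℕ → Prop} {ε : ℕ → Sgn} {s : Sgn} {t : Term L}
    (h₁ : ∀ ns l, t.IsBranch s ns l → ∀ n ∈ ns, IsPIA n.sgn n.op)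
    (h₂ : ∀ ns p, t.IsBranch s ns (some (ε p, p)) → ∀ n ∈ ns, SRRCondition Ω ε p n) :
    PIATree Ω ε s t.emb := by
  induction t generalizing s with
  | var x => exact .var s x
  | node c a ih =>
    obtain ⟨c', e, h, he, hb, hP, -, hS⟩ := Term.exists_emb_node c a
    obtain ⟨nx, ns, l, hbr⟩ := Tm.exists_isBranch_node s (.node c a) c a rfl
    rw [h]
    refine .node hb (hP s (h₁ _ _ hbr _ List.mem_cons_self)) ?_ fun i => ?_
    · intro hc i p hp k hk
      rw [he, Term.mem_leaves_emb] at hp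
      obtain ⟨ns, hns⟩ := Tm.exists_isBranch_of_mem_leaves hp
      have hk' : e k ≠ e i := fun h => hk (e.injective h)
      have h2 : 2 ≤ c.ar := by
        have := (e k).isLt
        have := (e i).isLt
        have : (e k).val ≠ (e i).val := fun h => hk' (Fin.ext h)
        omega
      obtain ⟨h₃, h₄⟩ := h₂ _ p (.step s c a (e i) ns _ hns) _ List.mem_cons_self (hS s hc h2) (e i)
        rfl (e k) hk'
      constructor
      · intro s' x hx
        rw [he, Term.mem_leaves_emb] at hx
        exact h₃ s' x hx
      · intro x hx
        obtain ⟨s', hx⟩ := (Term.occurs_iff .pos).1 hx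
        exact h₄ s' x (Term.mem_leaves_emb.1 hx)
    · rw [he]
      exact ih (e i)
        (fun ns l h n hn => h₁ _ _ (.step s c a (e i) ns l h) n (List.mem_cons_of_mem _ hn))
        fun ns p h n hn => h₂ _ p (.step s c a (e i) ns _ h) n (List.mem_cons_of_mem _ hn)

lemma PIATree.skeletonOver {Ω : ℕ → ℕ → Prop} {ε : ℕ → Sgn} {s : Sgn} {t : Term L.star}
    (h : PIATree Ω ε s t) : SkeletonOver IsVar s.flip t := by
  induction h with
  | var s x => exact .leaf ⟨x, rfl⟩
  | node _ hc _ _ ih => exact .node hc fun i => by rw [Sgn.flip_mul]; exact ih i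

/-- An analytic inductive tree is a Skeleton above PIA subtrees: each branch is followed as long as
its nodes are Skeleton nodes, so that the PIA part of the branch is as short as possible. -/
lemma AnalyticTree.skeletonOver {Ω : ℕ → ℕ → Prop} {ε : ℕ → Sgn} {s : Sgn} {t : Term L}
    (h : AnalyticTree Ω ε s t) : SkeletonOver (PIATree Ω ε) s t.emb := by
  induction t generalizing s with
  | var x => exact .leaf (.var s x)
  | node c a ih =>
    by_cases hs : IsSkeleton s c
    · obtain ⟨c', e, h', he, -, -, hc, -⟩ := Term.exists_emb_node c a
      rw [h']
      refine .node (hc s hs) fun i => ?_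
      rw [he]
      refine ih (e i) ⟨fun ns p hns => ?_, fun ns l hns => ?_⟩
      · obtain ⟨P₂, P₁, ⟨hsplit, h₂, h₁⟩, h₃⟩ := h.1 _ p (.step s c a (e i) ns _ hns)
        rcases List.cons_eq_append_iff.1 hsplit with ⟨-, rfl⟩ | ⟨P₂, rfl, rfl⟩
        · exact ⟨[], ns, ⟨rfl, by simp, fun n hn => h₁ n (List.mem_cons_of_mem _ hn)⟩,
            fun n hn => h₃ n (List.mem_cons_of_mem _ hn)⟩
        · exact ⟨P₂, P₁, ⟨rfl, fun n hn => h₂ n (List.mem_cons_of_mem _ hn), h₁⟩, h₃⟩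
      · obtain ⟨P₂, P₁, hsplit, h₂, h₁⟩ := h.2 _ l (.step s c a (e i) ns _ hns)
        rcases List.cons_eq_append_iff.1 hsplit with ⟨-, rfl⟩ | ⟨P₂, rfl, rfl⟩
        · exact ⟨[], ns, ⟨rfl, by simp, fun n hn => h₁ n (List.mem_cons_of_mem _ hn)⟩⟩
        · exact ⟨P₂, P₁, ⟨rfl, fun n hn => h₂ n (List.mem_cons_of_mem _ hn), h₁⟩⟩
    · -- The root is not a Skeleton node, so the Skeleton part of every branch is empty.
      have key : ∀ ns l P₂ P₁, (Tm.node c a : Term L).IsBranch s ns l → GoodSplit ns P₂ P₁ →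
          P₁ = ns := by
        rintro ns l P₂ P₁ hns ⟨hsplit, h₂, -⟩
        cases P₂ with
        | nil => exact hsplit.symm
        | cons n P₂ =>
          have hn := h₂ n List.mem_cons_self
          cases hns <;> (rw [← (List.cons.inj hsplit).1] at hn; exact absurd hn hs)
      refine .leaf (.of_branches (fun ns l hns => ?_) fun ns p hns => ?_)
      · obtain ⟨P₂, P₁, hgood⟩ := h.2 ns l hns
        obtain rfl := key ns l P₂ P₁ hns hgood
        exact hgood.2.2
      · obtain ⟨P₂, P₁, hgood, h₃⟩ := h.1 ns p hns
        obtain rfl := key ns _ P₂ P₁ hns hgood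
        exact h₃

/-- Definite PIA trees with exactly one critical leaf, labelled `p`. -/
inductive CriticalTree (Ω : ℕ → ℕ → Prop) (ε : ℕ → Sgn) (p : ℕ) : Sgn → Term L.star → Prop where
  | var : CriticalTree Ω ε p (ε p) (.var p)
  | node {s : Sgn} {c : Conn L.star} {a : Fin c.ar → Term L.star} (i : Fin c.ar) : BaseNode c →
      OperatorNode s.flip c → CriticalTree Ω ε p (s.mul (c.eps i)) (a i) →
      (∀ h, h ≠ i → SkeletonOver IsVar (s.mul (c.eps h)).flip (a h) ∧
        OppUniform ε (s.mul (c.eps h)) (a h) ∧ Below Ω p (a h)) →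
      CriticalTree Ω ε p s (.node c a)

lemma CriticalTree.mem_leaves {Ω : ℕ → ℕ → Prop} {ε : ℕ → Sgn} {p : ℕ} {s : Sgn}
    {t : Term L.star} (h : CriticalTree Ω ε p s t) : (ε p, p) ∈ t.leaves s := by
  induction h with
  | var => simp [Tm.leaves]
  | node i _ _ _ _ ih => exact Tm.mem_leaves_node.2 ⟨i, ih⟩

/-- The components of the normal form of a PIA tree have at most one critical leaf. -/
lemma PIATree.disjunct {Ω : ℕ → ℕ → Prop} {ε : ℕ → Sgn} {s : Sgn} {t u : Term L.star}
    (h : PIATree Ω ε s t) (hu : Disjunct IsVar s.flip t u) :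
    OppUniform ε s u ∨ ∃ p, CriticalTree Ω ε p s u := by
  induction h generalizing u with
  | var s x =>
    cases hu
    by_cases hs : s = ε x
    · subst hs
      exact .inr ⟨x, .var⟩
    · refine .inl fun s' y hy => ?_
      obtain ⟨rfl, rfl⟩ := Tm.mem_leaves_var.1 hy
      exact Sgn.eq_flip_of_ne hs
  | @node s c a hb _ hside _ ih =>
    cases hu with
    | leaf h => obtain ⟨x, h⟩ := h; cases h
    | choice i hc hi =>
      have hs := hc.mul_eps i
      rw [Sgn.flip_mul] at hi hs
      have := ih i hi
      rwa [Sgn.flip_injective hs] at this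
    | @operator _ _ _ b hc hi =>
      simp only [Sgn.flip_mul] at hi
      by_cases hall : ∀ i, OppUniform ε (s.mul (c.eps i)) (b i)
      · left
        intro s' x hx
        obtain ⟨i, hx⟩ := Tm.mem_leaves_node.1 hx
        exact hall i s' x hx
      · right
        push Not at hall
        obtain ⟨i, hni⟩ := hall
        obtain ⟨p, hp⟩ := (ih i (hi i)).resolve_left hni
        have hsub : ∀ h, ∀ l ∈ (b h).leaves (s.mul (c.eps h)),
            l ∈ (a h).leaves (s.mul (c.eps h)) := by
          rintro h ⟨s', x⟩ hl
          have := (hi h).leaves_subset (s' := s'.flip) (x := x)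
          rw [Tm.mem_leaves_flip, Tm.mem_leaves_flip, Sgn.flip_flip] at this
          exact this hl
        refine ⟨p, .node i hb hc hp fun h hh => ?_⟩
        obtain ⟨h₁, h₂⟩ := hside hc i p (hsub i _ hp.mem_leaves) h hh
        exact ⟨(hi h).operatorOver.skeletonOver, fun s' x hx => h₁ s' x (hsub h _ hx),
          h₂.of_subset _ (hsub h)⟩

end Inductive

/-! ### Residuation along the critical branch -/

section Residuation

variable {L : Lang.{u}}

/-- The inequality `x ≤ u` for `pos`, `u ≤ x` for `neg`. -/
def Ineq.ofSign : Sgn → Term L → Term L → Ineq L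
  | .pos, x, u => ⟨x, u⟩
  | .neg, x, u => ⟨u, x⟩

lemma Ineq.ofSign_var (s : Sgn) (x : ℕ) (a : Term L) :
    Ineq.ofSign s (.var x) a = Ineq.bound s x a := by
  cases s <;> rfl

lemma Ineq.ofSign_var_right (s : Sgn) (x : ℕ) (a : Term L) :
    Ineq.ofSign s a (.var x) = Ineq.bound s.flip x a := by
  cases s <;> rfl

/-- Let `a` be the subtrees of a node of order-type `e` in a tree with root sign `s`. The term `w`,
at the sign `s'`, is composed of `x`, at the sign `s`, and of the subtrees other than the `i`-th
one, at the opposites of their signs. This describes the term that results from residuating an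
inequality between `x` and the node in the `i`-th coordinate. -/
structure IsResidual {n : ℕ} (s s' : Sgn) (e : Fin n → Sgn) (a : Fin n → Term L) (i : Fin n)
    (x w : Term L) : Prop where
  skeletonOver : ∀ P, SkeletonOver P s x →
    (∀ h, h ≠ i → SkeletonOver P (s.mul (e h)).flip (a h)) → SkeletonOver P s' w
  leaves : ∀ l ∈ w.leaves s', l ∈ x.leaves s ∨ ∃ h, h ≠ i ∧ l ∈ (a h).leaves (s.mul (e h)).flip

lemma IsResidual.of_node {c : Conn L} {s s' : Sgn} {e : Fin c.ar → Sgn} {a d : Fin c.ar → Term L}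
    {i : Fin c.ar} {x : Term L} (hc : OperatorNode s' c) (hi : d i = x)
    (hd : ∀ j, j ≠ i → d j = a j)
    (h₁ : s'.mul (c.eps i) = s) (h₂ : ∀ j, j ≠ i → s'.mul (c.eps j) = (s.mul (e j)).flip) :
    IsResidual s s' e a i x (.node c d) where
  skeletonOver P hx ha := by
    refine .node (.inl hc) fun j => ?_
    by_cases hj : j = i
    · subst hj
      rwa [h₁, hi]
    · rw [h₂ j hj, hd j hj]
      exact ha j hj
  leaves := by
    rintro ⟨s₁, y⟩ hl
    obtain ⟨j, hl⟩ := Tm.mem_leaves_node.1 hl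
    by_cases hj : j = i
    · subst hj
      left
      rw [hi] at hl
      exact h₁ ▸ hl
    · right
      rw [hd j hj] at hl
      exact ⟨j, hj, h₂ j hj ▸ hl⟩

lemma mul_residEps_self {n : ℕ} (s : Sgn) (e : Fin n → Sgn) (i : Fin n) :
    (s.mul (e i)).mul (residEps e i i) = s := by
  simp only [residEps]; cases e i <;> simp

lemma mul_residEps_of_ne {n : ℕ} (s : Sgn) (e : Fin n → Sgn) {i j : Fin n} (h : j ≠ i) :
    (s.mul (e i)).mul (residEps e i j) = (s.mul (e j)).flip := by
  simp only [residEps]; cases e i <;> simp [h, Sgn.mul_flip, Sgn.flip_mul]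

/-- An inequality between `x` and a definite PIA tree can be residuated into any coordinate of the
root of the tree. -/
lemma BaseNode.exists_residual {s : Sgn} {c : Conn L.star} (hb : BaseNode c)
    (hc : OperatorNode s.flip c) (a : Fin c.ar → Term L.star) (i : Fin c.ar) (x : Term L.star) :
    ∃ w, Residuate (Ineq.ofSign s x (.node c a)) (Ineq.ofSign (s.mul (c.eps i)) w (a i)) ∧
      IsResidual s (s.mul (c.eps i)) c.eps a i x w := by
  cases s <;> cases c <;> first | exact hc.elim | exact i.elim0 | skip
  · rw [Term.node_join]
    match i with
    | 0 =>
      exact ⟨_, .join_left _ _ x, IsResidual.of_node (L := L.star) (c := .F StarF.subL) (s := .pos)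
        (s' := .pos) (e := fun _ => .pos) (a := a) (d := ![x, a (1 : Fin 2)]) (i := (0 : Fin 2))
        trivial rfl (fun j hj => match j with | 0 => absurd rfl hj | 1 => rfl) rfl
        (fun j hj => match j with | 0 => absurd rfl hj | 1 => rfl)⟩
    | 1 =>
      exact ⟨_, .join_right _ _ x, IsResidual.of_node (L := L.star) (c := .F StarF.subR) (s := .pos)
        (s' := .pos) (e := fun _ => .pos) (a := a) (d := ![a (0 : Fin 2), x]) (i := (1 : Fin 2))
        trivial rfl (fun j hj => match j with | 0 => rfl | 1 => absurd rfl hj) rfl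
        (fun j hj => match j with | 0 => rfl | 1 => absurd rfl hj)⟩
  · rename_i g
    cases g <;> first | exact hb.elim | skip
    rename_i g
    cases hi : L.G.eps g i
    · have hi' : (Conn.G (L := L.star) (StarG.base g)).eps i = .pos := hi
      rw [hi']
      exact ⟨_, .G_pos g i hi a x, IsResidual.of_node (L := L.star)
        (c := .F (StarF.flat g i hi)) (s := .pos) (s' := .pos)
        (e := L.G.eps g) (a := a) (d := Function.update a i x) (i := i) (x := x) trivial
        (Function.update_self _ _ _) (fun _ hj => Function.update_of_ne hj _ _)
        (by simpa [hi] using mul_residEps_self .pos (L.G.eps g) i)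
        fun j hj => by simpa [hi] using mul_residEps_of_ne .pos (L.G.eps g) hj⟩
    · have hi' : (Conn.G (L := L.star) (StarG.base g)).eps i = .neg := hi
      rw [hi']
      exact ⟨_, .G_neg g i hi a x, IsResidual.of_node (L := L.star)
        (c := .G (StarG.flat g i hi)) (s := .pos) (s' := .neg)
        (e := L.G.eps g) (a := a) (d := Function.update a i x) (i := i) (x := x) trivial
        (Function.update_self _ _ _) (fun _ hj => Function.update_of_ne hj _ _)
        (by simpa [hi] using mul_residEps_self .pos (L.G.eps g) i)
        fun j hj => by simpa [hi] using mul_residEps_of_ne .pos (L.G.eps g) hj⟩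
  · rw [Term.node_meet]
    match i with
    | 0 =>
      exact ⟨_, .meet_left _ _ x, IsResidual.of_node (L := L.star) (c := .G StarG.impL) (s := .neg)
        (s' := .neg) (e := fun _ => .pos) (a := a) (d := ![x, a (1 : Fin 2)]) (i := (0 : Fin 2))
        trivial rfl (fun j hj => match j with | 0 => absurd rfl hj | 1 => rfl) rfl
        (fun j hj => match j with | 0 => absurd rfl hj | 1 => rfl)⟩
    | 1 =>
      exact ⟨_, .meet_right _ _ x, IsResidual.of_node (L := L.star) (c := .G StarG.impR) (s := .neg)
        (s' := .neg) (e := fun _ => .pos) (a := a) (d := ![a (0 : Fin 2), x]) (i := (1 : Fin 2))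
        trivial rfl (fun j hj => match j with | 0 => rfl | 1 => absurd rfl hj) rfl
        (fun j hj => match j with | 0 => rfl | 1 => absurd rfl hj)⟩
  · rename_i f
    cases f <;> first | exact hb.elim | skip
    rename_i f
    cases hi : L.F.eps f i
    · have hi' : (Conn.F (L := L.star) (StarF.base f)).eps i = .pos := hi
      rw [hi']
      exact ⟨_, .F_pos f i hi a x, IsResidual.of_node (L := L.star)
        (c := .G (StarG.sharp f i hi)) (s := .neg) (s' := .neg)
        (e := L.F.eps f) (a := a) (d := Function.update a i x) (i := i) (x := x) trivial
        (Function.update_self _ _ _) (fun _ hj => Function.update_of_ne hj _ _)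
        (by simpa [hi] using mul_residEps_self .neg (L.F.eps f) i)
        fun j hj => by simpa [hi] using mul_residEps_of_ne .neg (L.F.eps f) hj⟩
    · have hi' : (Conn.F (L := L.star) (StarF.base f)).eps i = .neg := hi
      rw [hi']
      exact ⟨_, .F_neg f i hi a x, IsResidual.of_node (L := L.star)
        (c := .F (StarF.sharp f i hi)) (s := .neg) (s' := .pos)
        (e := L.F.eps f) (a := a) (d := Function.update a i x) (i := i) (x := x) trivial
        (Function.update_self _ _ _) (fun _ hj => Function.update_of_ne hj _ _)
        (by simpa [hi] using mul_residEps_self .neg (L.F.eps f) i)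
        fun j hj => by simpa [hi] using mul_residEps_of_ne .neg (L.F.eps f) hj⟩

/-- Residuation displays the critical leaf `p` of a definite PIA tree. The resulting bound `w` of
`p` has no critical leaves, and its letters are `Ω`-smaller than `p`. -/
lemma CriticalTree.exists_bound {Ω : ℕ → ℕ → Prop} {ε : ℕ → Sgn} {p : ℕ} {s : Sgn}
    {t : Term L.star} (h : CriticalTree Ω ε p s t) {Φ : Sgn × ℕ → Prop}
    (hΦ : ∀ y, t.Occurs y → Ω y p → Φ (ε y, y)) (x : Term L.star) (hx : SkeletonOver IsVar s x)
    (hx' : ∀ l ∈ x.leaves s, Φ l) :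
    ∃ w, Relation.ReflTransGen Residuate (Ineq.ofSign s x t) (Ineq.bound (ε p).flip p w) ∧
      SkeletonOver IsVar (ε p) w ∧ ∀ l ∈ w.leaves (ε p), Φ l := by
  induction h generalizing x with
  | var => exact ⟨x, by rw [Ineq.ofSign_var_right], hx, hx'⟩
  | @node s c a i hb hc _ hside ih =>
    have hocc : ∀ j y, (a j).Occurs y → Term.Occurs y (.node c a : Term L.star) := by
      intro j y hy
      obtain ⟨s', hy⟩ := (Term.occurs_iff (s.mul (c.eps j))).1 hy
      exact (Term.occurs_iff s).2 ⟨s', Tm.mem_leaves_node.2 ⟨j, hy⟩⟩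
    obtain ⟨w, hw, hres⟩ := hb.exists_residual hc a i x
    have hw' : ∀ l ∈ w.leaves (s.mul (c.eps i)), Φ l := by
      rintro ⟨s', y⟩ hl
      rcases hres.leaves _ hl with hl | ⟨h, hh, hl⟩
      · exact hx' _ hl
      · obtain ⟨-, hopp, hbelow⟩ := hside h hh
        obtain rfl := Sgn.flip_injective (hopp _ _ (Tm.mem_leaves_flip.1 hl))
        have hy : (a h).Occurs y := (Term.occurs_iff _).2 ⟨_, hl⟩
        exact hΦ y (hocc h y hy) (hbelow y hy)
    obtain ⟨w', h₁, h₂⟩ := ih (fun y hy => hΦ y (hocc i y hy)) w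
      (hres.skeletonOver _ hx fun h hh => (hside h hh).1) hw'
    exact ⟨w', .head hw h₁, h₂⟩

end Residuation

/-! ### Reductions to quasi-special rules -/

section Reduction

variable {L : Lang.{u}}

lemma ALBAReduces.context {Q Q' : List (QIneq L.star)} (h : ALBAReduces Q Q')
    (A B : List (QIneq L.star)) : ALBAReduces (A ++ Q ++ B) (A ++ Q' ++ B) := by
  induction h with
  | refl => exact .refl
  | tail _ h ih =>
    obtain ⟨Q₁, q, Q₂, qs, rfl, hq, rfl⟩ := h
    exact ih.tail ⟨A ++ Q₁, q, Q₂ ++ B, qs, by simp, hq, by simp⟩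

/-- The system `Q` is transformed by an ALBA reduction into a finite set of quasi-special rules. -/
def ReducesToRules (Q : List (QIneq L.star)) : Prop :=
  ∃ R : List (Rule L ℕ), (∀ r ∈ R, r.Sided ∧ r.QuasiSpecial) ∧
    ALBAReduces Q (R.map Rule.toQIneq)

namespace ReducesToRules

lemma of_reduces {Q Q' : List (QIneq L.star)} (h : ALBAReduces Q Q') (h' : ReducesToRules Q') :
    ReducesToRules Q :=
  let ⟨R, h₁, h₂⟩ := h'
  ⟨R, h₁, h.trans h₂⟩

/-- The members of a system can be reduced one after the other. -/
lemma of_forall {Q : List (QIneq L.star)} (h : ∀ q ∈ Q, ReducesToRules [q]) :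
    ReducesToRules Q := by
  induction Q with
  | nil => exact ⟨[], by simp, .refl⟩
  | cons q Q ih =>
    obtain ⟨R, h₁, h₂⟩ := h q List.mem_cons_self
    obtain ⟨R', h₁', h₂'⟩ := ih fun q hq => h q (List.mem_cons_of_mem _ hq)
    refine ⟨R ++ R', fun r hr => (List.mem_append.1 hr).elim (h₁ r) (h₁' r), ?_⟩
    have h₃ := h₂.context [] Q
    have h₄ := h₂'.context (R.map Rule.toQIneq) []
    simp only [List.nil_append, List.append_nil, List.singleton_append] at h₃ h₄
    rw [List.map_append]
    exact h₃.trans h₄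

lemma step {q : QIneq L.star} {qs : List (QIneq L.star)} (h : ALBAStep q qs)
    (h' : ∀ q' ∈ qs, ReducesToRules [q']) : ReducesToRules [q] :=
  of_reduces (.single ⟨[], q, [], qs, rfl, h, by simp⟩) (of_forall h')

/-- Replacement of the conclusion `s ≤ t` by `u ≤ t`, for the components `u` of the normal form of
`s`. -/
lemma of_normalizes_left {Φ : Term L.star → Prop} {ps : List (Ineq L.star)} {s t : Term L.star}
    (h : Normalizes Φ .pos s) (h' : ∀ u, Φ u → ReducesToRules [⟨ps, ⟨u, t⟩⟩]) :
    ReducesToRules [⟨ps, ⟨s, t⟩⟩] := by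
  obtain ⟨s', h₁, h₂⟩ := h
  induction h₁ using Relation.ReflTransGen.head_induction_on with
  | refl =>
    induction h₂ with
    | leaf h => exact h' _ h
    | bot => exact step (.concl ps _ _ (.dropBot t)) (by simp)
    | join _ _ ih ih' =>
      exact step (.concl ps _ _ (.splitJoin _ _ t)) (by simp [ih, ih'])
  | head h _ ih => exact step (.concl ps _ _ (.left _ _ t h)) (by simp [ih])

lemma of_normalizes_right {Φ : Term L.star → Prop} {ps : List (Ineq L.star)} {s t : Term L.star}
    (h : Normalizes Φ .neg t) (h' : ∀ u, Φ u → ReducesToRules [⟨ps, ⟨s, u⟩⟩]) :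
    ReducesToRules [⟨ps, ⟨s, t⟩⟩] := by
  obtain ⟨t', h₁, h₂⟩ := h
  induction h₁ using Relation.ReflTransGen.head_induction_on with
  | refl =>
    induction h₂ with
    | leaf h => exact h' _ h
    | bot => exact step (.concl ps _ _ (.dropTop s)) (by simp)
    | join _ _ ih ih' =>
      exact step (.concl ps _ _ (.splitMeet s _ _)) (by simp [ih, ih'])
  | head h _ ih => exact step (.concl ps _ _ (.right s _ _ h)) (by simp [ih])

/-- In every quasi-inequality with the conclusion `c`, the premise `e` can be replaced by a list of
premises that satisfy `F`, as far as reducibility to rules is concerned. -/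
def Replaces (c : Ineq L.star) (e : Ineq L.star) (F : Ineq L.star → Prop) : Prop :=
  ∀ ps ps' : List (Ineq L.star),
    (∀ es : List (Ineq L.star), (∀ e' ∈ es, F e') → ReducesToRules [⟨ps ++ es ++ ps', c⟩]) →
    ReducesToRules [⟨ps ++ e :: ps', c⟩]

lemma of_replaces {c : Ineq L.star} {E F : Ineq L.star → Prop} (h : ∀ e, E e → Replaces c e F)
    {es : List (Ineq L.star)} (hes : ∀ e ∈ es, E e)
    (hF : ∀ es' : List (Ineq L.star), (∀ e' ∈ es', F e') → ReducesToRules [⟨es', c⟩]) :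
    ReducesToRules [⟨es, c⟩] := by
  suffices H : ∀ done : List (Ineq L.star), (∀ e ∈ done, F e) →
      ReducesToRules [⟨done ++ es, c⟩] from H [] (by simp)
  induction es with
  | nil => simpa using hF
  | cons e es ih =>
    intro done hdone
    refine h e (hes e List.mem_cons_self) done es fun es' hes' => ?_
    refine ih (fun e' he' => hes e' (List.mem_cons_of_mem _ he')) (done ++ es') ?_
    simpa [or_imp, forall_and] using ⟨hdone, hes'⟩

lemma Replaces.of_residuate {c e e' : Ineq L.star} {F : Ineq L.star → Prop}
    (h : Relation.ReflTransGen Residuate e e') (h' : F e') : Replaces c e F := by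
  intro ps ps' H
  induction h using Relation.ReflTransGen.head_induction_on with
  | refl => simpa using H [e'] (by simpa using h')
  | head h _ ih => exact step (.residuation ps ps' _ _ c h) (by simpa using ih)

/-- A premise that bounds a variable by `t` is replaced by the bounds by the components of the
normal form of `t`. -/
lemma Replaces.of_normalizes {c : Ineq L.star} {Φ : Term L.star → Prop} {s : Sgn} {x : ℕ}
    {t : Term L.star} (h : Normalizes Φ s.flip t) :
    Replaces c (Ineq.bound s x t) fun e => ∃ u, Φ u ∧ e = Ineq.bound s x u := by
  intro ps ps' H
  obtain ⟨t', h₁, h₂⟩ := h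
  induction h₁ using Relation.ReflTransGen.head_induction_on with
  | refl =>
    induction h₂ generalizing ps ps' with
    | @leaf u h => simpa using H [Ineq.bound s x u] (by simpa using ⟨u, h, rfl⟩)
    | bot =>
      have hs : Simplify (Ineq.bound s x (Term.botOf s.flip) : Ineq L.star) [] := by
        cases s
        · exact .dropTop _
        · exact .dropBot _
      exact step (.prem ps ps' _ c _ hs) (by simpa using H [])
    | @join u u' _ _ ih ih' =>
      have hs : Simplify (Ineq.bound s x (Term.joinOf s.flip u u') : Ineq L.star)
          [Ineq.bound s x u, Ineq.bound s x u'] := by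
        cases s
        · exact .splitMeet _ _ _
        · exact .splitJoin _ _ _
      refine step (.prem ps ps' _ c _ hs) ?_
      simp only [List.mem_singleton, forall_eq, List.append_assoc, List.cons_append,
        List.nil_append]
      refine ih ps _ fun es hes => ?_
      refine ih' (ps ++ es) ps' fun es' hes' => ?_
      rw [List.append_assoc ps]
      exact H (es ++ es') fun e he => (List.mem_append.1 he).elim (hes e) (hes' e)
  | @head u u' h _ ih =>
    have hs : Simplify (Ineq.bound s x u : Ineq L.star) [Ineq.bound s x u'] := by
      cases s
      · exact .right _ _ _ h
      · exact .left _ _ _ h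
    exact step (.prem ps ps' _ c _ hs) (by simpa using ih)

end ReducesToRules

/-- The join of a list for `pos`, the meet for `neg`. -/
def Term.bigJoinOf : Sgn → List (Term L) → Term L
  | .pos => Term.bigJoin
  | .neg => Term.bigMeet

lemma Term.bigJoinOf_nil (s : Sgn) : Term.bigJoinOf s ([] : List (Term L)) = Term.botOf s := by
  cases s <;> rfl

lemma Term.bigJoinOf_singleton (s : Sgn) (a : Term L) : Term.bigJoinOf s [a] = a := by
  cases s <;> rfl

lemma Term.bigJoinOf_cons_cons (s : Sgn) (a b : Term L) (l : List (Term L)) :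
    Term.bigJoinOf s (a :: b :: l) = Term.joinOf s a (Term.bigJoinOf s (b :: l)) := by
  cases s <;> rfl

lemma Term.joinTree_bigJoinOf (s : Sgn) (as : List (Term L)) :
    JoinTree (· ∈ as) s (Term.bigJoinOf s as) := by
  induction as using Term.bigJoin.induct with
  | case1 => rw [Term.bigJoinOf_nil]; exact .bot
  | case2 => rw [Term.bigJoinOf_singleton]; exact .leaf (by simp)
  | case3 a b l ih =>
    rw [Term.bigJoinOf_cons_cons]
    exact .join (.leaf List.mem_cons_self) (ih.mono fun t ht => List.mem_cons_of_mem _ ht)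

lemma Tm.mem_leaves_joinOf {s s₁ s' : Sgn} {t t' : Term L} {x : ℕ}
    (h : (s', x) ∈ (Term.joinOf s₁ t t').leaves s) :
    (s', x) ∈ t.leaves s ∨ (s', x) ∈ t'.leaves s := by
  cases s₁ <;> obtain ⟨i, hi⟩ := Tm.mem_leaves_node.1 h <;>
  · match i with
    | 0 => exact .inl (by simpa using hi)
    | 1 => exact .inr (by simpa using hi)

lemma JoinTree.exists_mem_leaves {Φ : Term L → Prop} {s s₁ s' : Sgn} {t : Term L} {x : ℕ}
    (h : JoinTree Φ s₁ t) (hx : (s', x) ∈ t.leaves s) : ∃ u, Φ u ∧ (s', x) ∈ u.leaves s := by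
  induction h with
  | leaf h => exact ⟨_, h, hx⟩
  | bot => cases s₁ <;> obtain ⟨i, -⟩ := Tm.mem_leaves_node.1 hx <;> exact i.elim0
  | join _ _ ih ih' => exact (Tm.mem_leaves_joinOf hx).elim ih ih'

lemma SkeletonOver.subst {Q : Sgn → Term L → Prop} {s : Sgn} {t : Term L} {τ : ℕ → Term L}
    (h : SkeletonOver IsVar s t) (hτ : ∀ s' x, (s', x) ∈ t.leaves s → SkeletonOver Q s' (τ x)) :
    SkeletonOver Q s (t.subst τ) := by
  induction h with
  | @leaf s t h =>
    obtain ⟨x, rfl⟩ := h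
    exact hτ s x (by simp [Tm.leaves])
  | node hc _ ih =>
    exact .node hc fun i => ih i fun s' x hx => hτ s' x (Tm.mem_leaves_node.2 ⟨i, hx⟩)

/-- The two Ackermann rules in one: `s` is the sign of the occurrences of `p` in the other premises
`e`, in the generation trees `+e.lhs` and `−e.rhs`. -/
lemma ALBAStep.ackermann (s : Sgn) (p : ℕ) (as : List (Term L.star))
    (ps rest : List (Ineq L.star)) (c : Ineq L.star)
    (hperm : ps.Perm (as.map (Ineq.bound s.flip p) ++ rest)) (has : ∀ a ∈ as, ¬ Term.Occurs p a)
    (hrest : ∀ e ∈ rest, (s.flip, p) ∉ e.leaves) (hc : p ∉ c.leaves.map Prod.snd) :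
    ALBAStep ⟨ps, c⟩ [⟨rest.map (Ineq.subst1 p (Term.bigJoinOf s as)), c⟩] := by
  have h₁ : ¬ Term.Occurs p c.lhs := fun h => hc (by
    obtain ⟨s', h⟩ := (Term.occurs_iff .pos).1 h
    exact List.mem_map.2 ⟨_, List.mem_append_left _ h, rfl⟩)
  have h₂ : ¬ Term.Occurs p c.rhs := fun h => hc (by
    obtain ⟨s', h⟩ := (Term.occurs_iff .neg).1 h
    exact List.mem_map.2 ⟨_, List.mem_append_right _ h, rfl⟩)
  cases s
  · refine .rightAckermann p as ps rest c hperm has (fun e he => ?_) h₁ h₂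
    have := hrest e he
    simp only [Ineq.leaves, List.mem_append, not_or] at this
    exact ⟨this.1, fun h => this.2 ((Tm.mem_leaves_flip (s := .pos)).2 h)⟩
  · refine .leftAckermann p as ps rest c hperm has (fun e he => ?_) h₁ h₂
    have := hrest e he
    simp only [Ineq.leaves, List.mem_append, not_or] at this
    exact ⟨this.1, fun h => this.2 ((Tm.mem_leaves_flip (s := .pos)).2 h)⟩

end Reduction

/-! ### Elimination of the letters from the premises -/

section Elimination

variable {L : Lang.{u}}

/-- The leaves allowed in a bound: non-critical occurrences of the letters in `M`, and structural
variables in `C` with the sign that they have in the sequent `q`. -/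
def AdmissibleLeaf (ε : ℕ → Sgn) (q : Seqt L ℕ) (C : Set ℕ) (M : Finset ℕ) (l : Sgn × ℕ) : Prop :=
  (l.2 ∈ M ∧ l.1 = ε l.2) ∨ (l ∈ q.leaves ∧ l.2 ∈ C)

/-- The premises `Ineq.bound s x t` that arise in the elimination of the letters in `M`. They bound
either a structural variable outside `C`, or a critical occurrence of a letter `x`; in the latter
case, the letters of the bound are `Ω`-smaller than `x`. -/
structure AdmissibleBound (Ω : ℕ → ℕ → Prop) (ε : ℕ → Sgn) (q : Seqt L ℕ) (C : Set ℕ)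
    (M : Finset ℕ) (s : Sgn) (x : ℕ) (t : Term L.star) : Prop where
  skeletonOver : SkeletonOver IsVar s.flip t
  leaves : ∀ l ∈ t.leaves s.flip, AdmissibleLeaf ε q C M l
  var : ((s, x) ∈ q.leaves ∧ x ∉ C) ∨
    (x ∈ M ∧ s = (ε x).flip ∧ ∀ z ∈ M, t.Occurs z → Ω z x)

lemma exists_list_map_eq {X Y : Type*} (f : X → Y) (P : X → Prop) {l : List Y}
    (h : ∀ y ∈ l, ∃ x, P x ∧ y = f x) : ∃ l' : List X, (∀ x ∈ l', P x) ∧ l = l'.map f := by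
  induction l with
  | nil => exact ⟨[], by simp, rfl⟩
  | cons y l ih =>
    obtain ⟨x, hx, rfl⟩ := h y List.mem_cons_self
    obtain ⟨l', hl', rfl⟩ := ih fun y hy => h y (List.mem_cons_of_mem _ hy)
    exact ⟨x :: l', by simpa using ⟨hx, hl'⟩, rfl⟩

lemma Ineq.mem_leaves_bound {s s' : Sgn} {x y : ℕ} {t : Term L} :
    (s', y) ∈ (Ineq.bound s x t).leaves ↔ (s' = s ∧ y = x) ∨ (s', y) ∈ t.leaves s.flip := by
  cases s <;> simp [Ineq.bound, Ineq.leaves, Tm.leaves, or_comm]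

lemma Ineq.subst1_bound {s : Sgn} {p x : ℕ} {a t : Term L} (h : x ≠ p) :
    Ineq.subst1 p a (Ineq.bound s x t) = Ineq.bound s x (Term.subst1 p a t) := by
  cases s <;> simp [Ineq.subst1, Ineq.bound, Term.subst1, Tm.subst, h]

lemma Rule.mem_leaves_displayed {s s' : Sgn} {x y : ℕ} {U : Str L ℕ} :
    (s', y) ∈ (Rule.displayed s x U).leaves ↔ (s' = s ∧ y = x) ∨ (s', y) ∈ U.leaves s.flip := by
  cases s <;> simp [Rule.displayed, Seqt.leaves, Tm.leaves, or_comm]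

lemma Rule.toIneq_displayed (s : Sgn) (x : ℕ) (U : Str L ℕ) :
    (Rule.displayed s x U).toIneq = Ineq.bound s x (U.toTerm s.flip) := by
  cases s <;> simp [Rule.displayed, Seqt.toIneq, Ineq.bound, Str.toTerm]

variable {q : Seqt L ℕ}

/-- Premises without letters are brought into normal form, and then they are readings of the
premises of a quasi-special rule. -/
lemma reducesToRules_of_no_letters {Ω : ℕ → ℕ → Prop} {ε : ℕ → Sgn} {C : Set ℕ}
    (hq : q.Sided) (hnd : (q.leaves.map Prod.snd).Nodup) {es : List (Ineq L.star)}
    (hes : ∀ e ∈ es, ∃ s x t, AdmissibleBound Ω ε q C ∅ s x t ∧ e = Ineq.bound s x t) :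
    ReducesToRules [⟨es, q.toIneq⟩] := by
  let P : Sgn × ℕ × Str L ℕ → Prop := fun d =>
    (d.1, d.2.1) ∈ q.leaves ∧ d.2.1 ∉ C ∧ d.2.2.Sided d.1.flip ∧
      ∀ l ∈ d.2.2.leaves d.1.flip, l ∈ q.leaves ∧ l.2 ∈ C
  refine ReducesToRules.of_replaces (F := fun e => ∃ d, P d ∧
    e = (Rule.displayed d.1 d.2.1 d.2.2).toIneq) ?_ hes fun es' hes' => ?_
  · rintro _ ⟨s, x, t, h, rfl⟩
    intro ps ps' H
    refine ReducesToRules.Replaces.of_normalizes h.skeletonOver.normalizes ps ps' fun es hes => ?_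
    refine H es fun e he => ?_
    obtain ⟨u, hu, rfl⟩ := hes e he
    obtain ⟨U, hU₁, hU₂, hU₃⟩ := hu.operatorOver.exists_structure
    have hx : (s, x) ∈ q.leaves ∧ x ∉ C := by
      simpa using h.var
    refine ⟨(s, x, U), ⟨hx.1, hx.2, hU₁, ?_⟩, ?_⟩
    · rintro ⟨s', y⟩ hl
      have := h.leaves _ (hu.leaves_subset (hU₃ ▸ hl))
      simpa [AdmissibleLeaf] using this
    · rw [Rule.toIneq_displayed, hU₂]
  · obtain ⟨ds, hds, rfl⟩ := exists_list_map_eq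
      (fun d : Sgn × ℕ × Str L ℕ => (Rule.displayed d.1 d.2.1 d.2.2).toIneq) P hes'
    let r : Rule L ℕ := ⟨ds.map fun d => Rule.displayed d.1 d.2.1 d.2.2, q⟩
    have hr : r.Linear := by
      refine ⟨hnd, fun q' hq' => ?_⟩
      obtain ⟨d, hd, rfl⟩ := List.mem_map.1 hq'
      rintro ⟨s', y⟩ hl
      rcases Rule.mem_leaves_displayed.1 hl with ⟨rfl, rfl⟩ | hl
      · exact (hds d hd).1
      · exact ((hds d hd).2.2.2 _ hl).1
    refine ⟨[r], ?_, ?_⟩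
    · simp only [List.mem_singleton, forall_eq]
      refine ⟨⟨fun q' hq' => ?_, hq⟩, hr.analytic, ds, rfl, fun d hd => ⟨(hds d hd).1, ?_, ?_⟩⟩
      · obtain ⟨⟨s, x, U⟩, hd, rfl⟩ := List.mem_map.1 hq'
        have := (hds _ hd).2.2.1
        cases s
        · exact ⟨trivial, this⟩
        · exact ⟨this, trivial⟩
      · exact List.count_eq_one_of_mem hnd (List.mem_map.2 ⟨_, (hds d hd).1, rfl⟩)
      · intro d' hd' hmem
        obtain ⟨s', hs'⟩ := (Tm.mem_vars d'.1.flip).1 hmem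
        exact (hds d hd).2.1 ((hds d' hd').2.2.2 _ hs').2
    · have : r.toQIneq = ⟨ds.map fun d => (Rule.displayed d.1 d.2.1 d.2.2).toIneq, q.toIneq⟩ := by
        simp [r, Rule.toQIneq, Function.comp_def]
      rw [List.map_singleton, this]
      exact .refl

/-- Substitution of the join of the bounds of `p` for `p` in a bound of another variable. -/
lemma AdmissibleBound.subst1 {Ω : ℕ → ℕ → Prop} {ε : ℕ → Sgn} {C : Set ℕ} {M : Finset ℕ} {s : Sgn}
    {x p : ℕ} {t b : Term L.star} {Φ : Term L.star → Prop} (h : AdmissibleBound Ω ε q C M s x t)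
    (hp : p ∈ M) (hM : ∀ l ∈ q.leaves, l.2 ∉ M) (hb : JoinTree Φ (ε p) b)
    (hΦ : ∀ a, Φ a → SkeletonOver IsVar (ε p) a ∧
      ∀ l ∈ a.leaves (ε p), l ∈ q.leaves ∧ l.2 ∈ C) (hx : x ≠ p) :
    AdmissibleBound Ω ε q C (M.erase p) s x (Term.subst1 p b t) := by
  have hleaf : ∀ s' z, (s', z) ∈ (Term.subst1 p b t).leaves s.flip →
      (z ≠ p ∧ (s', z) ∈ t.leaves s.flip) ∨ ((s', z) ∈ q.leaves ∧ z ∈ C) := by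
    intro s' z hz
    obtain ⟨s₁, y, hy, hz⟩ := Tm.mem_leaves_subst.1 hz
    by_cases hyp : y = p
    · subst hyp
      rw [if_pos rfl] at hz
      right
      have hs : s₁ = ε y := by
        rcases h.leaves _ hy with h | h
        · exact h.2
        · exact absurd hp (hM _ h.1)
      subst hs
      obtain ⟨u, hu, hz⟩ := hb.exists_mem_leaves hz
      exact (hΦ u hu).2 _ hz
    · rw [if_neg hyp] at hz
      obtain ⟨rfl, rfl⟩ := Tm.mem_leaves_var.1 hz
      exact .inl ⟨hyp, hy⟩
  refine ⟨h.skeletonOver.subst fun s' y hy => ?_, ?_, ?_⟩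
  · by_cases hyp : y = p
    · subst hyp
      rw [if_pos rfl]
      have hs : s' = ε y := by
        rcases h.leaves _ hy with h | h
        · exact h.2
        · exact absurd hp (hM _ h.1)
      subst hs
      exact hb.skeletonOver fun u hu => (hΦ u hu).1
    · rw [if_neg hyp]
      exact .leaf ⟨y, rfl⟩
  · rintro ⟨s', z⟩ hz
    rcases hleaf s' z hz with ⟨hzp, hz⟩ | hz
    · exact (h.leaves _ hz).imp_left fun h => ⟨Finset.mem_erase.2 ⟨hzp, h.1⟩, h.2⟩
    · exact .inr hz
  · refine h.var.imp_right fun ⟨h₁, h₂, h₃⟩ =>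
      ⟨Finset.mem_erase.2 ⟨hx, h₁⟩, h₂, fun z hz hocc => ?_⟩
    have hzM := Finset.mem_of_mem_erase hz
    obtain ⟨s', hs'⟩ := (Term.occurs_iff s.flip).1 hocc
    rcases hleaf s' z hs' with ⟨-, hz⟩ | hz
    · exact h₃ z hzM ((Term.occurs_iff _).2 ⟨_, hz⟩)
    · exact absurd hzM (hM _ hz.1)

/-- The letters are eliminated by the Ackermann rules, in an order that extends `Ω`: the bounds of
an `Ω`-minimal letter contain structural variables only. -/
lemma reducesToRules_of_admissibleBound {Ω : ℕ → ℕ → Prop} (hirrefl : ∀ x, ¬ Ω x x)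
    (htrans : ∀ x y z, Ω x y → Ω y z → Ω x z) {ε : ℕ → Sgn} {C : Set ℕ}
    (hq : q.Sided) (hnd : (q.leaves.map Prod.snd).Nodup) (hleaves : q.toIneq.leaves = q.leaves)
    (M : Finset ℕ) (hM : ∀ l ∈ q.leaves, l.2 ∉ M) {es : List (Ineq L.star)}
    (hes : ∀ e ∈ es, ∃ s x t, AdmissibleBound Ω ε q C M s x t ∧ e = Ineq.bound s x t) :
    ReducesToRules [⟨es, q.toIneq⟩] := by
  induction hn : M.card generalizing M es with
  | zero =>
    obtain rfl := Finset.card_eq_zero.1 hn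
    exact reducesToRules_of_no_letters hq hnd hes
  | succ n ih =>
    have hne : M.Nonempty := Finset.card_pos.1 (by omega)
    obtain ⟨p, hpM, hmin⟩ : ∃ p ∈ M, ∀ z ∈ M, ¬ Ω z p := by
      have : IsStrictOrder ℕ Ω := { irrefl := hirrefl, trans := htrans }
      obtain ⟨p, -, hp⟩ := (M.finite_toSet.wellFoundedOn (r := Ω)).has_min Set.univ
        ⟨⟨_, hne.choose_spec⟩, trivial⟩
      exact ⟨p, p.2, fun z hz => hp ⟨z, hz⟩ trivial⟩
    obtain ⟨ds, hds, rfl⟩ := exists_list_map_eq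
      (fun d : Sgn × ℕ × Term L.star => Ineq.bound d.1 d.2.1 d.2.2)
      (fun d => AdmissibleBound Ω ε q C M d.1 d.2.1 d.2.2)
      fun e he => by
        obtain ⟨s, x, t, h, rfl⟩ := hes e he
        exact ⟨(s, x, t), h, rfl⟩
    -- The premises that bound `p`, and the other ones.
    let A := ds.filter fun d => decide (d.2.1 = p)
    let B := ds.filter fun d => !decide (d.2.1 = p)
    have hA : ∀ d ∈ A, d.2.1 = p ∧ d.1 = (ε p).flip ∧ SkeletonOver IsVar (ε p) d.2.2 ∧
        ∀ l ∈ d.2.2.leaves (ε p), l ∈ q.leaves ∧ l.2 ∈ C := by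
      rintro ⟨s, x, t⟩ hd
      obtain ⟨hd', hx⟩ := List.mem_filter.1 hd
      obtain rfl : x = p := by simpa using hx
      have h := hds _ hd'
      obtain ⟨hs, hlt⟩ : s = (ε x).flip ∧ ∀ z ∈ M, t.Occurs z → Ω z x :=
        (h.var.resolve_left fun h' => hM _ h'.1 hpM).2
      subst hs
      have h₁ := h.skeletonOver
      have h₂ := h.leaves
      simp only [Sgn.flip_flip] at h₁ h₂
      refine ⟨rfl, rfl, h₁, ?_⟩
      rintro ⟨s', z⟩ hl
      -- A letter in a bound of `p` would be `Ω`-smaller than `p`.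
      refine (h₂ _ hl).resolve_left fun h' => ?_
      exact hmin z h'.1 (hlt z h'.1 ((Term.occurs_iff _).2 ⟨s', hl⟩))
    have hB : ∀ d ∈ B, d.2.1 ≠ p ∧ AdmissibleBound Ω ε q C M d.1 d.2.1 d.2.2 := by
      intro d hd
      obtain ⟨hd, hx⟩ := List.mem_filter.1 hd
      exact ⟨by simpa using hx, hds d hd⟩
    let as := A.map fun d => d.2.2
    have has : ∀ a ∈ as, SkeletonOver IsVar (ε p) a ∧
        ∀ l ∈ a.leaves (ε p), l ∈ q.leaves ∧ l.2 ∈ C := by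
      intro a ha
      obtain ⟨d, hd, rfl⟩ := List.mem_map.1 ha
      exact (hA d hd).2.2
    have hstep := ALBAStep.ackermann (ε p) p as
      (ds.map fun d => Ineq.bound d.1 d.2.1 d.2.2) (B.map fun d => Ineq.bound d.1 d.2.1 d.2.2)
      q.toIneq ?_ ?_ ?_ ?_
    · refine ReducesToRules.step hstep ?_
      simp only [List.mem_singleton, forall_eq]
      refine ih (M.erase p) (fun l hl h => hM l hl (Finset.mem_of_mem_erase h)) ?_
        (by rw [Finset.card_erase_of_mem hpM]; omega)
      intro e he
      simp only [List.map_map, List.mem_map, Function.comp_apply] at he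
      obtain ⟨⟨s, x, t⟩, hd, rfl⟩ := he
      obtain ⟨hxp, hd⟩ := hB _ hd
      refine ⟨s, x, Term.subst1 p (Term.bigJoinOf (ε p) as) t, ?_, Ineq.subst1_bound hxp⟩
      exact hd.subst1 hpM hM (Term.joinTree_bigJoinOf (ε p) as) has hxp
    · rw [List.map_map]
      have : A.map (Ineq.bound (ε p).flip p ∘ fun d => d.2.2) =
          A.map fun d => Ineq.bound d.1 d.2.1 d.2.2 := by
        refine List.map_congr_left fun d hd => ?_
        obtain ⟨h₁, h₂, -⟩ := hA d hd
        simp [h₁, h₂]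
      rw [this, ← List.map_append]
      exact ((List.filter_append_perm _ ds).map _).symm
    · intro a ha hocc
      obtain ⟨s', hs'⟩ := (Term.occurs_iff (ε p)).1 hocc
      exact hM _ ((has a ha).2 _ hs').1 hpM
    · intro e he hmem
      obtain ⟨d, hd, rfl⟩ := List.mem_map.1 he
      obtain ⟨hxp, hd⟩ := hB d hd
      rcases Ineq.mem_leaves_bound.1 hmem with ⟨-, h⟩ | h
      · exact hxp h.symm
      · rcases hd.leaves _ h with ⟨-, h⟩ | ⟨h, -⟩
        · exact Sgn.flip_ne _ h
        · exact hM _ h hpM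
    · rw [hleaves]
      intro h
      obtain ⟨l, hl, rfl⟩ := List.mem_map.1 h
      exact hM l hl hpM

end Elimination

/-! ### From analytic inductive inequalities to rules -/

section Main

variable {L : Lang.{u}}

/-- Trees of PIA nodes over letters smaller than `N` that either have no critical leaf or can be
residuated along their only critical branch. -/
structure DefinitePIA (Ω : ℕ → ℕ → Prop) (ε : ℕ → Sgn) (N : ℕ) (s : Sgn) (t : Term L.star) :
    Prop where
  skeletonOver : SkeletonOver IsVar s.flip t
  critical : OppUniform ε s t ∨ ∃ p, CriticalTree Ω ε p s t
  lt : ∀ x, t.Occurs x → x < N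

lemma Term.exists_bound (t : Term L) : ∃ N, ∀ x, t.Occurs x → x < N := by
  obtain ⟨N, hN⟩ := (List.finite_toSet ((t.leaves .pos).map Prod.snd)).bddAbove
  exact ⟨N + 1, fun x hx => Nat.lt_succ_of_le (hN hx)⟩

/-- The maximal PIA subtrees are brought into normal form within the whole tree. Their conjunctions
(in negative position, disjunctions) thereby become a part of the Skeleton, so that each variable
that is introduced for a PIA subtree later on bounds a single definite tree. -/
lemma SkeletonOver.exists_definite {Ω : ℕ → ℕ → Prop} {ε : ℕ → Sgn} {N : ℕ} {s : Sgn}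
    {t : Term L.star} (h : SkeletonOver (PIATree Ω ε) s t) (hN : ∀ x, t.Occurs x → x < N) :
    ∃ t', Relation.ReflTransGen Rewrite t t' ∧ SkeletonOver (DefinitePIA Ω ε N) s t' := by
  induction h with
  | @leaf s t h =>
    obtain ⟨t', h₁, h₂⟩ := h.skeletonOver.normalizes
    refine ⟨t', h₁, h₂.skeletonOver fun u hu => .leaf ⟨hu.operatorOver.skeletonOver,
      h.disjunct hu, fun x hx => hN x ?_⟩⟩
    obtain ⟨s', hx⟩ := (Term.occurs_iff s.flip).1 hx
    exact (Term.occurs_iff _).2 ⟨s', hu.leaves_subset hx⟩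
  | @node s c a hc _ ih =>
    have hN' : ∀ i x, (a i).Occurs x → x < N := by
      intro i x hx
      obtain ⟨s', hx⟩ := (Term.occurs_iff (s.mul (c.eps i))).1 hx
      exact hN x ((Term.occurs_iff s).2 ⟨s', Tm.mem_leaves_node.2 ⟨i, hx⟩⟩)
    choose b hb hb' using fun i => ih i (hN' i)
    exact ⟨.node c b, Rewrite.star_node c hb, .node hc hb'⟩

/-- The premise that bounds the variable of a definite PIA tree: if the tree has a critical leaf,
then this leaf is displayed by residuation. -/
lemma DefinitePIA.replaces {Ω : ℕ → ℕ → Prop} {ε : ℕ → Sgn} {N : ℕ} {q : Seqt L ℕ} {C : Set ℕ}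
    (hM : ∀ l ∈ q.leaves, l.2 ∉ Finset.range N) {s : Sgn} {x : ℕ} {t : Term L.star}
    (h : DefinitePIA Ω ε N s t) (hx : (s, x) ∈ q.leaves)
    (hC : x ∈ C ↔ ∃ p, CriticalTree Ω ε p s t) :
    ReducesToRules.Replaces q.toIneq (Ineq.bound s x t) fun e => ∃ s' y u,
      AdmissibleBound Ω ε q C (Finset.range N) s' y u ∧ e = Ineq.bound s' y u := by
  by_cases hcrit : ∃ p, CriticalTree Ω ε p s t
  · have hxC := hC.2 hcrit
    obtain ⟨p, hp⟩ := hcrit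
    obtain ⟨w, h₁, h₂, h₃⟩ := hp.exists_bound
      (Φ := fun l => (l.2 < N ∧ l.1 = ε l.2 ∧ Ω l.2 p) ∨ (l ∈ q.leaves ∧ l.2 ∈ C))
      (fun y hy hyp => .inl ⟨h.lt y hy, rfl, hyp⟩) (.var x) (.leaf ⟨x, rfl⟩) (by
        rintro ⟨s', y⟩ hl
        obtain ⟨rfl, rfl⟩ := Tm.mem_leaves_var.1 hl
        exact .inr ⟨hx, hxC⟩)
    rw [Ineq.ofSign_var] at h₁
    refine .of_residuate h₁ ⟨_, p, w, ⟨by rwa [Sgn.flip_flip], ?_, .inr ⟨?_, rfl, ?_⟩⟩, rfl⟩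
    · intro l hl
      rw [Sgn.flip_flip] at hl
      exact (h₃ l hl).imp_left fun h => ⟨Finset.mem_range.2 h.1, h.2.1⟩
    · exact Finset.mem_range.2 (h.lt p ((Term.occurs_iff s).2 ⟨_, hp.mem_leaves⟩))
    · intro z hz hocc
      obtain ⟨s', hs'⟩ := (Term.occurs_iff (ε p)).1 hocc
      rcases h₃ _ hs' with h | h
      · exact h.2.2
      · exact absurd hz (hM _ h.1)
  · refine .of_residuate .refl ⟨s, x, t, ⟨h.skeletonOver, ?_, .inl ⟨hx, fun hxC => ?_⟩⟩, rfl⟩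
    · rintro ⟨s', z⟩ hl
      have hz := h.critical.resolve_right hcrit _ _ (Tm.mem_leaves_flip.1 hl)
      exact .inl ⟨Finset.mem_range.2 (h.lt z ((Term.occurs_iff _).2 ⟨_, hl⟩)),
        Sgn.flip_injective hz⟩
    · exact hcrit (hC.1 hxC)

/-- An inequality between definite trees: the inverted Ackermann rule introduces a variable for each
of the PIA subtrees, and the premises are then turned into the premises of a rule. -/
lemma reducesToRules_of_operatorOver {Ω : ℕ → ℕ → Prop} (hirrefl : ∀ x, ¬ Ω x x)
    (htrans : ∀ x y z, Ω x y → Ω y z → Ω x z) {ε : ℕ → Sgn} {N : ℕ} {t t' : Term L.star}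
    (h : OperatorOver (DefinitePIA Ω ε N) .pos t) (h' : OperatorOver (DefinitePIA Ω ε N) .neg t') :
    ReducesToRules [⟨[], ⟨t, t'⟩⟩] := by
  classical
  -- Fresh variables of different parities keep the two sides apart.
  let f : ℕ → ℕ := fun x => N + 2 * x
  let f' : ℕ → ℕ := fun x => N + (2 * x + 1)
  have hff' : ∀ x ∈ Set.range f, x ∉ Set.range f' := by
    rintro _ ⟨z, rfl⟩ ⟨z', hz⟩
    simp only [f, f'] at hz
    omega
  obtain ⟨U, σ, hU₁, rfl, hU₂, hU₃, hU₄⟩ := h.exists_linear f fun x y h => by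
    simp only [f] at h; omega
  obtain ⟨U', σ', hU₁', rfl, hU₂', hU₃', hU₄'⟩ := h'.exists_linear f' fun x y h => by
    simp only [f'] at h; omega
  let τ : ℕ → Term L.star := fun x => if x ∈ Set.range f then σ x else σ' x
  let q : Seqt L ℕ := ⟨U, U'⟩
  have hleaves : q.toIneq.leaves = q.leaves := by
    simp only [q, Ineq.leaves, Seqt.toIneq, Seqt.leaves, hU₂, hU₂']
  have hτ : ∀ s x, (s, x) ∈ q.leaves → DefinitePIA Ω ε N s (τ x) ∧ N ≤ x := by
    intro s x hx
    rcases List.mem_append.1 hx with hx | hx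
    · obtain ⟨h₁, h₂⟩ := hU₄ s x hx
      simp only [τ, if_pos h₂]
      obtain ⟨z, rfl⟩ := h₂
      exact ⟨h₁, Nat.le_add_right _ _⟩
    · obtain ⟨h₁, h₂⟩ := hU₄' s x hx
      simp only [τ, if_neg fun h => hff' x h h₂]
      obtain ⟨z, rfl⟩ := h₂
      exact ⟨h₁, Nat.le_add_right _ _⟩
  have hnd : (q.leaves.map Prod.snd).Nodup := by
    simp only [q, Seqt.leaves, List.map_append]
    refine List.nodup_append'.2 ⟨hU₃, hU₃', fun x hx hx' => ?_⟩
    obtain ⟨⟨s, _⟩, h, rfl⟩ := List.mem_map.1 hx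
    obtain ⟨⟨s', _⟩, h', rfl⟩ := List.mem_map.1 hx'
    exact hff' _ (hU₄ _ _ h).2 (hU₄' _ _ h').2
  have hM : ∀ l ∈ q.leaves, l.2 ∉ Finset.range N := fun l hl hN =>
    absurd (Finset.mem_range.1 hN) (Nat.not_lt.2 (hτ l.1 l.2 hl).2)
  have hsubst : (⟨(U.toTerm .pos).subst σ, (U'.toTerm .neg).subst σ'⟩ : Ineq L.star) =
      ⟨q.toIneq.lhs.subst τ, q.toIneq.rhs.subst τ⟩ := by
    simp only [q, Seqt.toIneq]
    congr 1
    · refine Tm.subst_congr .pos fun s x hx => ?_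
      rw [hU₂] at hx
      exact (if_pos (hU₄ s x hx).2).symm
    · refine Tm.subst_congr .neg fun s x hx => ?_
      rw [hU₂'] at hx
      exact (if_neg fun h => hff' x h (hU₄' s x hx).2).symm
  rw [hsubst]
  refine ReducesToRules.step (.invertedAckermann q.toIneq τ (by rwa [hleaves]) ?_) ?_
  · rw [hleaves]
    intro x hx y hy hocc
    obtain ⟨⟨s, _⟩, hx', rfl⟩ := List.mem_map.1 hx
    obtain ⟨⟨s', _⟩, hy', rfl⟩ := List.mem_map.1 hy
    have h₁ := (hτ _ _ hy').1.lt _ hocc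
    have h₂ := (hτ _ _ hx').2
    omega
  · simp only [List.mem_singleton, forall_eq, hleaves]
    let C : Set ℕ := {x | ∃ s, (s, x) ∈ q.leaves ∧ ∃ p, CriticalTree Ω ε p s (τ x)}
    refine ReducesToRules.of_replaces (E := fun e => ∃ l ∈ q.leaves,
      e = Ineq.bound l.1 l.2 (τ l.2)) (F := fun e => ∃ s y u,
      AdmissibleBound Ω ε q C (Finset.range N) s y u ∧ e = Ineq.bound s y u) ?_ ?_ ?_
    · rintro _ ⟨⟨s, x⟩, hl, rfl⟩
      refine (hτ s x hl).1.replaces hM hl ⟨fun ⟨s', hl', hp⟩ => ?_, fun hp => ⟨s, hl, hp⟩⟩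
      have := List.inj_on_of_nodup_map hnd hl hl' rfl
      rwa [(Prod.mk.inj this).1]
    · intro e he
      obtain ⟨l, hl, rfl⟩ := List.mem_map.1 he
      exact ⟨l, hl, rfl⟩
    · intro es hes
      exact reducesToRules_of_admissibleBound hirrefl htrans ⟨hU₁, hU₁'⟩ hnd hleaves
        (Finset.range N) hM hes

/-- Analytic inductive inequalities reduce to quasi-special rules. -/
lemma Ineq.AnalyticInductive.reducesToRules {Ω : ℕ → ℕ → Prop} (hirrefl : ∀ x, ¬ Ω x x)
    (htrans : ∀ x y z, Ω x y → Ω y z → Ω x z) {ε : ℕ → Sgn} {s t : Term L}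
    (h : (Ineq.mk s t).AnalyticInductive Ω ε) : ReducesToRules [⟨[], ⟨s.emb, t.emb⟩⟩] := by
  obtain ⟨N₁, hN₁⟩ := Term.exists_bound s.emb
  obtain ⟨N₂, hN₂⟩ := Term.exists_bound t.emb
  obtain ⟨s', hs₁, hs₂⟩ := (AnalyticTree.skeletonOver h.1).exists_definite (N := max N₁ N₂)
    fun x hx => lt_max_of_lt_left (hN₁ x hx)
  obtain ⟨t', ht₁, ht₂⟩ := (AnalyticTree.skeletonOver h.2).exists_definite (N := max N₁ N₂)
    fun x hx => lt_max_of_lt_right (hN₂ x hx)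
  refine ReducesToRules.of_normalizes_left (.of_rewrite hs₁ hs₂.normalizes) fun u hu => ?_
  refine ReducesToRules.of_normalizes_right (.of_rewrite ht₁ ht₂.normalizes) fun u' hu' => ?_
  exact reducesToRules_of_operatorOver hirrefl htrans hu.operatorOver hu'.operatorOver

end Main

end DLE

/-- Every analytic `(Ω, ε)`-inductive inequality is transformed by an ALBA reduction into a finite
set of quasi-special structural rules of the display calculus that is equivalent to it on all
perfect algebras. -/
theorem mainTheorem1 (L : DLE.Lang.{u}) (Ω : ℕ → ℕ → Prop)
    (hirrefl : ∀ x, ¬ Ω x x) (htrans : ∀ x y z, Ω x y → Ω y z → Ω x z)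
    (ε : ℕ → DLE.Sgn) (s t : DLE.Term L)
    (h : (DLE.Ineq.mk s t).AnalyticInductive Ω ε) :
    ∃ R : List (DLE.Rule L ℕ),
      (∀ r ∈ R, r.Sided ∧ r.QuasiSpecial) ∧
      DLE.ALBAReduces [⟨[], ⟨s.emb, t.emb⟩⟩] (R.map DLE.Rule.toQIneq) ∧
      ∀ (A : Type w) [CompletelyDistribLattice A] (𝔸 : DLE.Alg L A), 𝔸.IsPerfect →
        ((DLE.Ineq.mk s t).Valid 𝔸 ↔ ∀ r ∈ R, r.Valid 𝔸) := by
  obtain ⟨R, hR, hred⟩ := h.reducesToRules hirrefl htrans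
  refine ⟨R, hR, hred, fun A _ 𝔸 h𝔸 => ?_⟩
  have := hred.valid_iff h𝔸.isResiduated
  simp only [List.mem_singleton, forall_eq, List.forall_mem_map] at this
  rw [← show _ ↔ ∀ r ∈ R, r.Valid 𝔸 from this]
  simp [DLE.QIneq.Valid, DLE.Ineq.Valid, DLE.Ineq.Holds, DLE.Alg.eval_emb]
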